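/- Let $1\le\alpha<2$, let $m_1,\dots,m_N>0$, $M=\sum_k m_k$, and let $0<R<(M/\alpha)^{1/\alpha}$. For centres $c_1,\dots,c_N\in\mathbb R^2$ put $V(x)=\sum_k \frac{m_k}{\alpha|x-c_k|^\alpha}$. The Jacobi metric is the Riemannian metric $(V(x)-1)\langle\cdot,\cdot\rangle$ on $\{x: V(x)>1,\ x\ne c_k\ \forall k\}$, and $L([0,T];y)=\int_0^T|\dot y|\sqrt{V(y)-1}\,dt$ is the Jacobi length. All solutions below are collisionless solutions of $\ddot y=\nabla V(y)$ on some $[0,T]$, $T>0$, with energy $\frac12|\dot y|^2-V(y)=-1$. For $\rho>0$ and $p_0,p_1\in\partial B_R(0)$, an outer solution from $p_0$ to $p_1$ is a solution with $y(0)=p_0$, $y(T)=p_1$, $|y(t)|>R$ for $t\in(0,T)$, and such that the angle between $\dot y(0)$ and $p_0$ is smaller than $\rho$. An open set $U$ is strongly convex if its closure lies in the region carrying the Jacobi metric and any two distinct points of $\overline U$ are joined by a unique (arc-length parametrized) geodesic of minimal Jacobi length, whose interior lies in $U$. There are $\rho>0$, $\delta_0>0$ and $\varepsilon_1>0$ such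 that, for every $\varepsilon\in(0,\varepsilon_1)$ and all centres with $|c_k|\le\varepsilon$, the following holds. (a) For all $p_0,p_1\in\partial B_R(0)$ with $|p_0-p_1|\le\delta_0$ there is exactly one outer solution $y_{\rm ext}(\cdot\,;p_0,p_1)$ from $p_0$ to $p_1$; let $[0,T_{\rm ext}(p_0,p_1)]$ be its domain. (b) If $U$ is strongly convex and $p\neq q$ are points of $\overline U$, the minimal geodesic from $p$ to $q$ has exactly one increasing reparametrization $\widetilde y(\cdot\,;p,q)$ that is a solution (with energy $-1$); let $[0,T(p,q)]$ be its domain. (c) Let $0<\delta\le\delta_0$, let $U$ be strongly convex, $\widetilde p\in U$ with $|\widetilde p|<R$, $\bar p\in\partial B_R(0)$, and $D=\{p\in\partial B_R(0)\cap\overline U:|\bar p-p|\le\delta\}$. Define on $D$ the functions $$G_{\rm even}(p)=L\big([0,T(\widetilde p,p)];\widetilde y(\cdot\,;\widetilde p,p)\big)+L\big([0,T_{\rm ext}(p,\bar p)];y_{\rm ext}(\cdot\,;p,\bar p)\big),$$ $$G_{\rm odd}(p)=L\big([0,T_{\rm ext}(\bar p,p)];y_{\rm ext}(\cdot\,;\bar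 p,p)\big)+L\big([0,T(p,\widetilde p)];\widetilde y(\cdot\,;p,\widetilde p)\big).$$ Both are differentiable (relative to $D$) at every $p\in D$, and for every $\varphi\in T_p(\partial B_R(0))$ their differentials are given by $$dG_{\rm even}(p)[\varphi]=\tfrac1{\sqrt2}\big\langle\dot{\widetilde y}(T(\widetilde p,p);\widetilde p,p)-\dot y_{\rm ext}(0;p,\bar p),\varphi\big\rangle,$$ $$dG_{\rm odd}(p)[\varphi]=\tfrac1{\sqrt2}\big\langle\dot y_{\rm ext}(T_{\rm ext}(\bar p,p);\bar p,p)-\dot{\widetilde y}(0;p,\widetilde p),\varphi\big\rangle.$$ -/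

import Mathlib

open Set Metric
open scoped RealInnerProductSpace

namespace NCentre

/-- The Euclidean plane. -/
abbrev Plane := EuclideanSpace ℝ (Fin 2)

/-- The potential `V(x) = ∑ₖ mₖ / (α |x - cₖ|^α)` of `N` centres `cₖ` with masses `mₖ`. -/
noncomputable def potential {N : ℕ} (α : ℝ) (m : Fin N → ℝ) (c : Fin N → Plane) (x : Plane) : ℝ :=
  ∑ k, m k / (α * ‖x - c k‖ ^ α)

/-- The open region carrying the Jacobi metric at energy `-1`, namely the Riemannian metric
`(V(x) - 1) ⟨·,·⟩`: the points that are not centres and at which `V > 1`. -/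
def jacobiRegion {N : ℕ} (α : ℝ) (m : Fin N → ℝ) (c : Fin N → Plane) : Set Plane :=
  {x | (∀ k, x ≠ c k) ∧ 1 < potential α m c x}

/-- The velocity at time `t` of a curve defined on `[0, T]` (one-sided at the end points). -/
noncomputable def velocity (T : ℝ) (y : ℝ → Plane) (t : ℝ) : Plane :=
  derivWithin y (Icc 0 T) t

/-- The Jacobi length `L([0,T]; y) = ∫₀ᵀ |y'| √(V(y) - 1) dt`. -/
noncomputable def jacobiLength {N : ℕ} (α : ℝ) (m : Fin N → ℝ) (c : Fin N → Plane)
    (T : ℝ) (y : ℝ → Plane) : ℝ :=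
  ∫ t in (0 : ℝ)..T, ‖velocity T y t‖ * Real.sqrt (potential α m c (y t) - 1)

/-- `y` is a collisionless classical solution on `[0, T]` of `y'' = ∇V(y)` with energy
`|y'|²/2 - V(y) = -1`. -/
def IsSolution {N : ℕ} (α : ℝ) (m : Fin N → ℝ) (c : Fin N → Plane)
    (T : ℝ) (y : ℝ → Plane) : Prop :=
  0 < T ∧ ∀ t ∈ Icc 0 T,
    (∀ k, y t ≠ c k) ∧
    DifferentiableWithinAt ℝ y (Icc 0 T) t ∧
    HasDerivWithinAt (velocity T y) (gradient (potential α m c) (y t)) (Icc 0 T) t ∧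
    ‖velocity T y t‖ ^ 2 / 2 - potential α m c (y t) = -1

/-- `y` on `[0, T]` is an outer solution from `p₀` to `p₁`: a solution with energy `-1` joining `p₀`
to `p₁`, outside the closed ball of radius `R` at intermediate times, whose initial velocity
forms an angle smaller than `ρ` with the outward radial direction `p₀`. -/
def IsOuterSolution {N : ℕ} (α : ℝ) (m : Fin N → ℝ) (c : Fin N → Plane) (R ρ : ℝ)
    (p₀ p₁ : Plane) (T : ℝ) (y : ℝ → Plane) : Prop :=
  IsSolution α m c T y ∧ y 0 = p₀ ∧ y T = p₁ ∧ (∀ t ∈ Ioo 0 T, R < ‖y t‖) ∧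
    InnerProductGeometry.angle p₀ (velocity T y 0) < ρ

/-- `γ` on `[0, ℓ]` is a geodesic of the Jacobi metric parametrized by arc length. With
`W = V - 1`, the geodesic equation of the conformal metric `W ⟨·,·⟩` reads
`γ'' + (⟨∇W, γ'⟩ / W) γ' - (|γ'|² / (2 W)) ∇W = 0`; it is written here multiplied by `W`. -/
def IsUnitSpeedGeodesic {N : ℕ} (α : ℝ) (m : Fin N → ℝ) (c : Fin N → Plane)
    (ℓ : ℝ) (γ : ℝ → Plane) : Prop :=
  0 < ℓ ∧ ∀ s ∈ Icc 0 ℓ,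
    γ s ∈ jacobiRegion α m c ∧
    DifferentiableWithinAt ℝ γ (Icc 0 ℓ) s ∧
    DifferentiableWithinAt ℝ (velocity ℓ γ) (Icc 0 ℓ) s ∧
    (potential α m c (γ s) - 1) • derivWithin (velocity ℓ γ) (Icc 0 ℓ) s
      + ⟪gradient (potential α m c) (γ s), velocity ℓ γ s⟫ • velocity ℓ γ s
      - (‖velocity ℓ γ s‖ ^ 2 / 2) • gradient (potential α m c) (γ s) = 0 ∧
    Real.sqrt (potential α m c (γ s) - 1) * ‖velocity ℓ γ s‖ = 1

/-- `γ` on `[0, ℓ]` is a minimal geodesic from `p` to `q`, parametrized by arc length: its Jacobi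
length does not exceed the one of any `C¹` curve of the region joining `p` to `q`. -/
def IsMinimalGeodesic {N : ℕ} (α : ℝ) (m : Fin N → ℝ) (c : Fin N → Plane)
    (p q : Plane) (ℓ : ℝ) (γ : ℝ → Plane) : Prop :=
  IsUnitSpeedGeodesic α m c ℓ γ ∧ γ 0 = p ∧ γ ℓ = q ∧
    ∀ u : ℝ → Plane, ContDiffOn ℝ 1 u (Icc 0 1) → (∀ t ∈ Icc (0 : ℝ) 1, u t ∈ jacobiRegion α m c) →
      u 0 = p → u 1 = q → jacobiLength α m c ℓ γ ≤ jacobiLength α m c 1 u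

/-- The open set `U` is strongly convex for the Jacobi metric: its closure lies in the region, and
any two distinct points of its closure are joined by a unique minimal geodesic, whose interior
lies in `U`. -/
def IsStronglyConvex {N : ℕ} (α : ℝ) (m : Fin N → ℝ) (c : Fin N → Plane) (U : Set Plane) : Prop :=
  IsOpen U ∧ closure U ⊆ jacobiRegion α m c ∧
    ∀ p ∈ closure U, ∀ q ∈ closure U, p ≠ q →
      ∃ (ℓ : ℝ) (γ : ℝ → Plane), IsMinimalGeodesic α m c p q ℓ γ ∧ (∀ s ∈ Ioo 0 ℓ, γ s ∈ U) ∧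
        ∀ (ℓ' : ℝ) (γ' : ℝ → Plane), IsMinimalGeodesic α m c p q ℓ' γ' →
          ℓ' = ℓ ∧ EqOn γ' γ (Icc 0 ℓ)

/-- `y` on `[0, T]` is a reparametrized minimal geodesic from `p` to `q`: a solution with
energy `-1` that is an increasing reparametrization of a minimal geodesic from `p` to `q`. -/
def IsInnerArc {N : ℕ} (α : ℝ) (m : Fin N → ℝ) (c : Fin N → Plane)
    (p q : Plane) (T : ℝ) (y : ℝ → Plane) : Prop :=
  IsSolution α m c T y ∧ ∃ (ℓ : ℝ) (γ : ℝ → Plane), IsMinimalGeodesic α m c p q ℓ γ ∧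
    ∃ s : ℝ → ℝ, ContinuousOn s (Icc 0 T) ∧ StrictMonoOn s (Icc 0 T) ∧ s 0 = 0 ∧ s T = ℓ ∧
      ∀ t ∈ Icc 0 T, y t = γ (s t)

/-- The set of admissible junction points: points of `∂B_R(0) ∩ closure U` at distance at most
`δ` from the other end `pbar` of the outer solution. -/
def admissible (R δ : ℝ) (U : Set Plane) (pbar : Plane) : Set Plane :=
  {p | p ∈ sphere (0 : Plane) R ∧ p ∈ closure U ∧ dist pbar p ≤ δ}

end NCentre

namespace NCentre

open Filter Topology

/-! ### One-sided calculus on a segment -/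

/-! Both formulas are instances of the first variation of length: along a solution of energy `-1`
the Jacobi length is `1/√2` times `∫ |y'|²`, and to first order it changes only through the
displacements of the end points, paired with the end velocities. The work lies in showing that inner
arcs and outer solutions are well defined, and that they depend on their end points well enough for
the remainder to be negligible.

Inner arcs. The change of parameter `s' = √2 (V - 1)` exchanges unit speed geodesics and solutions
of energy `-1`, so strong convexity gives existence and uniqueness. Adding to an arc a linear
interpolation of the end displacements, and dominating length by action (`mul_sqrt_le_action`),
bounds the displaced minimal length from above with a quadratic error
(`IsInnerArc.jacobiLength_le_add`). The same bound with the two arcs exchanged is a lower bound, in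
which the end velocities of the displaced arc appear. These converge by compactness: a limit of
inner arcs is a solution in `closure U` that is no longer than the minimum, hence it is the unique
minimal geodesic (`IsInnerArc.tendsto`).

Outer solutions. For small `ε` the force outside the circle is close, in the Lipschitz sense, to a
central attraction. An almost radial start keeps a small angular momentum, the distance to the
origin is uniformly concave in time, and the arc returns to the circle in bounded time
(`IsOuterField.exists_return`). Shooting on both sides of the radial direction and the intermediate
value theorem give existence. Uniqueness rests on `exists_compare`, which bounds the difference of
two initial velocities by the differences of the end points and of the energies. Indeed, with `z =
y₂ - y₁`, the Wronskian `z' × y₁ - z × y₁'` is nearly a constant `q`, and the angular displacement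
`z × y₁ / |y₁|²` has derivative close to `q / |y₁|²`; it cannot be small at both ends unless `q` is
small. This controls the tangential part of `z'(0)`, and the energy controls the radial part. The
resulting Lipschitz dependence makes the error in the first variation quadratic
(`IsOuterField.exists_outer_variation`). -/

lemma sub_le_mul_of_hasDerivWithinAt_le {f f' : ℝ → ℝ} {a b C : ℝ} (hab : a ≤ b)
    (hf : ∀ t ∈ Icc a b, HasDerivWithinAt f (f' t) (Icc a b) t) (h : ∀ t ∈ Icc a b, f' t ≤ C) :
    f b - f a ≤ C * (b - a) := by
  refine (convex_Icc a b).image_sub_le_mul_sub_of_deriv_le (fun t ht => (hf t ht).continuousWithinAt)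
    (fun t ht => ?_) (fun t ht => ?_) a (left_mem_Icc.2 hab) b (right_mem_Icc.2 hab) hab
  · rw [interior_Icc] at ht
    exact ((hf t (Ioo_subset_Icc_self ht)).hasDerivAt
      (Icc_mem_nhds ht.1 ht.2)).differentiableAt.differentiableWithinAt
  · rw [interior_Icc] at ht
    rw [((hf t (Ioo_subset_Icc_self ht)).hasDerivAt (Icc_mem_nhds ht.1 ht.2)).deriv]
    exact h t (Ioo_subset_Icc_self ht)

lemma mul_le_sub_of_le_hasDerivWithinAt {f f' : ℝ → ℝ} {a b C : ℝ} (hab : a ≤ b)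
    (hf : ∀ t ∈ Icc a b, HasDerivWithinAt f (f' t) (Icc a b) t) (h : ∀ t ∈ Icc a b, C ≤ f' t) :
    C * (b - a) ≤ f b - f a := by
  have := sub_le_mul_of_hasDerivWithinAt_le (f := fun t => - f t) (f' := fun t => - f' t) (C := -C)
    hab (fun t ht => (hf t ht).neg) (fun t ht => neg_le_neg (h t ht))
  linarith

lemma norm_sub_le_mul_of_hasDerivWithinAt {E : Type*} [NormedAddCommGroup E] [NormedSpace ℝ E]
    {f f' : ℝ → E} {a b C : ℝ} (hab : a ≤ b)
    (hf : ∀ t ∈ Icc a b, HasDerivWithinAt f (f' t) (Icc a b) t)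
    (h : ∀ t ∈ Icc a b, ‖f' t‖ ≤ C) : ‖f b - f a‖ ≤ C * (b - a) :=
  norm_image_sub_le_of_norm_deriv_le_segment' hf (fun t ht => h t (Ico_subset_Icc_self ht)) b
    (right_mem_Icc.2 hab)

/-! ### Arcs: solutions of `y'' = F(y)` on `[0, T]` -/

/-- `y` solves `y'' = F(y)` on `[0, T]` with velocity `v`. -/
def IsArc (F : Plane → Plane) (T : ℝ) (y v : ℝ → Plane) : Prop :=
  ∀ t ∈ Icc 0 T, HasDerivWithinAt y (v t) (Icc 0 T) t ∧
    HasDerivWithinAt v (F (y t)) (Icc 0 T) t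

lemma IsArc.mono {F : Plane → Plane} {T T' : ℝ} {y v : ℝ → Plane} (h : IsArc F T y v)
    (hT : T' ≤ T) : IsArc F T' y v := fun t ht =>
  have hs : Icc 0 T' ⊆ Icc 0 T := Icc_subset_Icc_right hT
  ⟨(h t (hs ht)).1.mono hs, (h t (hs ht)).2.mono hs⟩

lemma IsArc.congr_force {F G : Plane → Plane} {T : ℝ} {y v : ℝ → Plane} (h : IsArc F T y v)
    (hFG : ∀ t ∈ Icc 0 T, F (y t) = G (y t)) : IsArc G T y v := fun t ht =>
  ⟨(h t ht).1, hFG t ht ▸ (h t ht).2⟩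

lemma IsArc.continuousOn {F : Plane → Plane} {T : ℝ} {y v : ℝ → Plane} (h : IsArc F T y v) :
    ContinuousOn y (Icc 0 T) := fun t ht => (h t ht).1.continuousWithinAt

lemma IsArc.continuousOn_velocity {F : Plane → Plane} {T : ℝ} {y v : ℝ → Plane}
    (h : IsArc F T y v) : ContinuousOn v (Icc 0 T) := fun t ht => (h t ht).2.continuousWithinAt

lemma IsArc.velocity_eq {F : Plane → Plane} {T : ℝ} {y v : ℝ → Plane} (h : IsArc F T y v)
    (hT : 0 < T) {t : ℝ} (ht : t ∈ Icc 0 T) : velocity T y t = v t :=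
  (h t ht).1.derivWithin (uniqueDiffOn_Icc hT t ht)

/-- The first order vector field `(x, v) ↦ (v, F x)`. -/
def phaseField (F : Plane → Plane) (z : Plane × Plane) : Plane × Plane := (z.2, F z.1)

lemma lipschitzWith_phaseField {F : Plane → Plane} {K : NNReal} (hF : LipschitzWith K F) :
    LipschitzWith (max 1 K) (phaseField F) := by
  have h1 : LipschitzWith 1 (fun z : Plane × Plane => z.2) := LipschitzWith.prod_snd
  have h2 : LipschitzWith K (fun z : Plane × Plane => F z.1) := by
    have := hF.comp (LipschitzWith.prod_fst (α := Plane) (β := Plane))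
    rwa [mul_one] at this
  exact h1.prodMk h2

lemma IsArc.hasDerivWithinAt_phase {F : Plane → Plane} {T : ℝ} {y v : ℝ → Plane}
    (h : IsArc F T y v) {t : ℝ} (ht : t ∈ Ico 0 T) :
    HasDerivWithinAt (fun t => (y t, v t)) (phaseField F (y t, v t)) (Ici t) t := by
  have h1 := (h t (Ico_subset_Icc_self ht)).1.prodMk (h t (Ico_subset_Icc_self ht)).2
  exact h1.mono_of_mem_nhdsWithin (Icc_mem_nhdsGE_of_mem ht)

/-- Gronwall's inequality for two arcs of the same Lipschitz force. -/
lemma IsArc.gronwall {F : Plane → Plane} {K : NNReal} (hF : LipschitzWith K F) {T : ℝ}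
    {y₁ v₁ y₂ v₂ : ℝ → Plane} (h₁ : IsArc F T y₁ v₁) (h₂ : IsArc F T y₂ v₂) {t : ℝ}
    (ht : t ∈ Icc 0 T) :
    ‖y₂ t - y₁ t‖ ≤ Real.exp (((max 1 K : NNReal) : ℝ) * T) * (‖y₂ 0 - y₁ 0‖ + ‖v₂ 0 - v₁ 0‖) ∧
      ‖v₂ t - v₁ t‖ ≤ Real.exp (((max 1 K : NNReal) : ℝ) * T) * (‖y₂ 0 - y₁ 0‖ + ‖v₂ 0 - v₁ 0‖) := by
  have hK0 : (0 : ℝ) ≤ ((max 1 K : NNReal) : ℝ) := NNReal.coe_nonneg _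
  have := dist_le_of_trajectories_ODE (v := fun _ => phaseField F)
    (fun _ => lipschitzWith_phaseField hF) (h₂.continuousOn.prodMk h₂.continuousOn_velocity)
    (fun t ht => h₂.hasDerivWithinAt_phase ht) (h₁.continuousOn.prodMk h₁.continuousOn_velocity)
    (fun t ht => h₁.hasDerivWithinAt_phase ht) le_rfl t ht
  rw [sub_zero, Prod.dist_eq, Prod.dist_eq, dist_eq_norm, dist_eq_norm, dist_eq_norm,
    dist_eq_norm] at this
  have hfin : max ‖y₂ t - y₁ t‖ ‖v₂ t - v₁ t‖
      ≤ Real.exp (((max 1 K : NNReal) : ℝ) * T) * (‖y₂ 0 - y₁ 0‖ + ‖v₂ 0 - v₁ 0‖) := by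
    refine this.trans ?_
    rw [mul_comm]
    refine mul_le_mul ?_ (max_le ?_ ?_) (le_max_of_le_left (norm_nonneg _)) (Real.exp_nonneg _)
    · exact Real.exp_le_exp.2 (mul_le_mul_of_nonneg_left ht.2 hK0)
    · exact le_add_of_nonneg_right (norm_nonneg _)
    · exact le_add_of_nonneg_left (norm_nonneg _)
  exact ⟨(le_max_left _ _).trans hfin, (le_max_right _ _).trans hfin⟩

/-- Global existence for a bounded Lipschitz force. -/
lemma exists_isArc {F : Plane → Plane} {K : NNReal} (hF : LipschitzWith K F) {B : ℝ}
    (hB : ∀ x, ‖F x‖ ≤ B) {T : ℝ} (hT : 0 < T) (x₀ v₀ : Plane) :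
    ∃ y v : ℝ → Plane, IsArc F T y v ∧ y 0 = x₀ ∧ v 0 = v₀ := by
  have hB0 : 0 ≤ B := (norm_nonneg _).trans (hB 0)
  -- Picard–Lindelöf on `[0, T]` requires `L * T ≤ a`, where `L` bounds the field on the ball of
  -- radius `a`. The unscaled velocity component would contribute `a * T`; with the velocity
  -- multiplied by `2 * T` it contributes only `a / 2`, for any `T`. This `a` gives equality.
  set a : ℝ := ‖(2 * T) • v₀‖ + 4 * B * T ^ 2 with ha
  have ha0 : 0 ≤ a := by positivity
  set L : ℝ := (‖(2 * T) • v₀‖ + a) / (2 * T) + 2 * T * B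
  set f : Plane × Plane → Plane × Plane := fun z => ((2 * T)⁻¹ • z.2, (2 * T) • F z.1)
  have hl : ∃ K', LipschitzWith K' f := by
    have h1 : LipschitzWith (‖(2 * T)⁻¹‖₊ * 1) (fun z : Plane × Plane => (2 * T)⁻¹ • z.2) :=
      (lipschitzWith_smul ((2 * T)⁻¹ : ℝ) (β := Plane)).comp LipschitzWith.prod_snd
    have h2 : LipschitzWith (‖2 * T‖₊ * (K * 1)) (fun z : Plane × Plane => (2 * T) • F z.1) :=
      (lipschitzWith_smul (2 * T : ℝ) (β := Plane)).comp (hF.comp LipschitzWith.prod_fst)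
    exact ⟨_, h1.prodMk h2⟩
  obtain ⟨K', hK'⟩ := hl
  have hL0 : 0 ≤ L := by positivity
  have hP : IsPicardLindelof (fun _ => f) (⟨0, left_mem_Icc.2 hT.le⟩ : Icc (0 : ℝ) T)
      (x₀, (2 * T) • v₀) ⟨a, ha0⟩ 0 ⟨L, hL0⟩ K' := by
    refine IsPicardLindelof.of_time_independent (fun z hz => ?_) hK'.lipschitzOnWith ?_
    · have hz2 : ‖z.2‖ ≤ ‖(2 * T) • v₀‖ + a := by
        have : dist z.2 ((2 * T) • v₀) ≤ a := (le_max_right _ _).trans hz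
        rw [dist_eq_norm] at this
        linarith [norm_le_norm_add_norm_sub' z.2 ((2 * T) • v₀)]
      change max ‖(2 * T)⁻¹ • z.2‖ ‖(2 * T) • F z.1‖ ≤ L
      rw [norm_smul, norm_smul, Real.norm_of_nonneg (by positivity),
        Real.norm_of_nonneg (by positivity)]
      refine max_le ?_ ?_
      · have : (2 * T)⁻¹ * ‖z.2‖ ≤ (‖(2 * T) • v₀‖ + a) / (2 * T) := by
          rw [div_eq_inv_mul]; gcongr
        have : 0 ≤ 2 * T * B := by positivity
        simp only [L]; linarith
      · have : 2 * T * ‖F z.1‖ ≤ 2 * T * B := by gcongr; exact hB _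
        have : 0 ≤ (‖(2 * T) • v₀‖ + a) / (2 * T) := by positivity
        simp only [L]; linarith
    · change L * max (T - 0) (0 - 0) ≤ a - 0
      rw [sub_zero, sub_zero, sub_zero, max_eq_left hT.le]
      have : L * T = (‖(2 * T) • v₀‖ + a) / 2 + 2 * B * T ^ 2 := by
        simp only [L]; field_simp
      rw [this, ha]
      linarith
  obtain ⟨z, hz0, hz⟩ := hP.exists_eq_forall_mem_Icc_hasDerivWithinAt₀
  refine ⟨fun t => (z t).1, fun t => (2 * T)⁻¹ • (z t).2, fun t ht => ⟨?_, ?_⟩, ?_, ?_⟩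
  · have := (ContinuousLinearMap.fst ℝ Plane Plane).hasFDerivAt.comp_hasDerivWithinAt t (hz t ht)
    exact this
  · have := (ContinuousLinearMap.snd ℝ Plane Plane).hasFDerivAt.comp_hasDerivWithinAt t (hz t ht)
    have := this.const_smul ((2 * T)⁻¹)
    have e : (2 * T)⁻¹ • (ContinuousLinearMap.snd ℝ Plane Plane) (f (z t)) = F (z t).1 := by
      change (2 * T)⁻¹ • (2 * T) • F (z t).1 = _
      rw [smul_smul, inv_mul_cancel₀ (by positivity), one_smul]
    rw [e] at this
    exact this
  · exact congrArg Prod.fst hz0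
  · have : (z 0).2 = (2 * T) • v₀ := congrArg Prod.snd hz0
    simp only [this]
    rw [smul_smul, inv_mul_cancel₀ (by positivity), one_smul]

/-! ### Smooth truncation and Taylor bounds on compact sets -/

lemma exists_contDiff_cutoff {K Ω : Set Plane} (hK : IsCompact K) (hΩ : IsOpen Ω) (hKΩ : K ⊆ Ω) :
    ∃ χ : Plane → ℝ, ContDiff ℝ 2 χ ∧ HasCompactSupport χ ∧ tsupport χ ⊆ Ω ∧ ∀ x ∈ K, χ x = 1 := by
  obtain ⟨δ, hδ, hδΩ⟩ := hK.exists_cthickening_subset_open hΩ hKΩ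
  obtain ⟨f, hf1, hf0, -⟩ := exists_contMDiffMap_one_nhds_of_subset_interior (n := 2)
    (modelWithCornersSelf ℝ Plane) (s := K) (t := cthickening δ K) hK.isClosed
    ((self_subset_thickening hδ K).trans
      (interior_maximal (thickening_subset_cthickening δ K) isOpen_thickening))
  have hs : tsupport f ⊆ cthickening δ K :=
    closure_minimal (fun x hx => by_contra fun h => hx (hf0 x h)) isClosed_cthickening
  refine ⟨f, f.contMDiff.contDiff, ?_, hs.trans hδΩ, fun x hx => hf1.self_of_nhdsSet x hx⟩
  exact hK.cthickening.of_isClosed_subset (isClosed_tsupport _) hs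

lemma contDiff_smul_of_tsupport_subset {E : Type*} [NormedAddCommGroup E] [NormedSpace ℝ E]
    {χ : Plane → ℝ} {g : Plane → E} {Ω : Set Plane} {n : WithTop ℕ∞}
    (hχ : ContDiff ℝ n χ) (hsupp : tsupport χ ⊆ Ω)
    (hg : ∀ x ∈ Ω, ContDiffAt ℝ n g x) : ContDiff ℝ n (fun x => χ x • g x) := by
  rw [contDiff_iff_contDiffAt]
  intro x
  by_cases hx : x ∈ tsupport χ
  · exact hχ.contDiffAt.smul (hg x (hsupp hx))
  · have : (fun x => χ x • g x) =ᶠ[𝓝 x] fun _ => 0 := by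
      filter_upwards [(isClosed_tsupport χ).isOpen_compl.mem_nhds hx] with z hz
      rw [image_eq_zero_of_notMem_tsupport hz, zero_smul]
    exact contDiffAt_const.congr_of_eventuallyEq this

/-- A `C²` field on an open set coincides on a compact subset with a bounded Lipschitz field. -/
lemma exists_lipschitz_bounded_eqOn {g : Plane → Plane} {K Ω : Set Plane} (hK : IsCompact K)
    (hΩ : IsOpen Ω) (hKΩ : K ⊆ Ω) (hg : ∀ x ∈ Ω, ContDiffAt ℝ 2 g x) :
    ∃ (G : Plane → Plane) (L : NNReal) (B : ℝ), LipschitzWith L G ∧ (∀ x, ‖G x‖ ≤ B) ∧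
      ∀ x ∈ K, G x = g x := by
  obtain ⟨χ, hχ, hc, hs, h1⟩ := exists_contDiff_cutoff hK hΩ hKΩ
  have hG := contDiff_smul_of_tsupport_subset hχ hs hg
  have hGc : HasCompactSupport (fun x => χ x • g x) := hc.smul_right
  obtain ⟨L, hL⟩ := hG.lipschitzWith_of_hasCompactSupport hGc (by norm_num)
  obtain ⟨B, hB⟩ := hGc.exists_bound_of_continuous hG.continuous
  exact ⟨_, L, B, hL, hB, fun x hx => by rw [h1 x hx, one_smul]⟩

/-- Second order Taylor estimate, uniform on a compact set. -/
lemma exists_taylor_bound {f : Plane → ℝ} {g : Plane → Plane} {K Ω : Set Plane} (hK : IsCompact K)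
    (hΩ : IsOpen Ω) (hKΩ : K ⊆ Ω) (hf : ∀ x ∈ Ω, HasGradientAt f (g x) x)
    (hg : ∀ x ∈ Ω, ContDiffAt ℝ 2 g x) :
    ∃ η : ℝ, 0 < η ∧ ∃ C : ℝ, 0 ≤ C ∧ ∀ x ∈ K, ∀ h : Plane, ‖h‖ ≤ η →
      x + h ∈ Ω ∧ |f (x + h) - f x - ⟪g x, h⟫| ≤ C * ‖h‖ ^ 2 := by
  obtain ⟨δ, hδ, hδΩ⟩ := hK.exists_cthickening_subset_open hΩ hKΩ
  obtain ⟨G, L, B, hL, -, hGg⟩ := exists_lipschitz_bounded_eqOn hK.cthickening hΩ hδΩ hg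
  refine ⟨δ, hδ, L, L.2, fun x hx h hh => ?_⟩
  have hball : closedBall x ‖h‖ ⊆ cthickening δ K := fun z hz =>
    mem_cthickening_of_dist_le z x δ K hx ((mem_closedBall.1 hz).trans hh)
  have hxh : x + h ∈ closedBall x ‖h‖ := by simp [mem_closedBall, dist_eq_norm]
  have hxx : x ∈ closedBall x ‖h‖ := mem_closedBall_self (norm_nonneg _)
  refine ⟨hδΩ (hball hxh), ?_⟩
  -- On the ball of radius `‖h‖` the gradient differs from `g x` by at most `L * ‖h‖`, so the mean
  -- value inequality for `f` minus its linear part gives the quadratic bound.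
  have := (convex_closedBall x ‖h‖).norm_image_sub_le_of_norm_hasFDerivWithin_le'
    (f := f) (f' := fun z => InnerProductSpace.toDual ℝ Plane (g z))
    (φ := InnerProductSpace.toDual ℝ Plane (g x)) (C := L * ‖h‖)
    (fun z hz => (hf z (hδΩ (hball hz))).hasFDerivAt.hasFDerivWithinAt) (fun z hz => ?_) hxx hxh
  · rw [add_sub_cancel_left, InnerProductSpace.toDual_apply_apply, Real.norm_eq_abs] at this
    exact this.trans (le_of_eq (by ring))
  · rw [← map_sub, LinearIsometryEquiv.norm_map, ← hGg z (hball hz), ← hGg x (hball hxx)]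
    exact (hL.norm_sub_le z x).trans
      (mul_le_mul_of_nonneg_left (by simpa [dist_eq_norm] using hz) L.2)

/-! ### The potential and its gradient -/

/-- The attraction `u / |u|^(α+2)`, up to sign, of a unit mass at the origin. -/
noncomputable def attraction (α : ℝ) (u : Plane) : Plane := ‖u‖ ^ (-(α + 2)) • u

/-- The force field `-∑ₖ mₖ (x - cₖ) / |x - cₖ|^(α+2)`. -/
noncomputable def force {N : ℕ} (α : ℝ) (m : Fin N → ℝ) (c : Fin N → Plane) (x : Plane) : Plane :=
  -∑ k, m k • attraction α (x - c k)

/-- The complement of the centres. -/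
def offCentres {N : ℕ} (c : Fin N → Plane) : Set Plane := {x | ∀ k, x ≠ c k}

lemma isOpen_offCentres {N : ℕ} (c : Fin N → Plane) : IsOpen (offCentres c) := by
  have : offCentres c = ⋂ k, {c k}ᶜ := by ext x; simp [offCentres]
  rw [this]
  exact isOpen_iInter_of_finite fun k => isOpen_compl_singleton

lemma hasFDerivAt_unit_potential {α : ℝ} (hα : 0 < α) {u : Plane} (hu : u ≠ 0) :
    HasFDerivAt (fun u : Plane => (α * ‖u‖ ^ α)⁻¹)
      (InnerProductSpace.toDual ℝ Plane (-attraction α u)) u := by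
  have hu' : 0 < ‖u‖ := norm_pos_iff.2 hu
  have h1 := ((hasStrictFDerivAt_norm_sq u).hasFDerivAt.rpow_const (p := -α / 2)
    (Or.inl (by positivity))).const_mul α⁻¹
  have e : (fun u : Plane => (α * ‖u‖ ^ α)⁻¹) = fun u => α⁻¹ * (‖u‖ ^ 2) ^ (-α / 2) := by
    funext w
    rw [mul_inv, ← Real.rpow_natCast, ← Real.rpow_mul (norm_nonneg _), ← Real.rpow_neg
      (norm_nonneg _)]
    congr 2
    push_cast; ring
  rw [e]
  refine h1.congr_fderiv ?_
  ext w
  have e2 : (‖u‖ ^ 2) ^ (-α / 2 - 1) = ‖u‖ ^ (-(α + 2)) := by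
    rw [← Real.rpow_natCast, ← Real.rpow_mul (norm_nonneg _)]
    congr 1
    push_cast; ring
  simp only [e2, attraction, smul_apply, innerSL_apply_apply, map_neg,
    map_smulₛₗ, neg_apply, InnerProductSpace.toDual_apply_apply, smul_eq_mul,
    nsmul_eq_mul, RCLike.conj_to_real]
  push_cast
  field_simp

lemma hasGradientAt_potential {N : ℕ} {α : ℝ} (hα : 0 < α) (m : Fin N → ℝ) (c : Fin N → Plane)
    {x : Plane} (hx : x ∈ offCentres c) :
    HasGradientAt (potential α m c) (force α m c x) x := by
  rw [hasGradientAt_iff_hasFDerivAt]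
  have : HasFDerivAt (fun x => ∑ k, m k * (α * ‖x - c k‖ ^ α)⁻¹)
      (∑ k, m k • InnerProductSpace.toDual ℝ Plane (-attraction α (x - c k))) x := by
    refine HasFDerivAt.fun_sum fun k _ => ?_
    have h := (hasFDerivAt_unit_potential hα (sub_ne_zero.2 (hx k))).comp x
      ((hasFDerivAt_id x).sub_const (c k))
    exact (h.const_mul (m k))
  refine this.congr_fderiv ?_
  simp only [force, ← map_smul, ← map_sum, smul_neg, Finset.sum_neg_distrib]

lemma contDiffAt_attraction (α : ℝ) {u : Plane} (hu : u ≠ 0) {n : WithTop ℕ∞} :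
    ContDiffAt ℝ n (attraction α) u :=
  ((contDiffAt_norm ℝ hu).rpow_const_of_ne (norm_ne_zero_iff.2 hu)).smul contDiffAt_id

lemma contDiffAt_force {N : ℕ} (α : ℝ) (m : Fin N → ℝ) (c : Fin N → Plane)
    {x : Plane} (hx : x ∈ offCentres c) {n : WithTop ℕ∞} : ContDiffAt ℝ n (force α m c) x := by
  refine ContDiffAt.neg (ContDiffAt.sum fun k _ => ?_)
  exact ((contDiffAt_attraction α (sub_ne_zero.2 (hx k))).comp x
    (contDiffAt_id.sub contDiffAt_const)).const_smul (m k)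

lemma continuousAt_potential {N : ℕ} {α : ℝ} (hα : 0 < α) (m : Fin N → ℝ) (c : Fin N → Plane)
    {x : Plane} (hx : x ∈ offCentres c) : ContinuousAt (potential α m c) x :=
  (hasGradientAt_potential hα m c hx).hasFDerivAt.continuousAt

lemma isOpen_jacobiRegion {N : ℕ} {α : ℝ} (hα : 0 < α) (m : Fin N → ℝ) (c : Fin N → Plane) :
    IsOpen (jacobiRegion α m c) := by
  rw [isOpen_iff_mem_nhds]
  intro x hx
  filter_upwards [(isOpen_offCentres c).mem_nhds hx.1,
    (continuousAt_potential hα m c hx.1).eventually (lt_mem_nhds hx.2)] with z h1 h2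
  exact ⟨h1, h2⟩

/-- The potential tends to zero at infinity, so that the region is bounded. -/
lemma isBounded_jacobiRegion {N : ℕ} {α : ℝ} (hα : 0 < α) (m : Fin N → ℝ) (c : Fin N → Plane) :
    Bornology.IsBounded (jacobiRegion α m c) := by
  have ht : Tendsto (potential α m c) (Bornology.cobounded Plane) (𝓝 0) := by
    have : Tendsto (fun x => ∑ k, m k / (α * ‖x - c k‖ ^ α)) (Bornology.cobounded Plane)
        (𝓝 (∑ _k : Fin N, 0)) := by
      refine tendsto_finsetSum _ fun k _ => ?_
      refine Tendsto.div_atTop tendsto_const_nhds (Tendsto.const_mul_atTop hα ?_)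
      refine (tendsto_rpow_atTop hα).comp ?_
      refine tendsto_atTop_mono (fun x => norm_sub_norm_le x (c k)) ?_
      exact tendsto_atTop_add_const_right _ _ tendsto_norm_cobounded_atTop
    rwa [Finset.sum_const_zero] at this
  have := ht.eventually (gt_mem_nhds zero_lt_one)
  rw [Bornology.isBounded_def]
  filter_upwards [this] with x hx h
  exact (lt_asymm hx h.2)

/-! ### Solutions as arcs -/

lemma IsSolution.isArc {N : ℕ} {α : ℝ} (hα : 0 < α) {m : Fin N → ℝ} {c : Fin N → Plane} {T : ℝ}
    {y : ℝ → Plane} (h : IsSolution α m c T y) : IsArc (force α m c) T y (velocity T y) :=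
  fun t ht => by
    obtain ⟨h1, h2, h3, -⟩ := h.2 t ht
    rw [(hasGradientAt_potential hα m c h1).gradient] at h3
    exact ⟨h2.hasDerivWithinAt, h3⟩

lemma IsArc.isSolution {N : ℕ} {α : ℝ} (hα : 0 < α) {m : Fin N → ℝ} {c : Fin N → Plane} {T : ℝ}
    {y v : ℝ → Plane} (h : IsArc (force α m c) T y v) (hT : 0 < T)
    (hy : ∀ t ∈ Icc 0 T, y t ∈ offCentres c)
    (hE : ∀ t ∈ Icc 0 T, ‖v t‖ ^ 2 / 2 - potential α m c (y t) = -1) : IsSolution α m c T y := by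
  refine ⟨hT, fun t ht => ⟨hy t ht, (h t ht).1.differentiableWithinAt, ?_, ?_⟩⟩
  · rw [(hasGradientAt_potential hα m c (hy t ht)).gradient]
    exact (h t ht).2.congr (fun s hs => h.velocity_eq hT hs) (h.velocity_eq hT ht)
  · rw [h.velocity_eq hT ht, hE t ht]

lemma IsArc.hasDerivWithinAt_potential {N : ℕ} {α : ℝ} (hα : 0 < α) {m : Fin N → ℝ}
    {c : Fin N → Plane} {F : Plane → Plane} {T : ℝ} {y v : ℝ → Plane} (h : IsArc F T y v) {t : ℝ}
    (ht : t ∈ Icc 0 T) (hy : y t ∈ offCentres c) :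
    HasDerivWithinAt (fun t => potential α m c (y t)) ⟪force α m c (y t), v t⟫ (Icc 0 T) t := by
  have := (hasGradientAt_potential hα m c hy).hasFDerivAt.comp_hasDerivWithinAt t (h t ht).1
  rwa [InnerProductSpace.toDual_apply_apply] at this

/-- Conservation of energy. -/
lemma IsArc.energy_eq {N : ℕ} {α : ℝ} (hα : 0 < α) {m : Fin N → ℝ} {c : Fin N → Plane} {T : ℝ}
    {y v : ℝ → Plane} (h : IsArc (force α m c) T y v) (hy : ∀ t ∈ Icc 0 T, y t ∈ offCentres c)
    {t : ℝ} (ht : t ∈ Icc 0 T) :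
    ‖v t‖ ^ 2 / 2 - potential α m c (y t) = ‖v 0‖ ^ 2 / 2 - potential α m c (y 0) := by
  have hd : ∀ s ∈ Icc 0 T, HasDerivWithinAt (fun t => ‖v t‖ ^ 2 / 2 - potential α m c (y t)) 0
      (Icc 0 T) s := fun s hs => by
    have h1 := ((h s hs).2.norm_sq.div_const 2).sub
      (h.hasDerivWithinAt_potential hα (m := m) hs (hy s hs))
    refine h1.congr_deriv ?_
    rw [real_inner_comm]
    ring
  have h0 : (0 : ℝ) ≤ T := ht.1.trans ht.2
  have := (convex_Icc 0 T).norm_image_sub_le_of_norm_hasDerivWithin_le (C := 0) hd (by simp)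
    (left_mem_Icc.2 h0) ht
  rw [zero_mul, norm_le_zero_iff, sub_eq_zero] at this
  exact this

/-! ### Changes of parameter -/

/-- The autonomous equation `s' = f(s)` with `f > 0` on `[0, ℓ]` is solved by an increasing
bijection `s : [0, T] → [0, ℓ]` with inverse `τ`. -/
lemma exists_reparametrization {ℓ : ℝ} (hℓ : 0 < ℓ) {f : ℝ → ℝ} (hf : ContinuousOn f (Icc 0 ℓ))
    (hpos : ∀ x ∈ Icc 0 ℓ, 0 < f x) :
    ∃ (T : ℝ) (s τ : ℝ → ℝ), 0 < T ∧ StrictMono s ∧ s 0 = 0 ∧ s T = ℓ ∧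
      (∀ t ∈ Icc 0 T, s t ∈ Icc 0 ℓ ∧ HasDerivWithinAt s (f (s t)) (Icc 0 T) t) ∧
      τ 0 = 0 ∧ τ ℓ = T ∧
      (∀ x ∈ Icc 0 ℓ, τ x ∈ Icc 0 T ∧ s (τ x) = x ∧ HasDerivWithinAt τ (f x)⁻¹ (Icc 0 ℓ) x) := by
  -- `1 / f` is extended by constants outside `[0, ℓ]`. Its primitive `F` is time as a function of
  -- position, and `s` is the inverse of `F`; the lower bound `b⁻¹` of `g` makes `F` surjective on
  -- the whole line.
  set g : ℝ → ℝ := fun x => (f (projIcc 0 ℓ hℓ.le x))⁻¹ with hg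
  have hfp : ∀ x, 0 < f (projIcc 0 ℓ hℓ.le x) := fun x => hpos _ (projIcc 0 ℓ hℓ.le x).2
  have hfc : Continuous fun x => f (projIcc 0 ℓ hℓ.le x) :=
    hf.domRestrict.comp continuous_projIcc
  have hgc : Continuous g := hfc.inv₀ fun x => (hfp x).ne'
  obtain ⟨b, hb⟩ := isCompact_Icc.exists_bound_of_continuousOn hf
  have hb0 : 0 < b := (hpos 0 (left_mem_Icc.2 hℓ.le)).trans_le
    ((le_abs_self _).trans (hb 0 (left_mem_Icc.2 hℓ.le)))
  have hgb : ∀ x, b⁻¹ ≤ g x := fun x =>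
    inv_anti₀ (hfp x) ((le_abs_self _).trans (hb _ (projIcc 0 ℓ hℓ.le x).2))
  have hgpos : ∀ x, 0 < g x := fun x => inv_pos.2 (hfp x)
  set F : ℝ → ℝ := fun x => ∫ t in (0 : ℝ)..x, g t with hF
  have hFd : ∀ x, HasDerivAt F (g x) x := fun x =>
    (hgc.integral_hasStrictDerivAt 0 x).hasDerivAt
  have hF0 : F 0 = 0 := intervalIntegral.integral_same
  have hFm : StrictMono F := strictMono_of_deriv_pos fun x => by
    rw [(hFd x).deriv]; exact hgpos x
  have hFc : Continuous F := continuous_iff_continuousAt.2 fun x => (hFd x).continuousAt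
  have hmono : Monotone fun x => F x - b⁻¹ * x := by
    refine monotone_of_deriv_nonneg (fun x => ?_) (fun x => ?_)
    · exact ((hFd x).sub ((hasDerivAt_id x).const_mul b⁻¹)).differentiableAt
    · have : deriv (fun x => F x - b⁻¹ * x) x = g x - b⁻¹ * 1 :=
        ((hFd x).sub ((hasDerivAt_id x).const_mul b⁻¹)).deriv
      rw [this]
      linarith [hgb x]
  have hsurj : Function.Surjective F := by
    refine hFc.surjective ?_ ?_
    · refine tendsto_atTop_mono' _ ?_ (tendsto_id.const_mul_atTop (inv_pos.2 hb0))
      filter_upwards [eventually_ge_atTop 0] with x hx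
      have := hmono hx
      simp only [hF0] at this
      simp only [id]; linarith
    · refine tendsto_atBot_mono' _ ?_ (tendsto_id.const_mul_atBot (inv_pos.2 hb0))
      filter_upwards [eventually_le_atBot 0] with x hx
      have := hmono hx
      simp only [hF0] at this
      simp only [id]; linarith
  set e := hFm.orderIsoOfSurjective F hsurj
  have heF : ∀ x, e x = F x := fun x => rfl
  have hFs : ∀ t, F (e.symm t) = t := fun t => e.apply_symm_apply t
  have hsF : ∀ x, e.symm (F x) = x := fun x => e.symm_apply_apply x
  have hs0 : e.symm 0 = 0 := by rw [← hF0, hsF, hF0]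
  have hT : 0 < F ℓ := hF0 ▸ hFm hℓ
  refine ⟨F ℓ, e.symm, F, hT, e.symm.strictMono, hs0, hsF ℓ, fun t ht => ?_, hF0, rfl,
    fun x hx => ⟨⟨?_, hFm.monotone hx.2⟩, hsF x, ?_⟩⟩
  · have hmem : e.symm t ∈ Icc 0 ℓ := by
      refine ⟨?_, ?_⟩
      · rw [← hs0]; exact e.symm.monotone ht.1
      · rw [← hsF ℓ]; exact e.symm.monotone ht.2
    refine ⟨hmem, ?_⟩
    have h1 : HasDerivAt e.symm (g (e.symm t))⁻¹ t :=
      (hFd (e.symm t)).of_local_left_inverse e.symm.continuous.continuousAt (hgpos _).ne'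
        (Eventually.of_forall hFs)
    have h2 : (g (e.symm t))⁻¹ = f (e.symm t) := by
      simp only [hg, inv_inv, projIcc_of_mem hℓ.le hmem]
    rw [h2] at h1
    exact h1.hasDerivWithinAt
  · rw [← hF0]; exact hFm.monotone hx.1
  · have : g x = (f x)⁻¹ := by simp only [hg, projIcc_of_mem hℓ.le hx]
    rw [← this]
    exact (hFd x).hasDerivWithinAt

/-- Uniqueness of the increasing solution of `s' = f(s)` from `0` to `ℓ`. -/
lemma reparametrization_unique {ℓ T T' : ℝ} {f s τ s' : ℝ → ℝ} (hT' : 0 ≤ T')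
    (hpos : ∀ x ∈ Icc 0 ℓ, 0 < f x) (hτ0 : τ 0 = 0) (hτℓ : τ ℓ = T)
    (hτ : ∀ x ∈ Icc 0 ℓ, s (τ x) = x ∧ HasDerivWithinAt τ (f x)⁻¹ (Icc 0 ℓ) x)
    (hs0 : s' 0 = 0) (hsT : s' T' = ℓ)
    (hs : ∀ t ∈ Icc 0 T', s' t ∈ Icc 0 ℓ ∧ HasDerivWithinAt s' (f (s' t)) (Icc 0 T') t) :
    T' = T ∧ EqOn s' s (Icc 0 T) := by
  -- Time read off from position is time itself: `τ ∘ s'` has derivative `1`.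
  have hd : ∀ t ∈ Icc 0 T', HasDerivWithinAt (fun t => τ (s' t) - t) 0 (Icc 0 T') t := by
    intro t ht
    have h1 := (hτ _ (hs t ht).1).2.scomp t (hs t ht).2 (fun r hr => (hs r hr).1)
    have h2 := h1.sub (hasDerivWithinAt_id t (Icc 0 T'))
    refine h2.congr_deriv ?_
    rw [smul_eq_mul, mul_inv_cancel₀ (hpos _ (hs t ht).1).ne', sub_self]
  have hid : ∀ t ∈ Icc 0 T', τ (s' t) = t := by
    intro t ht
    have := (convex_Icc 0 T').norm_image_sub_le_of_norm_hasDerivWithin_le (C := 0) hd (by simp)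
      (left_mem_Icc.2 hT') ht
    rw [zero_mul, norm_le_zero_iff, hs0, hτ0] at this
    linarith
  have hTT : T' = T := by rw [← hid T' (right_mem_Icc.2 hT'), hsT, hτℓ]
  refine ⟨hTT, fun t ht => ?_⟩
  rw [← hTT] at ht
  rw [← (hτ _ (hs t ht).1).1, hid t ht]

/-- If `y = γ ∘ s` with `s` continuous and injective, and `γ' ≠ 0`, then `s` is differentiable. -/
lemma exists_hasDerivWithinAt_of_comp {E : Type*} [NormedAddCommGroup E] [InnerProductSpace ℝ E]
    {T ℓ t : ℝ} {y γ : ℝ → E} {s : ℝ → ℝ} {y' γ' : E} (hc : ContinuousOn s (Icc 0 T))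
    (hi : InjOn s (Icc 0 T)) (hm : MapsTo s (Icc 0 T) (Icc 0 ℓ)) (ht : t ∈ Icc 0 T)
    (hy : ∀ r ∈ Icc 0 T, y r = γ (s r)) (hyd : HasDerivWithinAt y y' (Icc 0 T) t)
    (hγd : HasDerivWithinAt γ γ' (Icc 0 ℓ) (s t)) (h0 : γ' ≠ 0) :
    ∃ d, HasDerivWithinAt s d (Icc 0 T) t := by
  -- Pairing with `γ'` reduces to scalar functions: the slope of `s` is the slope of `⟪y, γ'⟫`
  -- divided by that of `⟪γ, γ'⟫`, whose limit `|γ'|²` is nonzero. Injectivity keeps `s r ≠ s t` in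
  -- the latter.
  have h1 : HasDerivWithinAt (fun r => ⟪y r, γ'⟫) ⟪y', γ'⟫ (Icc 0 T) t := by
    simpa using hyd.inner ℝ (hasDerivWithinAt_const t (Icc 0 T) γ')
  have h2 : HasDerivWithinAt (fun r => ⟪γ r, γ'⟫) ⟪γ', γ'⟫ (Icc 0 ℓ) (s t) := by
    simpa using hγd.inner ℝ (hasDerivWithinAt_const (s t) (Icc 0 ℓ) γ')
  rw [hasDerivWithinAt_iff_tendsto_slope] at h1 h2
  have hne : ⟪γ', γ'⟫ ≠ 0 := inner_self_ne_zero.2 h0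
  have hst : Tendsto s (𝓝[Icc 0 T \ {t}] t) (𝓝[Icc 0 ℓ \ {s t}] (s t)) := by
    refine tendsto_nhdsWithin_iff.2 ⟨(hc t ht).tendsto.mono_left (nhdsWithin_mono _ sdiff_subset), ?_⟩
    filter_upwards [self_mem_nhdsWithin] with r hr
    exact ⟨hm hr.1, fun h => hr.2 (hi hr.1 ht h)⟩
  refine ⟨⟪y', γ'⟫ / ⟪γ', γ'⟫, ?_⟩
  rw [hasDerivWithinAt_iff_tendsto_slope]
  refine (h1.div (h2.comp hst) hne).congr' ?_
  have hev : ∀ᶠ r in 𝓝[Icc 0 T \ {t}] t,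
      slope (fun r => ⟪γ r, γ'⟫) (s t) (s r) ≠ 0 := (h2.comp hst).eventually_ne hne
  filter_upwards [self_mem_nhdsWithin, hev] with r hr hr2
  have hsr : s r - s t ≠ 0 := sub_ne_zero.2 fun h => hr.2 (hi hr.1 ht h)
  have hrt : r - t ≠ 0 := sub_ne_zero.2 hr.2
  simp only [Pi.div_apply, Function.comp_apply, slope_def_field, hy r hr.1, hy t ht] at hr2 ⊢
  have hnum : ⟪γ (s r), γ'⟫ - ⟪γ (s t), γ'⟫ ≠ 0 := fun h => hr2 (by rw [h, zero_div])
  field_simp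

section

variable {N : ℕ} {α : ℝ} {m : Fin N → ℝ} {c : Fin N → Plane}

/-! ### Minimal geodesics and solutions -/

lemma IsUnitSpeedGeodesic.hasDerivWithinAt {ℓ : ℝ} {γ : ℝ → Plane}
    (h : IsUnitSpeedGeodesic α m c ℓ γ) {s : ℝ} (hs : s ∈ Icc 0 ℓ) :
    HasDerivWithinAt γ (velocity ℓ γ s) (Icc 0 ℓ) s := (h.2 s hs).2.1.hasDerivWithinAt

lemma IsUnitSpeedGeodesic.norm_sq {ℓ : ℝ} {γ : ℝ → Plane}
    (h : IsUnitSpeedGeodesic α m c ℓ γ) {s : ℝ} (hs : s ∈ Icc 0 ℓ) :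
    (potential α m c (γ s) - 1) * ‖velocity ℓ γ s‖ ^ 2 = 1 := by
  have h1 := (h.2 s hs).2.2.2.2
  have h2 : 0 ≤ potential α m c (γ s) - 1 := by linarith [(h.2 s hs).1.2]
  have := congrArg (· ^ 2) h1
  simpa [mul_pow, Real.sq_sqrt h2] using this

lemma IsUnitSpeedGeodesic.continuousOn_density (hα : 0 < α) {ℓ : ℝ} {γ : ℝ → Plane}
    (h : IsUnitSpeedGeodesic α m c ℓ γ) :
    ContinuousOn (fun s => Real.sqrt 2 * (potential α m c (γ s) - 1)) (Icc 0 ℓ) := fun s hs =>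
  (((continuousAt_potential hα m c (h.2 s hs).1.1).comp_continuousWithinAt
    (h.hasDerivWithinAt hs).continuousWithinAt).sub continuousWithinAt_const).const_mul _

lemma IsUnitSpeedGeodesic.density_pos {ℓ : ℝ} {γ : ℝ → Plane}
    (h : IsUnitSpeedGeodesic α m c ℓ γ) {s : ℝ} (hs : s ∈ Icc 0 ℓ) :
    0 < Real.sqrt 2 * (potential α m c (γ s) - 1) :=
  mul_pos (by positivity) (by linarith [(h.2 s hs).1.2])

lemma IsUnitSpeedGeodesic.jacobiLength_eq {ℓ : ℝ} {γ : ℝ → Plane}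
    (h : IsUnitSpeedGeodesic α m c ℓ γ) : jacobiLength α m c ℓ γ = ℓ := by
  have : jacobiLength α m c ℓ γ = ∫ _t in (0 : ℝ)..ℓ, (1 : ℝ) := by
    refine intervalIntegral.integral_congr fun s hs => ?_
    rw [uIcc_of_le h.1.le] at hs
    have h1 := (h.2 s hs).2.2.2.2
    rwa [mul_comm] at h1
  rw [this]; simp

/-- Reparametrizing a geodesic by `s' = √2 (V - 1)` gives a solution of energy `-1`. -/
lemma IsUnitSpeedGeodesic.isSolution_comp (hα : 0 < α) {ℓ : ℝ} {γ : ℝ → Plane}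
    (h : IsUnitSpeedGeodesic α m c ℓ γ) {T : ℝ} (hT : 0 < T) {s : ℝ → ℝ}
    (hs : ∀ t ∈ Icc 0 T, s t ∈ Icc 0 ℓ ∧ HasDerivWithinAt s
      (Real.sqrt 2 * (potential α m c (γ (s t)) - 1)) (Icc 0 T) t) :
    IsSolution α m c T (fun t => γ (s t)) := by
  have hm : MapsTo s (Icc 0 T) (Icc 0 ℓ) := fun t ht => (hs t ht).1
  have h2 : Real.sqrt 2 * Real.sqrt 2 = 2 := Real.mul_self_sqrt (by norm_num)
  have harc : IsArc (force α m c) T (fun t => γ (s t))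
      (fun t => (Real.sqrt 2 * (potential α m c (γ (s t)) - 1)) • velocity ℓ γ (s t)) := by
    intro t ht
    have hst := hm ht
    have hg := h.2 _ hst
    have hgr := (hasGradientAt_potential hα m c hg.1.1).gradient
    refine ⟨(h.hasDerivWithinAt hst).scomp t (hs t ht).2 hm, ?_⟩
    have hV := (hasGradientAt_potential hα m c hg.1.1).hasFDerivAt.comp_hasDerivWithinAt (s t)
      (h.hasDerivWithinAt hst)
    rw [InnerProductSpace.toDual_apply_apply] at hV
    have hVt := ((hV.scomp t (hs t ht).2 hm).sub_const 1).const_mul (Real.sqrt 2)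
    have hw := hg.2.2.1.hasDerivWithinAt.scomp t (hs t ht).2 hm
    refine (hVt.smul hw).congr_deriv ?_
    have heq := hg.2.2.2.1
    have hn := h.norm_sq hst
    rw [hgr] at heq
    set W := potential α m c (γ (s t)) - 1 with hW
    set g := force α m c (γ (s t))
    set e := velocity ℓ γ (s t)
    set a := derivWithin (velocity ℓ γ) (Icc 0 ℓ) (s t)
    have e1 : W • a = (‖e‖ ^ 2 / 2) • g - ⟪g, e⟫ • e := by
      rw [← sub_eq_zero, ← heq]; abel
    -- The normalization `W * ‖e‖² = 1` turns the coefficient of `g` in `2 * W * (W * a)` into `1`;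
    -- the remaining multiple of `e` is cancelled by the derivative of the factor `√2 * W`.
    have e2 : (Real.sqrt 2 * W) • (Real.sqrt 2 * W) • a = (2 * W) • (W • a) := by
      rw [smul_smul, smul_smul]; congr 1; linear_combination W ^ 2 * h2
    simp only [Function.comp_apply]
    rw [e2, e1]
    have e3 : (Real.sqrt 2 * (Real.sqrt 2 * W) • ⟪g, e⟫) = 2 * W * ⟪g, e⟫ := by
      rw [smul_eq_mul]; linear_combination W * ⟪g, e⟫ * h2
    rw [e3, smul_sub, smul_smul, smul_smul]
    have e4 : 2 * W * (‖e‖ ^ 2 / 2) = 1 := by linear_combination hn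
    rw [e4, one_smul]
    abel
  refine harc.isSolution hα hT (fun t ht => (h.2 _ (hm ht)).1.1) fun t ht => ?_
  have hn := h.norm_sq (hm ht)
  rw [norm_smul, mul_pow, Real.norm_eq_abs, sq_abs]
  linear_combination (potential α m c (γ (s t)) - 1) * hn +
    (potential α m c (γ (s t)) - 1) ^ 2 * ‖velocity ℓ γ (s t)‖ ^ 2 / 2 * h2

/-- Conversely, reparametrizing a solution by arc length gives a geodesic. -/
lemma IsSolution.isUnitSpeedGeodesic_comp (hα : 0 < α) {T : ℝ} {y : ℝ → Plane}
    (h : IsSolution α m c T y) (hy : ∀ t ∈ Icc 0 T, 1 < potential α m c (y t)) {ℓ : ℝ} (hℓ : 0 < ℓ)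
    {σ : ℝ → ℝ} (hσ : ∀ x ∈ Icc 0 ℓ, σ x ∈ Icc 0 T ∧ HasDerivWithinAt σ
      (Real.sqrt 2 * (potential α m c (y (σ x)) - 1))⁻¹ (Icc 0 ℓ) x) :
    IsUnitSpeedGeodesic α m c ℓ (fun x => y (σ x)) ∧ ∀ x ∈ Icc 0 ℓ,
      velocity ℓ (fun x => y (σ x)) x
        = (Real.sqrt 2 * (potential α m c (y (σ x)) - 1))⁻¹ • velocity T y (σ x) := by
  have hm : MapsTo σ (Icc 0 ℓ) (Icc 0 T) := fun t ht => (hσ t ht).1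
  have h2 : Real.sqrt 2 * Real.sqrt 2 = 2 := Real.mul_self_sqrt (by norm_num)
  have h2' : Real.sqrt 2 ≠ 0 := by positivity
  have harc := h.isArc hα
  have hd : ∀ x ∈ Icc 0 ℓ, HasDerivWithinAt (fun x => y (σ x))
      ((Real.sqrt 2 * (potential α m c (y (σ x)) - 1))⁻¹ • velocity T y (σ x)) (Icc 0 ℓ) x :=
    fun x hx => (harc _ (hm hx)).1.scomp x (hσ x hx).2 hm
  have hvel : ∀ x ∈ Icc 0 ℓ, velocity ℓ (fun x => y (σ x)) x
      = (Real.sqrt 2 * (potential α m c (y (σ x)) - 1))⁻¹ • velocity T y (σ x) := fun x hx =>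
    (hd x hx).derivWithin (uniqueDiffOn_Icc hℓ x hx)
  refine ⟨⟨hℓ, fun x hx => ?_⟩, hvel⟩
  have ht := hm hx
  obtain ⟨hc1, -, -, hE⟩ := h.2 _ ht
  have hW0 : 0 < potential α m c (y (σ x)) - 1 := by linarith [hy _ ht]
  have hV := ((harc.hasDerivWithinAt_potential hα (m := m) ht hc1).scomp x (hσ x hx).2 hm)
  have hf := ((hV.sub_const 1).const_mul (Real.sqrt 2)).inv (mul_pos (by positivity) hW0).ne'
  have hvd := (hf.smul ((harc _ ht).2.scomp x (hσ x hx).2 hm)).congr hvel (hvel x hx)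
  refine ⟨⟨hc1, hy _ ht⟩, (hd x hx).differentiableWithinAt, hvd.differentiableWithinAt, ?_, ?_⟩
  · rw [hvd.derivWithin (uniqueDiffOn_Icc hℓ x hx), hvel x hx,
      (hasGradientAt_potential hα m c hc1).gradient]
    simp only [Function.comp_apply]
    set W := potential α m c (y (σ x)) - 1 with hW
    set g := force α m c (y (σ x))
    set v := velocity T y (σ x)
    have hv : ‖v‖ ^ 2 = 2 * W := by linear_combination 2 * hE
    obtain ⟨k, hk⟩ : ∃ k, k = (Real.sqrt 2 * W)⁻¹ := ⟨_, rfl⟩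
    have hk1 : k * (Real.sqrt 2 * W) = 1 := by
      rw [hk]; exact inv_mul_cancel₀ (mul_pos (by positivity) hW0).ne'
    rw [div_eq_mul_inv _ ((Real.sqrt 2 * W) ^ 2), ← inv_pow, ← hk, norm_smul, mul_pow, hv,
      inner_smul_right, Real.norm_eq_abs, sq_abs]
    have e1 : W * (-(Real.sqrt 2 * (k * ⟪g, v⟫)) * k ^ 2) + k * ⟪g, v⟫ * k = 0 := by
      linear_combination (-(k ^ 2 * ⟪g, v⟫)) * hk1
    calc _ = (W * (-(Real.sqrt 2 * (k * ⟪g, v⟫)) * k ^ 2) + k * ⟪g, v⟫ * k) • v := by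
          simp only [smul_eq_mul, Pi.inv_apply, ← hW, ← hk]; module
      _ = 0 := by rw [e1, zero_smul]
  · rw [hvel x hx, norm_smul, norm_inv, Real.norm_of_nonneg (by positivity)]
    have hv : ‖velocity T y (σ x)‖ = Real.sqrt 2 * Real.sqrt (potential α m c (y (σ x)) - 1) := by
      rw [← Real.sqrt_mul (by norm_num), eq_comm, Real.sqrt_eq_iff_mul_self_eq (by positivity)
        (norm_nonneg _)]
      linear_combination (-2) * hE
    rw [hv]
    have := Real.mul_self_sqrt hW0.le
    have h3 := (Real.sqrt_pos.2 hW0).ne'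
    nth_rewrite 2 [← this]
    field_simp

/-- The parameter change of an inner arc satisfies `s' = √2 (V - 1)`. -/
lemma hasDerivWithinAt_of_isSolution_comp (hα : 0 < α) {T ℓ : ℝ} {y γ : ℝ → Plane} {s : ℝ → ℝ}
    (hy : IsSolution α m c T y) (hγ : IsUnitSpeedGeodesic α m c ℓ γ)
    (hc : ContinuousOn s (Icc 0 T)) (hs : StrictMonoOn s (Icc 0 T)) (hs0 : s 0 = 0)
    (hsT : s T = ℓ) (hys : ∀ t ∈ Icc 0 T, y t = γ (s t)) {t : ℝ} (ht : t ∈ Icc 0 T) :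
    s t ∈ Icc 0 ℓ ∧
      HasDerivWithinAt s (Real.sqrt 2 * (potential α m c (γ (s t)) - 1)) (Icc 0 T) t := by
  have hm : MapsTo s (Icc 0 T) (Icc 0 ℓ) := fun r hr => by
    refine ⟨?_, ?_⟩
    · rw [← hs0]; exact hs.monotoneOn (left_mem_Icc.2 hy.1.le) hr hr.1
    · rw [← hsT]; exact hs.monotoneOn hr (right_mem_Icc.2 hy.1.le) hr.2
  have hst := hm ht
  refine ⟨hst, ?_⟩
  have hn := hγ.norm_sq hst
  have hW : 0 < potential α m c (γ (s t)) - 1 := by linarith [(hγ.2 _ hst).1.2]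
  have h0 : velocity ℓ γ (s t) ≠ 0 := fun h => by simp [h] at hn
  have hyd := (hy.isArc hα t ht).1
  obtain ⟨d, hd⟩ := exists_hasDerivWithinAt_of_comp hc hs.injOn hm ht hys hyd
    (hγ.hasDerivWithinAt hst) h0
  have hd0 : 0 ≤ d := by
    rw [← hd.derivWithin (uniqueDiffOn_Icc hy.1 t ht)]
    exact hs.monotoneOn.derivWithin_nonneg
  have hv : velocity T y t = d • velocity ℓ γ (s t) :=
    (uniqueDiffOn_Icc hy.1 t ht).eq_deriv _ hyd
      (((hγ.hasDerivWithinAt hst).scomp t hd hm).congr hys (hys t ht))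
  have hE := (hy.2 t ht).2.2.2
  rw [hv, hys t ht, norm_smul, mul_pow, Real.norm_eq_abs, sq_abs] at hE
  -- The energy determines `d²`, and the monotonicity of `s` the sign of `d`.
  have hd2 : d ^ 2 = (Real.sqrt 2 * (potential α m c (γ (s t)) - 1)) ^ 2 := by
    rw [mul_pow, Real.sq_sqrt (by norm_num)]
    linear_combination (2 * (potential α m c (γ (s t)) - 1)) * hE - d ^ 2 * hn
  rw [← (pow_left_inj₀ hd0 (mul_pos (by positivity) hW).le two_ne_zero).1 hd2]
  exact hd

/-- The Jacobi length of a solution is the increment of its arc length parameter. -/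
lemma IsSolution.jacobiLength_eq {T : ℝ} {y : ℝ → Plane} (hy : IsSolution α m c T y) :
    jacobiLength α m c T y = ∫ t in (0 : ℝ)..T, Real.sqrt 2 * (potential α m c (y t) - 1) := by
  refine intervalIntegral.integral_congr fun t ht => ?_
  rw [uIcc_of_le hy.1.le] at ht
  have hE := (hy.2 t ht).2.2.2
  have hW : 0 ≤ potential α m c (y t) - 1 := by nlinarith [sq_nonneg ‖velocity T y t‖]
  have hv : ‖velocity T y t‖ = Real.sqrt 2 * Real.sqrt (potential α m c (y t) - 1) := by
    rw [← Real.sqrt_mul (by norm_num), eq_comm, Real.sqrt_eq_iff_mul_self_eq (by positivity)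
      (norm_nonneg _)]
    linear_combination (-2) * hE
  simp only [hv]
  rw [mul_assoc, Real.mul_self_sqrt hW]

lemma IsSolution.continuousOn_potential (hα : 0 < α) {T : ℝ} {y : ℝ → Plane}
    (hy : IsSolution α m c T y) : ContinuousOn (fun t => potential α m c (y t)) (Icc 0 T) :=
  fun t ht => ((hy.isArc hα).hasDerivWithinAt_potential hα ht (hy.2 t ht).1).continuousWithinAt

lemma IsSolution.jacobiLength_eq_sub (hα : 0 < α) {T : ℝ} {y : ℝ → Plane}
    (hy : IsSolution α m c T y) {s : ℝ → ℝ} (hs : ∀ t ∈ Icc 0 T, HasDerivWithinAt s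
      (Real.sqrt 2 * (potential α m c (y t) - 1)) (Icc 0 T) t) :
    jacobiLength α m c T y = s T - s 0 := by
  rw [hy.jacobiLength_eq]
  refine intervalIntegral.integral_eq_sub_of_hasDerivAt_of_le hy.1.le
    (fun t ht => (hs t ht).continuousWithinAt)
    (fun t ht => (hs t (Ioo_subset_Icc_self ht)).hasDerivAt (Icc_mem_nhds ht.1 ht.2)) ?_
  refine ContinuousOn.intervalIntegrable ?_
  rw [uIcc_of_le hy.1.le]
  exact ((hy.continuousOn_potential hα).sub continuousOn_const).const_smul (Real.sqrt 2)

lemma IsInnerArc.jacobiLength_le (hα : 0 < α) {p q : Plane} {T : ℝ} {y : ℝ → Plane}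
    (h : IsInnerArc α m c p q T y) {u : ℝ → Plane} (hu : ContDiffOn ℝ 1 u (Icc 0 1))
    (hur : ∀ t ∈ Icc (0 : ℝ) 1, u t ∈ jacobiRegion α m c) (hu0 : u 0 = p) (hu1 : u 1 = q) :
    jacobiLength α m c T y ≤ jacobiLength α m c 1 u := by
  obtain ⟨hy, ℓ, γ, hγ, s, hc, hs, hs0, hsT, hys⟩ := h
  refine le_trans (le_of_eq ?_) (hγ.2.2.2 u hu hur hu0 hu1)
  rw [hγ.1.jacobiLength_eq, hy.jacobiLength_eq_sub hα (s := s), hs0, hsT, sub_zero]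
  intro t ht
  rw [hys t ht]
  exact (hasDerivWithinAt_of_isSolution_comp hα hy hγ.1 hc hs hs0 hsT hys ht).2

lemma IsInnerArc.endpoints {p q : Plane} {T : ℝ} {y : ℝ → Plane}
    (h : IsInnerArc α m c p q T y) : y 0 = p ∧ y T = q := by
  obtain ⟨hy, ℓ, γ, hγ, s, hc, hs, hs0, hsT, hys⟩ := h
  rw [hys 0 (left_mem_Icc.2 hy.1.le), hys T (right_mem_Icc.2 hy.1.le), hs0, hsT]
  exact ⟨hγ.2.1, hγ.2.2.1⟩

/-- Minimal geodesics of a strongly convex set have exactly one reparametrization as a solution. -/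
lemma IsStronglyConvex.existsUnique_isInnerArc (hα : 0 < α) {U : Set Plane}
    (hU : IsStronglyConvex α m c U) {p q : Plane} (hp : p ∈ closure U) (hq : q ∈ closure U)
    (hpq : p ≠ q) : ∃ (T : ℝ) (y : ℝ → Plane), IsInnerArc α m c p q T y ∧
      (∀ t ∈ Icc 0 T, y t ∈ closure U) ∧
      ∀ (T' : ℝ) (y' : ℝ → Plane), IsInnerArc α m c p q T' y' → T' = T ∧ EqOn y' y (Icc 0 T) := by
  obtain ⟨ℓ, γ, hγ, hin, huniq⟩ := hU.2.2 p hp q hq hpq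
  have hpos : ∀ x ∈ Icc 0 ℓ, 0 < Real.sqrt 2 * (potential α m c (γ x) - 1) :=
    fun x hx => hγ.1.density_pos hx
  obtain ⟨T, s, τ, hT, hsm, hs0, hsT, hs, hτ0, hτℓ, hτ⟩ :=
    exists_reparametrization hγ.1.1 (hγ.1.continuousOn_density hα) hpos
  have hcl : ∀ x ∈ Icc 0 ℓ, γ x ∈ closure U := fun x hx => by
    rcases eq_endpoints_or_mem_Ioo_of_mem_Icc hx with h | h | h
    · rw [h, hγ.2.1]; exact hp
    · rw [h, hγ.2.2.1]; exact hq
    · exact subset_closure (hin x h)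
  refine ⟨T, fun t => γ (s t), ⟨hγ.1.isSolution_comp hα hT hs, ℓ, γ, hγ, s,
    fun t ht => (hs t ht).2.continuousWithinAt, hsm.strictMonoOn _, hs0, hsT, fun _ _ => rfl⟩,
    fun t ht => hcl _ (hs t ht).1, ?_⟩
  rintro T' y' ⟨hy', ℓ', γ', hγ', s', hc', hsm', hs0', hsT', hys'⟩
  obtain ⟨rfl, hγγ⟩ := huniq ℓ' γ' hγ'
  have hmem := fun t ht => (hasDerivWithinAt_of_isSolution_comp hα hy' hγ'.1 hc' hsm' hs0' hsT' hys'
    (t := t) ht).1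
  have hys : ∀ t ∈ Icc 0 T', y' t = γ (s' t) := fun t ht => by
    rw [hys' t ht, hγγ (hmem t ht)]
  obtain ⟨h1, h2⟩ := reparametrization_unique hy'.1.le hpos hτ0 hτℓ (fun x hx => (hτ x hx).2)
    hs0' hsT' (fun t ht => hasDerivWithinAt_of_isSolution_comp hα hy' hγ.1 hc' hsm' hs0' hsT' hys ht)
  refine ⟨h1, fun t ht => ?_⟩
  rw [hys t (h1 ▸ ht), h2 ht]


/-! ### First variation of the Jacobi length of inner arcs -/

/-- Completing the square. Equality holds for `A = T * √(2 * W)`, the speed of a solution of energy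
`-1` rescaled from duration `T` to `[0, 1]`; hence nothing is lost to first order when the length of
a competitor close to a solution is replaced by its action. -/
lemma mul_sqrt_le_action {A W T : ℝ} (hT : 0 < T) (hW : 0 ≤ W) :
    A * Real.sqrt W ≤ 1 / Real.sqrt 2 * (A ^ 2 / (2 * T) + T * W) := by
  have h2 : Real.sqrt 2 * Real.sqrt 2 = 2 := Real.mul_self_sqrt (by norm_num)
  have h2p : 0 < Real.sqrt 2 := by positivity
  have hB := Real.mul_self_sqrt hW
  set B := Real.sqrt W
  rw [← hB, div_mul_eq_mul_div, one_mul, le_div_iff₀ h2p]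
  have : A ^ 2 / (2 * T) + T * (B * B) - A * B * Real.sqrt 2
      = (A - Real.sqrt 2 * T * B) ^ 2 / (2 * T) := by
    field_simp
    linear_combination (-(T ^ 2 * B ^ 2)) * h2
  have h3 : 0 ≤ (A - Real.sqrt 2 * T * B) ^ 2 / (2 * T) := by positivity
  linarith

/-- Upper bound for the variation of the minimal Jacobi length when the end points move. -/
lemma IsInnerArc.jacobiLength_le_add (hα : 0 < α) {K : Set Plane} {η C : ℝ}
    (hC : 0 ≤ C) (hη : ∀ x ∈ K, ∀ h : Plane, ‖h‖ ≤ η → x + h ∈ jacobiRegion α m c ∧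
      |potential α m c (x + h) - potential α m c x - ⟪force α m c x, h⟫| ≤ C * ‖h‖ ^ 2)
    {p q p' q' : Plane} {T T' : ℝ} {y y' : ℝ → Plane} (h : IsInnerArc α m c p q T y)
    (hK : ∀ t ∈ Icc 0 T, y t ∈ K) (h' : IsInnerArc α m c p' q' T' y') {r : ℝ} (hrη : r ≤ η)
    (hp : ‖p' - p‖ ≤ r) (hq : ‖q' - q‖ ≤ r) :
    jacobiLength α m c T' y' ≤ jacobiLength α m c T y + 1 / Real.sqrt 2 *
      (⟪velocity T y T, q' - q⟫ - ⟪velocity T y 0, p' - p⟫ + (2 / T + C * T) * r ^ 2) := by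
  have hr0 : 0 ≤ r := (norm_nonneg _).trans hp
  obtain ⟨hy0, hyT⟩ := h.endpoints
  obtain ⟨hy, ℓ, γ, hγ, s, hc, hs, hs0, hsT, hys⟩ := h
  have hT := hy.1
  have hsd : ∀ t ∈ Icc 0 T, HasDerivWithinAt s (Real.sqrt 2 * (potential α m c (y t) - 1))
      (Icc 0 T) t := fun t ht => by
    rw [hys t ht]
    exact (hasDerivWithinAt_of_isSolution_comp hα hy hγ.1 hc hs hs0 hsT hys ht).2
  rw [hy.jacobiLength_eq_sub hα hsd]
  have harc := hy.isArc hα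
  set v := velocity T y
  -- The competitor `u` is the original arc rescaled to `[0, 1]` plus the displacement `e`, which
  -- interpolates linearly between those of the end points.
  set Δ := (q' - q) - (p' - p) with hΔ
  set e : ℝ → Plane := fun τ => (p' - p) + τ • Δ with he
  have hen : ∀ τ ∈ Icc (0 : ℝ) 1, ‖e τ‖ ≤ r := fun τ hτ => by
    have : e τ = (1 - τ) • (p' - p) + τ • (q' - q) := by simp only [he, hΔ]; module
    rw [this]
    refine (norm_add_le _ _).trans ?_
    rw [norm_smul, norm_smul, Real.norm_of_nonneg hτ.1, Real.norm_of_nonneg (sub_nonneg.2 hτ.2)]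
    nlinarith [hτ.1, hτ.2]
  have hΔn : ‖Δ‖ ≤ 2 * r := (norm_sub_le _ _).trans (by linarith)
  have hmT : MapsTo (fun τ => T * τ) (Icc (0 : ℝ) 1) (Icc 0 T) := fun τ hτ =>
    ⟨mul_nonneg hT.le hτ.1, by nlinarith [hτ.2]⟩
  have hlin : ∀ τ, HasDerivWithinAt (fun τ => T * τ) T (Icc (0 : ℝ) 1) τ := fun τ => by
    simpa using (hasDerivWithinAt_id τ (Icc (0 : ℝ) 1)).const_mul T
  have hed : ∀ τ, HasDerivWithinAt e Δ (Icc (0 : ℝ) 1) τ := fun τ =>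
    (((hasDerivWithinAt_id τ (Icc (0 : ℝ) 1)).smul_const Δ).const_add (p' - p)).congr_deriv
      (one_smul ℝ Δ)
  set u : ℝ → Plane := fun τ => y (T * τ) + e τ with hu
  have hud : ∀ τ ∈ Icc (0 : ℝ) 1, HasDerivWithinAt u (T • v (T * τ) + Δ) (Icc 0 1) τ :=
    fun τ hτ => ((harc _ (hmT hτ)).1.scomp τ (hlin τ) hmT).add (hed τ)
  have huv : ∀ τ ∈ Icc (0 : ℝ) 1, derivWithin u (Icc 0 1) τ = T • v (T * τ) + Δ := fun τ hτ =>
    (hud τ hτ).derivWithin (uniqueDiffOn_Icc zero_lt_one τ hτ)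
  have huc : ContinuousOn (derivWithin u (Icc 0 1)) (Icc 0 1) := by
    refine ContinuousOn.congr ?_ huv
    exact ((harc.continuousOn_velocity.comp (by fun_prop) hmT).const_smul T).add continuousOn_const
  have hu1 : ContDiffOn ℝ 1 u (Icc 0 1) :=
    (contDiffOn_one_iff_derivWithin (uniqueDiffOn_Icc zero_lt_one)).2
      ⟨fun τ hτ => (hud τ hτ).differentiableWithinAt, huc⟩
  have hur : ∀ τ ∈ Icc (0 : ℝ) 1, u τ ∈ jacobiRegion α m c := fun τ hτ =>
    (hη _ (hK _ (hmT hτ)) _ ((hen τ hτ).trans hrη)).1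
  refine (h'.jacobiLength_le hα hu1 hur ?_ ?_).trans ?_
  · simp [hu, he, hy0]
  · simp [hu, he, hΔ, hyT]
  -- `Φ` is a function whose derivative dominates the length density of `u`: arc length of `y`, plus
  -- the boundary term of the first variation, plus a linear term for the second order errors. In
  -- the latter, `2 / T` comes from `‖Δ‖² / (2 * T)` with `‖Δ‖ ≤ 2 * r`, and `C * T` from the Taylor
  -- remainder of the potential.
  set R := 1 / Real.sqrt 2 * ((2 / T + C * T) * r ^ 2) with hR
  set Φ : ℝ → ℝ := fun τ => s (T * τ) + 1 / Real.sqrt 2 * ⟪v (T * τ), e τ⟫ + R * τ with hΦ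
  have hΦd : ∀ τ ∈ Icc (0 : ℝ) 1, HasDerivWithinAt Φ
      (T * (Real.sqrt 2 * (potential α m c (y (T * τ)) - 1)) + 1 / Real.sqrt 2 *
        (⟪v (T * τ), Δ⟫ + ⟪T • force α m c (y (T * τ)), e τ⟫) + R * 1) (Icc 0 1) τ := by
    intro τ hτ
    have h1 := (hsd _ (hmT hτ)).scomp τ (hlin τ) hmT
    have h2 := (((harc _ (hmT hτ)).2.scomp τ (hlin τ) hmT).inner ℝ (hed τ)).const_mul
      (1 / Real.sqrt 2)
    exact (h1.add h2).add ((hasDerivWithinAt_id τ _).const_mul R)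
  have hint := intervalIntegral.integral_le_sub_of_hasDeriv_right_of_le (zero_le_one' ℝ)
    (φ := fun τ => ‖velocity 1 u τ‖ * Real.sqrt (potential α m c (u τ) - 1))
    (fun τ hτ => (hΦd τ hτ).continuousWithinAt)
    (fun τ hτ => ((hΦd τ (Ioo_subset_Icc_self hτ)).hasDerivAt
      (Icc_mem_nhds hτ.1 hτ.2)).hasDerivWithinAt) ?_ ?_
  · refine hint.trans (le_of_eq ?_)
    simp only [hΦ, he, hR, hΔ]
    simp only [mul_one, mul_zero, one_smul, zero_smul, add_zero, add_sub_cancel]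
    ring
  · refine ContinuousOn.integrableOn_Icc (huc.norm.mul (ContinuousOn.sqrt ?_))
    exact ContinuousOn.sub (fun τ hτ => (continuousAt_potential hα m c (hur τ hτ).1).comp_continuousWithinAt
      (hud τ hτ).continuousWithinAt) continuousOn_const
  · intro τ hτ'
    have hτ := Ioo_subset_Icc_self hτ'
    have hur' := hur τ hτ
    refine (mul_sqrt_le_action hT (by linarith [hur'.2])).trans ?_
    rw [show velocity 1 u τ = T • v (T * τ) + Δ from huv τ hτ, norm_add_sq_real, norm_smul,
      Real.norm_of_nonneg hT.le, inner_smul_left, inner_smul_left]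
    have hE := (hy.2 _ (hmT hτ)).2.2.2
    have hV := (abs_le.1 (hη _ (hK _ (hmT hτ)) _ ((hen τ hτ).trans hrη)).2).2
    have hCr : C * ‖e τ‖ ^ 2 ≤ C * r ^ 2 := by
      gcongr; exact hen τ hτ
    have hΔ2 : ‖Δ‖ ^ 2 ≤ (2 * r) ^ 2 := by gcongr
    set w := v (T * τ)
    set x := y (T * τ)
    change ‖w‖ ^ 2 / 2 - potential α m c x = -1 at hE
    have h2 : Real.sqrt 2 = 1 / Real.sqrt 2 * 2 := by
      have h2 : Real.sqrt 2 * Real.sqrt 2 = 2 := Real.mul_self_sqrt (by norm_num)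
      have h2p : 0 < Real.sqrt 2 := by positivity
      field_simp; linarith
    have e1 : T * (Real.sqrt 2 * (potential α m c x - 1)) =
        1 / Real.sqrt 2 * (2 * T * (potential α m c x - 1)) := by
      nth_rewrite 1 [h2]; ring
    rw [e1, hR, mul_one, ← mul_add, ← mul_add]
    refine mul_le_mul_of_nonneg_left ?_ (by positivity)
    have hw : ‖w‖ ^ 2 = 2 * (potential α m c x - 1) := by linear_combination 2 * hE
    have e2 : ((T * ‖w‖) ^ 2 + 2 * (T * ⟪w, Δ⟫) + ‖Δ‖ ^ 2) / (2 * T)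
        = T * (potential α m c x - 1) + ⟪w, Δ⟫ + ‖Δ‖ ^ 2 / (2 * T) := by
      rw [mul_pow, hw]; field_simp
    have e3 : ‖Δ‖ ^ 2 / (2 * T) ≤ 2 / T * r ^ 2 := by
      rw [div_le_iff₀ (by positivity)]
      refine hΔ2.trans (le_of_eq ?_)
      field_simp
    have e4 : T * (potential α m c (u τ) - 1)
        ≤ T * (potential α m c x - 1 + ⟪force α m c x, e τ⟫ + C * r ^ 2) := by
      refine mul_le_mul_of_nonneg_left ?_ hT.le
      have : u τ = x + e τ := rfl
      rw [this]; linarith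
    simp only [conj_trivial]
    rw [e2]
    linarith

/-- A solution in the region that is not longer than an inner arc is an inner arc. -/
lemma IsSolution.isInnerArc (hα : 0 < α) {p q : Plane} {T T' : ℝ} {y y' : ℝ → Plane}
    (h : IsInnerArc α m c p q T y) (hy' : IsSolution α m c T' y')
    (hreg : ∀ t ∈ Icc 0 T', 1 < potential α m c (y' t)) (h0 : y' 0 = p) (h1 : y' T' = q)
    (hle : jacobiLength α m c T' y' ≤ jacobiLength α m c T y) : IsInnerArc α m c p q T' y' := by
  have hpos : ∀ t ∈ Icc 0 T', 0 < Real.sqrt 2 * (potential α m c (y' t) - 1) := fun t ht =>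
    mul_pos (by positivity) (by linarith [hreg t ht])
  have hc : ContinuousOn (fun t => Real.sqrt 2 * (potential α m c (y' t) - 1)) (Icc 0 T') :=
    ((hy'.continuousOn_potential hα).sub continuousOn_const).const_smul (Real.sqrt 2)
  -- The equation solved here has the inverse density as right side: its solution `σ` is time as a
  -- function of arc length, and its inverse `τ` is the arc length along `y'`.
  obtain ⟨ℓ, σ, τ, hℓ, -, hσ0, hσℓ, hσ, hτ0, hτT, hτ⟩ := exists_reparametrization hy'.1
    (hc.inv₀ fun t ht => (hpos t ht).ne') (fun t ht => inv_pos.2 (hpos t ht))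
  have hτd : ∀ t ∈ Icc 0 T', HasDerivWithinAt τ (Real.sqrt 2 * (potential α m c (y' t) - 1))
      (Icc 0 T') t := fun t ht => by simpa using (hτ t ht).2.2
  have hgeo := (hy'.isUnitSpeedGeodesic_comp hα hreg hℓ hσ).1
  have hlen := hy'.jacobiLength_eq_sub hα hτd
  refine ⟨hy', ℓ, fun x => y' (σ x), ⟨hgeo, by simp only [hσ0, h0], by simp only [hσℓ, h1], ?_⟩, τ,
    fun t ht => (hτd t ht).continuousWithinAt, ?_, hτ0, hτT, fun t ht => ?_⟩
  · intro u hu hur hu0 hu1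
    rw [hgeo.jacobiLength_eq]
    refine le_trans ?_ (h.jacobiLength_le hα hu hur hu0 hu1)
    rw [hlen, hτT, hτ0, sub_zero] at hle
    exact hle
  · intro a ha b hb hab
    have hm : StrictMonoOn τ (Icc 0 T') := by
      refine strictMonoOn_of_deriv_pos (convex_Icc _ _)
        (fun t ht => (hτd t ht).continuousWithinAt) fun t ht => ?_
      rw [interior_Icc] at ht
      rw [((hτd t (Ioo_subset_Icc_self ht)).hasDerivAt (Icc_mem_nhds ht.1 ht.2)).deriv]
      exact hpos t (Ioo_subset_Icc_self ht)
    exact hm ha hb hab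
  · simp only [(hτ t ht).2.1]


/-! ### Continuity of the end velocities of inner arcs -/

lemma IsSolution.norm_velocity_sq {T : ℝ} {y : ℝ → Plane} (h : IsSolution α m c T y) {t : ℝ}
    (ht : t ∈ Icc 0 T) : ‖velocity T y t‖ ^ 2 = 2 * (potential α m c (y t) - 1) := by
  linear_combination 2 * (h.2 t ht).2.2.2

lemma IsSolution.norm_sub_le {T S : ℝ} {y : ℝ → Plane} (hα : 0 < α) (h : IsSolution α m c T y)
    (hS : ∀ t ∈ Icc 0 T, ‖velocity T y t‖ ≤ S) : ‖y T - y 0‖ ≤ S * T := by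
  simpa using norm_sub_le_mul_of_hasDerivWithinAt h.1.le (fun t ht => (h.isArc hα t ht).1) hS

/-- Constants controlling the solutions in a compact subset of the region. -/
lemma exists_speed_bounds (hα : 0 < α) {K : Set Plane} (hK : IsCompact K)
    (hKr : K ⊆ jacobiRegion α m c) : ∃ w S : ℝ, 0 < w ∧ 0 < S ∧
      (∀ x ∈ K, w ≤ potential α m c x - 1) ∧
      ∀ (T : ℝ) (y : ℝ → Plane), IsSolution α m c T y → (∀ t ∈ Icc 0 T, y t ∈ K) →
        ∀ t ∈ Icc 0 T, ‖velocity T y t‖ ≤ S := by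
  have hc : ContinuousOn (potential α m c) K := fun x hx =>
    (continuousAt_potential hα m c (hKr hx).1).continuousWithinAt
  obtain ⟨b, hb⟩ := hK.exists_bound_of_continuousOn hc
  have hS : ∀ (T : ℝ) (y : ℝ → Plane), IsSolution α m c T y → (∀ t ∈ Icc 0 T, y t ∈ K) →
        ∀ t ∈ Icc 0 T, ‖velocity T y t‖ ≤ 1 + 2 * |b| := by
    intro T y hy hyK t ht
    have h1 := hy.norm_velocity_sq ht
    have h2 := (le_abs_self _).trans ((hb _ (hyK t ht)).trans (le_abs_self b))
    nlinarith [norm_nonneg (velocity T y t), abs_nonneg b]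
  rcases K.eq_empty_or_nonempty with rfl | hne
  · exact ⟨1, 1 + 2 * |b|, one_pos, by positivity, by simp, hS⟩
  · obtain ⟨x₀, hx₀, hmin⟩ := hK.exists_isMinOn hne hc
    exact ⟨potential α m c x₀ - 1, 1 + 2 * |b|, by linarith [(hKr hx₀).2], by positivity,
      fun x hx => sub_le_sub_right (hmin hx) 1, hS⟩

/-- Limits of solutions staying in a compact set, together with lower semicontinuity of length. -/
lemma exists_limit_isSolution (hα : 0 < α) {K : Set Plane} (hK : IsCompact K)
    (hKr : K ⊆ jacobiRegion α m c) {ι : Type*} {l : Filter ι} [l.NeBot]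
    {T : ι → ℝ} {y : ι → ℝ → Plane} {p q v₀ : Plane} {T₀ : ℝ} (hT₀ : 0 < T₀)
    (hsol : ∀ᶠ i in l, IsSolution α m c (T i) (y i) ∧ ∀ t ∈ Icc 0 (T i), y i t ∈ K)
    (hT : Tendsto T l (𝓝 T₀)) (hp : Tendsto (fun i => y i 0) l (𝓝 p))
    (hq : Tendsto (fun i => y i (T i)) l (𝓝 q))
    (hv : Tendsto (fun i => velocity (T i) (y i) 0) l (𝓝 v₀)) :
    ∃ Y : ℝ → Plane, IsSolution α m c T₀ Y ∧ (∀ t ∈ Icc 0 T₀, Y t ∈ K) ∧ Y 0 = p ∧ Y T₀ = q ∧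
      velocity T₀ Y 0 = v₀ ∧
      Tendsto (fun i => velocity (T i) (y i) (T i)) l (𝓝 (velocity T₀ Y T₀)) ∧
      ∀ L : ℝ, (∀ e > 0, ∀ᶠ i in l, jacobiLength α m c (T i) (y i) ≤ L + e) →
        jacobiLength α m c T₀ Y ≤ L := by
  obtain ⟨G, Λ, B, hG, hGB, hGK⟩ := exists_lipschitz_bounded_eqOn hK (isOpen_offCentres c)
    (fun x hx => (hKr hx).1) (fun x hx => contDiffAt_force α m c hx)
  obtain ⟨w, S, hw, hS, hwK, hSK⟩ := exists_speed_bounds hα hK hKr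
  -- The limit is constructed as an arc of the truncated force. Solving up to `T₀ + 1` covers the
  -- indices with `T i > T₀`, so that Gronwall applies on all of `[0, T i]`.
  obtain ⟨Y, V, hYarc, hY0, hV0⟩ := exists_isArc hG hGB (T := T₀ + 1) (by linarith) p v₀
  set E := Real.exp (((max 1 Λ : NNReal) : ℝ) * (T₀ + 1)) with hE
  set d : ι → ℝ := fun i => E * (‖Y 0 - y i 0‖ + ‖V 0 - velocity (T i) (y i) 0‖) with hd
  have hd0 : Tendsto d l (𝓝 0) := by
    have h1 : Tendsto (fun i => ‖Y 0 - y i 0‖) l (𝓝 0) := by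
      rw [hY0]; simpa using (hp.const_sub p).norm
    have h2 : Tendsto (fun i => ‖V 0 - velocity (T i) (y i) 0‖) l (𝓝 0) := by
      rw [hV0]; simpa using (hv.const_sub v₀).norm
    simpa using (h1.add h2).const_mul E
  have hTlt : ∀ᶠ i in l, T i < T₀ + 1 := hT.eventually (gt_mem_nhds (by linarith))
  have hclose : ∀ᶠ i in l, ∀ t ∈ Icc 0 (T i), ‖Y t - y i t‖ ≤ d i ∧
      ‖V t - velocity (T i) (y i) t‖ ≤ d i := by
    filter_upwards [hsol, hTlt] with i hi hiT t ht
    have harc := (hi.1.isArc hα).congr_force fun t ht => (hGK _ (hi.2 t ht)).symm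
    have := IsArc.gronwall hG harc (hYarc.mono hiT.le) ht
    have hle : Real.exp (((max 1 Λ : NNReal) : ℝ) * T i) ≤ E :=
      Real.exp_le_exp.2 (mul_le_mul_of_nonneg_left hiT.le (NNReal.coe_nonneg _))
    exact ⟨this.1.trans (mul_le_mul_of_nonneg_right hle (by positivity)),
      this.2.trans (mul_le_mul_of_nonneg_right hle (by positivity))⟩
  have hmin : ∀ t ≤ T₀, Tendsto (fun i => min t (T i)) l (𝓝 t) := fun t ht => by
    have := (tendsto_const_nhds (x := t)).min hT
    rwa [min_eq_left ht] at this
  have hlim : ∀ (f : ι → ℝ) (t : ℝ), t ∈ Icc 0 T₀ → Tendsto f l (𝓝 t) →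
      (∀ᶠ i in l, f i ∈ Icc 0 (T i)) → Tendsto (fun i => y i (f i)) l (𝓝 (Y t)) ∧
        Tendsto (fun i => velocity (T i) (y i) (f i)) l (𝓝 (V t)) := by
    intro f t ht hf hfm
    have htm : t ∈ Icc 0 (T₀ + 1) := ⟨ht.1, by linarith [ht.2]⟩
    have hf' : Tendsto f l (𝓝[Icc 0 (T₀ + 1)] t) := by
      refine tendsto_nhdsWithin_iff.2 ⟨hf, ?_⟩
      filter_upwards [hfm, hTlt] with i h1 h2
      exact ⟨h1.1, h1.2.trans h2.le⟩
    have h1 := (hYarc.continuousOn t htm).tendsto.comp hf'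
    have h2 := (hYarc.continuousOn_velocity t htm).tendsto.comp hf'
    have h3 : Tendsto (fun i => Y (f i) - y i (f i)) l (𝓝 0) := by
      refine squeeze_zero_norm' ?_ hd0
      filter_upwards [hclose, hfm] with i hi hfi using (hi _ hfi).1
    have h4 : Tendsto (fun i => V (f i) - velocity (T i) (y i) (f i)) l (𝓝 0) := by
      refine squeeze_zero_norm' ?_ hd0
      filter_upwards [hclose, hfm] with i hi hfi using (hi _ hfi).2
    constructor
    · simpa using h1.sub h3
    · simpa using h2.sub h4
  have hTpos : ∀ᶠ i in l, 0 < T i := hT.eventually (lt_mem_nhds hT₀)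
  have hminm : ∀ t ∈ Icc 0 T₀, ∀ᶠ i in l, min t (T i) ∈ Icc 0 (T i) := fun t ht => by
    filter_upwards [hTpos] with i hi
    exact ⟨le_min ht.1 hi.le, min_le_right _ _⟩
  have hYK : ∀ t ∈ Icc 0 T₀, Y t ∈ K := fun t ht => by
    refine hK.isClosed.mem_of_tendsto (hlim _ t ht (hmin t ht.2) (hminm t ht)).1 ?_
    filter_upwards [hsol, hminm t ht] with i hi hm using hi.2 _ hm
  have hT₀m : T₀ ∈ Icc 0 T₀ := right_mem_Icc.2 hT₀.le
  have h0m : (0 : ℝ) ∈ Icc 0 T₀ := left_mem_Icc.2 hT₀.le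
  have hend := hlim T T₀ hT₀m hT (by filter_upwards [hTpos] with i hi using right_mem_Icc.2 hi.le)
  have harc : IsArc (force α m c) T₀ Y V :=
    (hYarc.mono (by linarith)).congr_force fun t ht => hGK _ (hYK t ht)
  have hE0 : ‖v₀‖ ^ 2 / 2 - potential α m c p = -1 := by
    have hpK : p ∈ K := hY0 ▸ hYK 0 h0m
    have h1 := ((hv.norm.pow 2).div_const 2).sub
      ((continuousAt_potential hα m c (hKr hpK).1).tendsto.comp hp)
    refine tendsto_nhds_unique h1 (tendsto_const_nhds.congr' ?_)
    filter_upwards [hsol] with i hi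
    exact ((hi.1.2 0 (left_mem_Icc.2 hi.1.1.le)).2.2.2).symm
  have hsolY : IsSolution α m c T₀ Y := harc.isSolution hα hT₀ (fun t ht => (hKr (hYK t ht)).1)
    fun t ht => by
      rw [harc.energy_eq hα (fun t ht => (hKr (hYK t ht)).1) ht, hV0, hY0, hE0]
  have hvel : ∀ t ∈ Icc 0 T₀, velocity T₀ Y t = V t := fun t ht => harc.velocity_eq hT₀ ht
  refine ⟨Y, hsolY, hYK, hY0, tendsto_nhds_unique hend.1 hq, (hvel 0 h0m).trans hV0, ?_, ?_⟩
  · rw [hvel T₀ hT₀m]; exact hend.2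
  intro L hL
  set g : ℝ → ℝ := fun t => Real.sqrt 2 * (potential α m c (Y t) - 1) with hg
  have hgc : ContinuousOn g (Icc 0 T₀) :=
    ((hsolY.continuousOn_potential hα).sub continuousOn_const).const_smul (Real.sqrt 2)
  have hprim : ContinuousOn (fun t => ∫ r in (0 : ℝ)..t, g r) (Icc 0 T₀) := by
    have := intervalIntegral.continuousOn_primitive_interval (μ := MeasureTheory.volume)
      (f := g) (a := 0) (b := T₀) (by rw [uIcc_of_le hT₀.le]; exact hgc.integrableOn_Icc)
    rwa [uIcc_of_le hT₀.le] at this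
  have hint : Tendsto (fun i => ∫ r in (0 : ℝ)..(min T₀ (T i)), g r) l
      (𝓝 (jacobiLength α m c T₀ Y)) := by
    rw [hsolY.jacobiLength_eq]
    refine (hprim T₀ hT₀m).tendsto.comp (tendsto_nhdsWithin_iff.2 ⟨hmin T₀ le_rfl, ?_⟩)
    filter_upwards [hTpos] with i hi
    exact ⟨le_min hT₀.le hi.le, min_le_left _ _⟩
  -- Lower semicontinuity: the nonnegative part of the length of `y i` after `min T₀ (T i)` is
  -- dropped, and before it the densities are compared through the speeds, since `2 * (V - 1) =
  -- |v|²` and the velocities differ by at most `d i`.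
  have hcomp : ∀ᶠ i in l, (∫ r in (0 : ℝ)..(min T₀ (T i)), g r) - S * 2 * T₀ * d i
      ≤ jacobiLength α m c (T i) (y i) := by
    filter_upwards [hsol, hclose, hTpos] with i hi hcl hTi
    set τ := min T₀ (T i)
    have hτ0 : 0 ≤ τ := le_min hT₀.le hTi.le
    have hdi : 0 ≤ d i := by simp only [hd]; positivity
    have hfc : ContinuousOn (fun t => Real.sqrt 2 * (potential α m c (y i t) - 1)) (Icc 0 (T i)) :=
      ((hi.1.continuousOn_potential hα).sub continuousOn_const).const_smul (Real.sqrt 2)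
    have hsub1 : Icc 0 τ ⊆ Icc 0 (T i) := Icc_subset_Icc_right (min_le_right _ _)
    have hsub2 : Icc 0 τ ⊆ Icc 0 T₀ := Icc_subset_Icc_right (min_le_left _ _)
    have hI1 : IntervalIntegrable (fun t => Real.sqrt 2 * (potential α m c (y i t) - 1))
        MeasureTheory.volume 0 τ :=
      (hfc.mono (by rw [uIcc_of_le hτ0]; exact hsub1)).intervalIntegrable
    have hI2 : IntervalIntegrable g MeasureTheory.volume 0 τ :=
      (hgc.mono (by rw [uIcc_of_le hτ0]; exact hsub2)).intervalIntegrable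
    have hI3 : IntervalIntegrable (fun t => Real.sqrt 2 * (potential α m c (y i t) - 1))
        MeasureTheory.volume τ (T i) :=
      (hfc.mono (by rw [uIcc_of_le (min_le_right _ _)]; exact Icc_subset_Icc_left hτ0)).intervalIntegrable
    rw [hi.1.jacobiLength_eq, ← intervalIntegral.integral_add_adjacent_intervals hI1 hI3]
    have hpos : 0 ≤ ∫ t in τ..(T i), Real.sqrt 2 * (potential α m c (y i t) - 1) := by
      refine intervalIntegral.integral_nonneg (min_le_right _ _) fun t ht => ?_
      have := (hKr (hi.2 t ⟨hτ0.trans ht.1, ht.2⟩)).2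
      exact mul_nonneg (by positivity) (by linarith)
    have hmono : (∫ r in (0 : ℝ)..τ, (g r - S * 2 * d i))
        ≤ ∫ t in (0 : ℝ)..τ, Real.sqrt 2 * (potential α m c (y i t) - 1) := by
      refine intervalIntegral.integral_mono_on hτ0 (hI2.sub intervalIntegrable_const) hI1
        fun t ht => ?_
      have hv1 := hi.1.norm_velocity_sq (hsub1 ht)
      have hv2 := hsolY.norm_velocity_sq (hsub2 ht)
      have hb1 := hSK _ _ hi.1 hi.2 t (hsub1 ht)
      have hb2 := hSK _ _ hsolY hYK t (hsub2 ht)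
      have hvd := (hcl t (hsub1 ht)).2
      rw [← hvel t (hsub2 ht)] at hvd
      have hdiff : ‖velocity T₀ Y t‖ - ‖velocity (T i) (y i) t‖ ≤ d i :=
        (norm_sub_norm_le _ _).trans hvd
      have h2p : 0 < Real.sqrt 2 := by positivity
      have h2le : Real.sqrt 2 ≤ 2 := by
        rw [Real.sqrt_le_left (by norm_num)]; norm_num
      have key : 2 * (potential α m c (Y t) - 1) - 2 * (potential α m c (y i t) - 1)
          ≤ 2 * S * d i := by
        rw [← hv1, ← hv2]
        nlinarith [norm_nonneg (velocity T₀ Y t), norm_nonneg (velocity (T i) (y i) t)]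
      simp only [hg]
      have : Real.sqrt 2 * (potential α m c (Y t) - potential α m c (y i t)) ≤
          Real.sqrt 2 * (S * d i) := mul_le_mul_of_nonneg_left (by linarith) h2p.le
      nlinarith [mul_nonneg hS.le hdi]
    rw [intervalIntegral.integral_sub hI2 intervalIntegrable_const,
      intervalIntegral.integral_const, sub_zero, smul_eq_mul] at hmono
    have : τ * (S * 2 * d i) ≤ S * 2 * T₀ * d i := by
      have h1 : τ ≤ T₀ := min_le_left _ _
      have h2 : 0 ≤ S * 2 * d i := by positivity
      nlinarith
    linarith
  refine le_of_forall_pos_le_add fun e he => ?_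
  have hlim2 : Tendsto (fun i => (∫ r in (0 : ℝ)..(min T₀ (T i)), g r) - S * 2 * T₀ * d i) l
      (𝓝 (jacobiLength α m c T₀ Y)) := by
    simpa using hint.sub (hd0.const_mul (S * 2 * T₀))
  refine le_of_tendsto hlim2 ?_
  filter_upwards [hcomp, hL e he] with i h1 h2 using h1.trans h2


/-! ### Convergence and first variation of inner arcs in a strongly convex set -/

lemma IsStronglyConvex.isCompact_closure (hα : 0 < α) {U : Set Plane}
    (hU : IsStronglyConvex α m c U) : IsCompact (closure U) :=
  isCompact_of_isClosed_isBounded isClosed_closure ((isBounded_jacobiRegion hα m c).subset hU.2.1)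

lemma IsStronglyConvex.isInnerArc_mem (hα : 0 < α) {U : Set Plane}
    (hU : IsStronglyConvex α m c U) {p q : Plane} (hp : p ∈ closure U) (hq : q ∈ closure U)
    (hpq : p ≠ q) {T : ℝ} {y : ℝ → Plane} (h : IsInnerArc α m c p q T y) :
    ∀ t ∈ Icc 0 T, y t ∈ closure U := by
  obtain ⟨T₀, y₀, -, hmem, huniq⟩ := hU.existsUnique_isInnerArc hα hp hq hpq
  obtain ⟨rfl, hE⟩ := huniq T y h
  exact fun t ht => (hE ht).symm ▸ hmem t ht

lemma IsSolution.mul_le_jacobiLength (hα : 0 < α) {K : Set Plane} {w T : ℝ} {y : ℝ → Plane}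
    (hy : IsSolution α m c T y) (hK : ∀ t ∈ Icc 0 T, y t ∈ K)
    (hw : ∀ x ∈ K, w ≤ potential α m c x - 1) :
    Real.sqrt 2 * w * T ≤ jacobiLength α m c T y := by
  have h1 : (∫ _t in (0 : ℝ)..T, Real.sqrt 2 * w) = Real.sqrt 2 * w * T := by
    rw [intervalIntegral.integral_const, smul_eq_mul, sub_zero, mul_comm]
  rw [← h1, hy.jacobiLength_eq]
  refine intervalIntegral.integral_mono_on hy.1.le intervalIntegrable_const ?_ fun t ht => ?_
  · refine ContinuousOn.intervalIntegrable ?_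
    rw [uIcc_of_le hy.1.le]
    exact ((hy.continuousOn_potential hα).sub continuousOn_const).const_smul (Real.sqrt 2)
  · exact mul_le_mul_of_nonneg_left (hw _ (hK t ht)) (by positivity)

section Convergence

variable {ι : Type*} {l : Filter ι} {U : Set Plane} {P Q : ι → Plane} {T : ι → ℝ}
  {y : ι → ℝ → Plane} {p q : Plane} {T₀ : ℝ} {y₀ : ℝ → Plane}

/-- The Jacobi length of inner arcs is upper semicontinuous in the end points. -/
lemma IsInnerArc.eventually_jacobiLength_le (hα : 0 < α) (hU : IsStronglyConvex α m c U)
    (hin : ∀ᶠ i in l, IsInnerArc α m c (P i) (Q i) (T i) (y i))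
    (hP : Tendsto P l (𝓝 p)) (hQ : Tendsto Q l (𝓝 q)) (hp : p ∈ closure U) (hq : q ∈ closure U)
    (hpq : p ≠ q) (h₀ : IsInnerArc α m c p q T₀ y₀) {e : ℝ} (he : 0 < e) :
    ∀ᶠ i in l, jacobiLength α m c (T i) (y i) ≤ jacobiLength α m c T₀ y₀ + e := by
  obtain ⟨η, hη, C, hC, hTay⟩ := exists_taylor_bound (hU.isCompact_closure hα)
    (isOpen_jacobiRegion hα m c) hU.2.1 (fun x hx => hasGradientAt_potential hα m c hx.1)
    (fun x hx => contDiffAt_force α m c hx.1)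
  have hP' : Tendsto (fun i => P i - p) l (𝓝 0) := by simpa using hP.sub_const p
  have hQ' : Tendsto (fun i => Q i - q) l (𝓝 0) := by simpa using hQ.sub_const q
  have hr : Tendsto (fun i => max ‖P i - p‖ ‖Q i - q‖) l (𝓝 0) := by
    simpa using hP'.norm.max hQ'.norm
  have hlim : Tendsto (fun i => 1 / Real.sqrt 2 * (⟪velocity T₀ y₀ T₀, Q i - q⟫
      - ⟪velocity T₀ y₀ 0, P i - p⟫ + (2 / T₀ + C * T₀) * (max ‖P i - p‖ ‖Q i - q‖) ^ 2)) l
      (𝓝 0) := by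
    have := (((tendsto_const_nhds (x := velocity T₀ y₀ T₀)).inner hQ').sub
      ((tendsto_const_nhds (x := velocity T₀ y₀ 0)).inner hP')).add
      ((hr.pow 2).const_mul (2 / T₀ + C * T₀))
    simpa using this.const_mul (1 / Real.sqrt 2)
  filter_upwards [hin, hr.eventually (gt_mem_nhds hη), hlim.eventually (gt_mem_nhds he)]
    with i h1 h2 h3
  have := h₀.jacobiLength_le_add hα hC hTay (hU.isInnerArc_mem hα hp hq hpq h₀) h1 h2.le
    (le_max_left _ _) (le_max_right _ _)
  linarith

/-- Continuous dependence of inner arcs on their end points. -/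
lemma IsInnerArc.tendsto (hα : 0 < α) (hU : IsStronglyConvex α m c U)
    (hin : ∀ᶠ i in l, P i ∈ closure U ∧ Q i ∈ closure U ∧
      IsInnerArc α m c (P i) (Q i) (T i) (y i))
    (hP : Tendsto P l (𝓝 p)) (hQ : Tendsto Q l (𝓝 q)) (hp : p ∈ closure U) (hq : q ∈ closure U)
    (hpq : p ≠ q) (h₀ : IsInnerArc α m c p q T₀ y₀) :
    Tendsto T l (𝓝 T₀) ∧
      Tendsto (fun i => velocity (T i) (y i) 0) l (𝓝 (velocity T₀ y₀ 0)) ∧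
      Tendsto (fun i => velocity (T i) (y i) (T i)) l (𝓝 (velocity T₀ y₀ T₀)) := by
  have hK := hU.isCompact_closure hα
  obtain ⟨w, S, hw, hS, hwK, hSK⟩ := exists_speed_bounds hα hK hU.2.1
  have hne : ∀ᶠ i in l, P i ≠ Q i := by
    have := (hP.sub hQ).eventually_ne (sub_ne_zero.2 hpq)
    filter_upwards [this] with i hi using sub_ne_zero.1 hi
  have hsol : ∀ᶠ i in l, IsSolution α m c (T i) (y i) ∧ ∀ t ∈ Icc 0 (T i), y i t ∈ closure U := by
    filter_upwards [hin, hne] with i hi hi'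
    exact ⟨hi.2.2.1, hU.isInnerArc_mem hα hi.1 hi.2.1 hi' hi.2.2⟩
  have hlen : ∀ e > 0, ∀ᶠ i in l,
      jacobiLength α m c (T i) (y i) ≤ jacobiLength α m c T₀ y₀ + e := fun e he =>
    IsInnerArc.eventually_jacobiLength_le hα hU (hin.mono fun i hi => hi.2.2) hP hQ hp hq hpq h₀ he
  have hd : 0 < ‖q - p‖ := norm_pos_iff.2 (sub_ne_zero.2 hpq.symm)
  -- The duration is bounded below because the speed is bounded and the end points stay apart, and
  -- above because the length is bounded and `V - 1 ≥ w`. Together with `hvb` this puts durations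
  -- and initial velocities in compact sets.
  have hTb : ∀ᶠ i in l, T i ∈ Icc (‖q - p‖ / 2 / S)
      ((jacobiLength α m c T₀ y₀ + 1) / (Real.sqrt 2 * w)) := by
    filter_upwards [hsol, hin, hlen 1 one_pos, (hQ.sub hP).norm.eventually
      (lt_mem_nhds (half_lt_self hd))] with i h1 h2 h3 h4
    constructor
    · rw [div_le_iff₀ hS, mul_comm]
      have := h1.1.norm_sub_le hα (hSK _ _ h1.1 h1.2)
      rw [h2.2.2.endpoints.1, h2.2.2.endpoints.2] at this
      linarith
    · rw [le_div_iff₀ (by positivity), mul_comm]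
      exact (h1.1.mul_le_jacobiLength hα h1.2 hwK).trans h3
  have hvb : ∀ᶠ i in l, velocity (T i) (y i) 0 ∈ closedBall (0 : Plane) S := by
    filter_upwards [hsol] with i hi
    rw [mem_closedBall_zero_iff]
    exact hSK _ _ hi.1 hi.2 0 (left_mem_Icc.2 hi.1.1.le)
  -- Along an ultrafilter durations and initial velocities converge by compactness, so only the
  -- limit has to be identified.
  suffices H : ∀ 𝒰 : Ultrafilter ι, (𝒰 : Filter ι) ≤ l → Tendsto T 𝒰 (𝓝 T₀) ∧
      Tendsto (fun i => velocity (T i) (y i) 0) 𝒰 (𝓝 (velocity T₀ y₀ 0)) ∧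
      Tendsto (fun i => velocity (T i) (y i) (T i)) 𝒰 (𝓝 (velocity T₀ y₀ T₀)) from
    ⟨tendsto_iff_ultrafilter _ _ _ |>.2 fun 𝒰 h => (H 𝒰 h).1,
      tendsto_iff_ultrafilter _ _ _ |>.2 fun 𝒰 h => (H 𝒰 h).2.1,
      tendsto_iff_ultrafilter _ _ _ |>.2 fun 𝒰 h => (H 𝒰 h).2.2⟩
  intro 𝒰 h𝒰
  obtain ⟨T', hT'm, hT'⟩ := isCompact_Icc.ultrafilter_le_nhds (𝒰.map T)
    (le_principal_iff.2 (h𝒰 hTb))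
  obtain ⟨v', -, hv'⟩ := (isCompact_closedBall (0 : Plane) S).ultrafilter_le_nhds
    (𝒰.map fun i => velocity (T i) (y i) 0) (le_principal_iff.2 (h𝒰 hvb))
  have hT'0 : 0 < T' := lt_of_lt_of_le (by positivity) hT'm.1
  obtain ⟨Y, hY, hYK, hY0, hYT, hYv0, hYvT, hYL⟩ := exists_limit_isSolution hα hK hU.2.1 hT'0
    (h𝒰 hsol) hT'
    ((hP.mono_left h𝒰).congr' (h𝒰 (hin.mono fun i hi => hi.2.2.endpoints.1.symm)))
    ((hQ.mono_left h𝒰).congr' (h𝒰 (hin.mono fun i hi => hi.2.2.endpoints.2.symm))) hv'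
  -- Upper semicontinuity along the family and lower semicontinuity at the limit show that `Y` is
  -- not longer than `y₀`. It is therefore minimal, and uniqueness makes the limit independent of
  -- the ultrafilter.
  have hYin : IsInnerArc α m c p q T' Y := hY.isInnerArc hα h₀
    (fun t ht => (hU.2.1 (hYK t ht)).2) hY0 hYT (hYL _ fun e he => h𝒰 (hlen e he))
  obtain ⟨T₁, y₁, -, -, huniq⟩ := hU.existsUnique_isInnerArc hα hp hq hpq
  obtain ⟨e1, hE1⟩ := huniq _ _ hYin
  obtain ⟨e2, hE2⟩ := huniq _ _ h₀
  subst e1 e2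
  have hEq : EqOn Y y₀ (Icc 0 T₀) := fun t ht => (hE1 ht).trans (hE2 ht).symm
  have hvel : ∀ t ∈ Icc 0 T₀, velocity T₀ Y t = velocity T₀ y₀ t := fun t ht =>
    derivWithin_congr hEq (hEq ht)
  refine ⟨hT', ?_, ?_⟩
  · rw [← hvel 0 (left_mem_Icc.2 hT'0.le), hYv0]; exact hv'
  · rw [← hvel _ (right_mem_Icc.2 hT'0.le)]; exact hYvT

/-- First variation formula for the Jacobi length of inner arcs. -/
lemma IsInnerArc.jacobiLength_isLittleO (hα : 0 < α) (hU : IsStronglyConvex α m c U)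
    (hin : ∀ᶠ i in l, P i ∈ closure U ∧ Q i ∈ closure U ∧
      IsInnerArc α m c (P i) (Q i) (T i) (y i))
    (hP : Tendsto P l (𝓝 p)) (hQ : Tendsto Q l (𝓝 q)) (hp : p ∈ closure U) (hq : q ∈ closure U)
    (hpq : p ≠ q) (h₀ : IsInnerArc α m c p q T₀ y₀) :
    (fun i => jacobiLength α m c (T i) (y i) - jacobiLength α m c T₀ y₀ - 1 / Real.sqrt 2 *
      (⟪velocity T₀ y₀ T₀, Q i - q⟫ - ⟪velocity T₀ y₀ 0, P i - p⟫)) =o[l]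
      fun i => max ‖P i - p‖ ‖Q i - q‖ := by
  obtain ⟨hT, hv0, hvT⟩ := IsInnerArc.tendsto hα hU hin hP hQ hp hq hpq h₀
  have hT0 : 0 < T₀ := h₀.1.1
  obtain ⟨η, hη, C, hC, hTay⟩ := exists_taylor_bound (hU.isCompact_closure hα)
    (isOpen_jacobiRegion hα m c) hU.2.1 (fun x hx => hasGradientAt_potential hα m c hx.1)
    (fun x hx => contDiffAt_force α m c hx.1)
  have hP' : Tendsto (fun i => P i - p) l (𝓝 0) := by simpa using hP.sub_const p
  have hQ' : Tendsto (fun i => Q i - q) l (𝓝 0) := by simpa using hQ.sub_const q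
  have hr : Tendsto (fun i => max ‖P i - p‖ ‖Q i - q‖) l (𝓝 0) := by
    simpa using hP'.norm.max hQ'.norm
  have hne : ∀ᶠ i in l, P i ≠ Q i := by
    have := (hP.sub hQ).eventually_ne (sub_ne_zero.2 hpq)
    filter_upwards [this] with i hi using sub_ne_zero.1 hi
  have hω : Tendsto (fun i => ‖velocity (T i) (y i) (T i) - velocity T₀ y₀ T₀‖
      + ‖velocity (T i) (y i) 0 - velocity T₀ y₀ 0‖
      + ((2 / T₀ + C * T₀) + (2 / T i + C * T i)) * max ‖P i - p‖ ‖Q i - q‖) l (𝓝 0) := by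
    have h1 := (tendsto_const_nhds (x := (2 : ℝ))).div hT hT0.ne'
    have h2 := ((h1.add (hT.const_mul C)).const_add (2 / T₀ + C * T₀)).mul hr
    simpa using (((hvT.sub_const (velocity T₀ y₀ T₀)).norm.add
      (hv0.sub_const (velocity T₀ y₀ 0)).norm).add h2)
  rw [Asymptotics.isLittleO_iff]
  intro e he
  filter_upwards [hin, hne, hr.eventually (gt_mem_nhds hη), hω.eventually (gt_mem_nhds he)]
    with i h1 hi h2 h3
  set r := max ‖P i - p‖ ‖Q i - q‖
  have hr0 : 0 ≤ r := le_max_of_le_left (norm_nonneg _)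
  have hTi : 0 < T i := h1.2.2.1.1
  -- The upper bound is used in both directions. In `hlb` the base arc is the moving one, so its end
  -- velocities and duration enter; `hω` says that replacing the velocities by the limiting ones
  -- costs `o(r)`, and that the quadratic terms are `o(r)` as well.
  have hub := h₀.jacobiLength_le_add hα hC hTay (hU.isInnerArc_mem hα hp hq hpq h₀) h1.2.2 h2.le
    (le_max_left _ _) (le_max_right _ _)
  have hlb := h1.2.2.jacobiLength_le_add hα hC hTay
    (hU.isInnerArc_mem hα h1.1 h1.2.1 hi h1.2.2) h₀ h2.le
    (by rw [norm_sub_rev]; exact le_max_left _ _) (by rw [norm_sub_rev]; exact le_max_right _ _)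
  rw [← neg_sub (Q i) q, ← neg_sub (P i) p, inner_neg_right, inner_neg_right] at hlb
  have i1 : |⟪velocity (T i) (y i) (T i) - velocity T₀ y₀ T₀, Q i - q⟫|
      ≤ ‖velocity (T i) (y i) (T i) - velocity T₀ y₀ T₀‖ * r :=
    (abs_real_inner_le_norm _ _).trans
      (mul_le_mul_of_nonneg_left (le_max_right _ _) (norm_nonneg _))
  have i2 : |⟪velocity (T i) (y i) 0 - velocity T₀ y₀ 0, P i - p⟫|
      ≤ ‖velocity (T i) (y i) 0 - velocity T₀ y₀ 0‖ * r :=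
    (abs_real_inner_le_norm _ _).trans
      (mul_le_mul_of_nonneg_left (le_max_left _ _) (norm_nonneg _))
  rw [inner_sub_left, abs_le] at i1 i2
  set κ := 1 / Real.sqrt 2
  have hκ0 : 0 ≤ κ := by positivity
  have hκ1 : κ ≤ 1 := by
    rw [div_le_one (by positivity)]
    exact Real.one_le_sqrt.2 (by norm_num)
  set A := ‖velocity (T i) (y i) (T i) - velocity T₀ y₀ T₀‖
  set B := ‖velocity (T i) (y i) 0 - velocity T₀ y₀ 0‖
  have hc1 : 0 ≤ (2 / T₀ + C * T₀) * r ^ 2 := by positivity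
  have hc2 : 0 ≤ (2 / T i + C * T i) * r ^ 2 := by positivity
  have hA : 0 ≤ A * r := mul_nonneg (norm_nonneg _) hr0
  have hB : 0 ≤ B * r := mul_nonneg (norm_nonneg _) hr0
  have hfin : A * r + B * r + ((2 / T₀ + C * T₀) * r ^ 2 + (2 / T i + C * T i) * r ^ 2) ≤ e * r := by
    have := mul_le_mul_of_nonneg_right h3.le hr0
    refine le_trans (le_of_eq ?_) this
    ring
  have hκX : ∀ X : ℝ, 0 ≤ X → κ * X ≤ X := fun X hX => by nlinarith
  rw [Real.norm_eq_abs, Real.norm_eq_abs, abs_of_nonneg hr0, abs_le]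
  constructor
  · have h5 := hκX (A * r + B * r + (2 / T i + C * T i) * r ^ 2) (by linarith)
    have h6 : κ * (-⟪velocity (T i) (y i) (T i), Q i - q⟫ - -⟪velocity (T i) (y i) 0, P i - p⟫
        + (2 / T i + C * T i) * r ^ 2) ≤ κ * (-(⟪velocity T₀ y₀ T₀, Q i - q⟫
        - ⟪velocity T₀ y₀ 0, P i - p⟫) + (A * r + B * r + (2 / T i + C * T i) * r ^ 2)) :=
      mul_le_mul_of_nonneg_left (by linarith [i1.1, i1.2, i2.1, i2.2]) hκ0
    linarith
  · have h5 := hκX ((2 / T₀ + C * T₀) * r ^ 2) hc1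
    linarith

end Convergence

end

/-! ### The cross product of the plane -/

/-- The cross product (oriented area) of two vectors of the plane. -/
def cross (x y : Plane) : ℝ := x 0 * y 1 - x 1 * y 0

lemma inner_eq (x y : Plane) : ⟪x, y⟫ = x 0 * y 0 + x 1 * y 1 := by
  simp [PiLp.inner_apply, Fin.sum_univ_two, mul_comm]

lemma norm_sq_eq (x : Plane) : ‖x‖ ^ 2 = x 0 ^ 2 + x 1 ^ 2 := by
  rw [← real_inner_self_eq_norm_sq, inner_eq]; ring

lemma cross_self (x : Plane) : cross x x = 0 := by simp only [cross]; ring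

lemma cross_sub_left (x x' y : Plane) : cross (x - x') y = cross x y - cross x' y := by
  simp only [cross, PiLp.sub_apply]; ring

lemma cross_sub_right (x y y' : Plane) : cross x (y - y') = cross x y - cross x y' := by
  simp only [cross, PiLp.sub_apply]; ring

lemma cross_add_right (x y y' : Plane) : cross x (y + y') = cross x y + cross x y' := by
  simp only [cross, PiLp.add_apply]; ring

lemma cross_smul_right (x y : Plane) (a : ℝ) : cross x (a • y) = a * cross x y := by
  simp only [cross, PiLp.smul_apply, smul_eq_mul]; ring

lemma inner_sq_add_cross_sq (x y : Plane) : ⟪x, y⟫ ^ 2 + cross x y ^ 2 = ‖x‖ ^ 2 * ‖y‖ ^ 2 := by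
  rw [norm_sq_eq, norm_sq_eq, inner_eq, cross]; ring

lemma abs_cross_le (x y : Plane) : |cross x y| ≤ ‖x‖ * ‖y‖ := by
  refine abs_le_of_sq_le_sq ?_ (by positivity)
  rw [mul_pow, ← inner_sq_add_cross_sq]
  nlinarith [sq_nonneg ⟪x, y⟫]

lemma norm_mul_norm_le (x y : Plane) : ‖x‖ * ‖y‖ ≤ |⟪x, y⟫| + |cross x y| := by
  refine le_of_sq_le_sq ?_ (by positivity)
  rw [mul_pow, ← inner_sq_add_cross_sq, ← sq_abs ⟪x, y⟫, ← sq_abs (cross x y)]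
  nlinarith [abs_nonneg ⟪x, y⟫, abs_nonneg (cross x y)]

lemma hasDerivWithinAt_coord {f : ℝ → Plane} {f' : Plane} {s : Set ℝ} {t : ℝ}
    (hf : HasDerivWithinAt f f' s t) (i : Fin 2) : HasDerivWithinAt (fun t => f t i) (f' i) s t :=
  (EuclideanSpace.proj (𝕜 := ℝ) i : Plane →L[ℝ] ℝ).hasFDerivAt.comp_hasDerivWithinAt t hf

lemma HasDerivWithinAt.cross {f g : ℝ → Plane} {f' g' : Plane} {s : Set ℝ} {t : ℝ}
    (hf : HasDerivWithinAt f f' s t) (hg : HasDerivWithinAt g g' s t) :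
    HasDerivWithinAt (fun t => NCentre.cross (f t) (g t))
      (NCentre.cross f' (g t) + NCentre.cross (f t) g') s t := by
  have := ((hasDerivWithinAt_coord hf 0).mul (hasDerivWithinAt_coord hg 1)).sub
    ((hasDerivWithinAt_coord hf 1).mul (hasDerivWithinAt_coord hg 0))
  refine this.congr_deriv ?_
  simp only [NCentre.cross]; ring

/-! ### Second order estimates for functions of one variable -/

/-- The base point may lie on either side of `t`, and `κ` may have any sign: a negative `κ` serves
to bound the distance to the origin from below. -/
lemma le_taylor_of_second_deriv_le {f f' f'' : ℝ → ℝ} {T κ : ℝ}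
    (hf : ∀ t ∈ Icc 0 T, HasDerivWithinAt f (f' t) (Icc 0 T) t)
    (hf' : ∀ t ∈ Icc 0 T, HasDerivWithinAt f' (f'' t) (Icc 0 T) t)
    (h : ∀ t ∈ Icc 0 T, f'' t ≤ -κ) {s t : ℝ} (hs : s ∈ Icc 0 T) (ht : t ∈ Icc 0 T) :
    f t ≤ f s + f' s * (t - s) - κ / 2 * (t - s) ^ 2 := by
  have h1 : ∀ a ∈ Icc 0 T, ∀ b ∈ Icc 0 T, a ≤ b → f' b - f' a ≤ -κ * (b - a) := by
    intro a ha b hb hab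
    have hsub : Icc a b ⊆ Icc 0 T := Icc_subset_Icc ha.1 hb.2
    exact sub_le_mul_of_hasDerivWithinAt_le hab (fun t ht => (hf' t (hsub ht)).mono hsub)
      fun t ht => h t (hsub ht)
  set g : ℝ → ℝ := fun τ => f τ - (f s + f' s * (τ - s) - κ / 2 * (τ - s) ^ 2) with hg
  have hgd : ∀ τ ∈ Icc 0 T, HasDerivWithinAt g (f' τ - (f' s - κ * (τ - s))) (Icc 0 T) τ := by
    intro τ hτ
    have hid := (hasDerivWithinAt_id τ (Icc 0 T)).sub_const s
    have := (hf τ hτ).sub (((hid.const_mul (f' s)).const_add (f s)).sub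
      ((hid.pow 2).const_mul (κ / 2)))
    refine this.congr_deriv ?_
    simp only [id]; push_cast; ring
  have hgs : g s = 0 := by simp [hg]
  rcases le_total s t with hst | hts
  · have hsub : Icc s t ⊆ Icc 0 T := Icc_subset_Icc hs.1 ht.2
    have := sub_le_mul_of_hasDerivWithinAt_le (C := 0) hst
      (fun τ hτ => (hgd τ (hsub hτ)).mono hsub)
      fun τ hτ => by linarith [h1 s hs τ (hsub hτ) hτ.1]
    simp only [hgs] at this
    simp only [hg] at this; linarith
  · have hsub : Icc t s ⊆ Icc 0 T := Icc_subset_Icc ht.1 hs.2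
    have := mul_le_sub_of_le_hasDerivWithinAt (C := 0) hts
      (fun τ hτ => (hgd τ (hsub hτ)).mono hsub)
      fun τ hτ => by linarith [h1 τ (hsub hτ) s hs hτ.2]
    simp only [hgs] at this
    simp only [hg] at this; linarith

/-- A uniformly concave function lies above its chord. -/
lemma le_sub_of_second_deriv_le {f f' f'' : ℝ → ℝ} {T κ b : ℝ} (hT : 0 < T)
    (hf : ∀ t ∈ Icc 0 T, HasDerivWithinAt f (f' t) (Icc 0 T) t)
    (hf' : ∀ t ∈ Icc 0 T, HasDerivWithinAt f' (f'' t) (Icc 0 T) t)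
    (h : ∀ t ∈ Icc 0 T, f'' t ≤ -κ) (h0 : b ≤ f 0) (h1 : b ≤ f T) {t : ℝ} (ht : t ∈ Icc 0 T) :
    κ / 2 * t * (T - t) ≤ f t - b := by
  -- The Taylor bounds from `t` to the two ends are averaged with weights `T - t` and `t`, which
  -- eliminates `f' t`.
  have e1 := le_taylor_of_second_deriv_le hf hf' h ht (left_mem_Icc.2 hT.le)
  have e2 := le_taylor_of_second_deriv_le hf hf' h ht (right_mem_Icc.2 hT.le)
  have e3 : (T - t) * b ≤ (T - t) * (f t + f' t * (0 - t) - κ / 2 * (0 - t) ^ 2) :=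
    mul_le_mul_of_nonneg_left (h0.trans e1) (by linarith [ht.2])
  have e4 : t * b ≤ t * (f t + f' t * (T - t) - κ / 2 * (T - t) ^ 2) :=
    mul_le_mul_of_nonneg_left (h1.trans e2) ht.1
  have e5 : T * (κ / 2 * t * (T - t)) ≤ T * (f t - b) := by linarith
  exact le_of_mul_le_mul_left e5 hT

/-! ### Perturbed central forces -/

/-- `F` is, up to a term of size `η` in the Lipschitz norm, the central force `-Ψ(x) x`. -/
structure IsNearlyCentral (F : Plane → Plane) (Ψ : Plane → ℝ) (L : NNReal) (B η : ℝ) : Prop where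
  lipschitz : LipschitzWith L F
  bounded : ∀ x, ‖F x‖ ≤ B
  lipschitz_coeff : LipschitzWith L Ψ
  small : ∀ x, ‖F x + Ψ x • x‖ ≤ η
  small_lipschitz : ∀ x x', ‖(F x' + Ψ x' • x') - (F x + Ψ x • x)‖ ≤ η * ‖x' - x‖

/-- An arc leaving the circle of radius `R` and coming back to it, staying in the annulus
`R ≤ |y| ≤ R₂`, with angular momentum at most `h`. -/
structure IsReturnArc (F : Plane → Plane) (R R₂ S κ τ₀ Tmax h T : ℝ) (y v : ℝ → Plane) : Prop where
  arc : IsArc F T y v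
  le_time : τ₀ ≤ T
  time_le : T ≤ Tmax
  mem : ∀ t ∈ Icc 0 T, R ≤ ‖y t‖ ∧ ‖y t‖ ≤ R₂
  start : ‖y 0‖ = R
  finish : ‖y T‖ = R
  speed : ∀ t ∈ Icc 0 T, ‖v t‖ ≤ S
  momentum : ∀ t ∈ Icc 0 T, |cross (y t) (v t)| ≤ h
  concave : ∀ t ∈ Icc 0 T, κ / 2 * t * (T - t) ≤ ‖y t‖ - R

/-- Common constant of Gronwall's inequality for arcs of duration at most `Tmax`. -/
noncomputable def gronwallConst (L : NNReal) (Tmax : ℝ) : ℝ :=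
  Real.exp (((max 1 L : NNReal) : ℝ) * Tmax)

lemma gronwallConst_pos (L : NNReal) (Tmax : ℝ) : 0 < gronwallConst L Tmax := Real.exp_pos _

section Compare

variable {F : Plane → Plane} {Ψ : Plane → ℝ} {L : NNReal} {B η R R₂ S κ τ₀ Tmax T₁ T₂ D : ℝ}
  {y₁ v₁ y₂ v₂ : ℝ → Plane}

lemma IsArc.gronwall_le (hF : LipschitzWith L F) (h₁ : IsArc F T₁ y₁ v₁) (h₂ : IsArc F T₁ y₂ v₂)
    (hT : T₁ ≤ Tmax) (hD : ‖y₂ 0 - y₁ 0‖ + ‖v₂ 0 - v₁ 0‖ ≤ D) {t : ℝ} (ht : t ∈ Icc 0 T₁) :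
    ‖y₂ t - y₁ t‖ ≤ gronwallConst L Tmax * D ∧ ‖v₂ t - v₁ t‖ ≤ gronwallConst L Tmax * D := by
  have := IsArc.gronwall hF h₁ h₂ ht
  have hle : Real.exp (((max 1 L : NNReal) : ℝ) * T₁) ≤ gronwallConst L Tmax :=
    Real.exp_le_exp.2 (mul_le_mul_of_nonneg_left hT (NNReal.coe_nonneg _))
  have h3 := mul_le_mul hle hD (by positivity) (gronwallConst_pos L Tmax).le
  exact ⟨this.1.trans h3, this.2.trans h3⟩

/-- The Wronskian `(y₂ - y₁)' × y₁ - (y₂ - y₁) × y₁'` is nearly constant. -/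
lemma abs_wronskian_sub_le {Z : ℝ} (hF : IsNearlyCentral F Ψ L B η) (hη0 : 0 ≤ η)
    (h₁ : IsReturnArc F R R₂ S κ τ₀ Tmax η T₁ y₁ v₁) (h₂ : IsArc F T₁ y₂ v₂) (hR₂ : 0 ≤ R₂)
    (hZ : ∀ t ∈ Icc 0 T₁, ‖y₂ t - y₁ t‖ ≤ Z) {t : ℝ} (ht : t ∈ Icc 0 T₁) :
    |(cross (v₂ t - v₁ t) (y₁ t) - cross (y₂ t - y₁ t) (v₁ t))
      - (cross (v₂ 0 - v₁ 0) (y₁ 0) - cross (y₂ 0 - y₁ 0) (v₁ 0))|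
      ≤ Tmax * ((η * (R₂ + 1) + L * R₂ * Z) * Z) := by
  have hL0 : (0 : ℝ) ≤ L := L.2
  have hZ0 : 0 ≤ Z := (norm_nonneg _).trans (hZ t ht)
  have hqd : ∀ t ∈ Icc 0 T₁, HasDerivWithinAt
      (fun t => cross (v₂ t - v₁ t) (y₁ t) - cross (y₂ t - y₁ t) (v₁ t))
      (cross (F (y₂ t) - F (y₁ t)) (y₁ t) - cross (y₂ t - y₁ t) (F (y₁ t))) (Icc 0 T₁) t := by
    intro t ht
    have := (HasDerivWithinAt.cross ((h₂ t ht).2.sub (h₁.arc t ht).2) (h₁.arc t ht).1).sub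
      (HasDerivWithinAt.cross ((h₂ t ht).1.sub (h₁.arc t ht).1) (h₁.arc t ht).2)
    refine this.congr_deriv ?_
    simp only [Pi.sub_apply]; ring
  have hqb : ∀ t ∈ Icc 0 T₁, ‖cross (F (y₂ t) - F (y₁ t)) (y₁ t)
      - cross (y₂ t - y₁ t) (F (y₁ t))‖ ≤ (η * (R₂ + 1) + L * R₂ * Z) * Z := by
    intro t ht
    have hz := hZ t ht
    have hy₁ := (h₁.mem t ht).2
    set E₁ := F (y₁ t) + Ψ (y₁ t) • y₁ t with hE₁
    set E₂ := F (y₂ t) + Ψ (y₂ t) • y₂ t with hE₂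
    -- An exactly central force with constant coefficient would contribute nothing. What remains is
    -- the noncentral error, of order `η * Z`, and the variation of `Ψ`, which is multiplied by `z ×
    -- y₁` and hence is quadratic in `Z`.
    have e : cross (F (y₂ t) - F (y₁ t)) (y₁ t) - cross (y₂ t - y₁ t) (F (y₁ t))
        = cross (E₂ - E₁) (y₁ t) - cross (y₂ t - y₁ t) E₁
          - (Ψ (y₂ t) - Ψ (y₁ t)) * cross (y₂ t - y₁ t) (y₁ t) := by
      simp only [hE₁, hE₂, cross, PiLp.sub_apply, PiLp.add_apply, PiLp.smul_apply, smul_eq_mul]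
      ring
    have b1 : |cross (E₂ - E₁) (y₁ t)| ≤ η * Z * R₂ := by
      refine (abs_cross_le _ _).trans (mul_le_mul ?_ hy₁ (norm_nonneg _) (by positivity))
      exact (hF.small_lipschitz _ _).trans (mul_le_mul_of_nonneg_left hz hη0)
    have b2 : |cross (y₂ t - y₁ t) E₁| ≤ Z * η :=
      (abs_cross_le _ _).trans (mul_le_mul hz (hF.small _) (norm_nonneg _) hZ0)
    have b3 : |(Ψ (y₂ t) - Ψ (y₁ t)) * cross (y₂ t - y₁ t) (y₁ t)| ≤ (L * Z) * (Z * R₂) := by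
      rw [abs_mul]
      refine mul_le_mul ?_ ?_ (abs_nonneg _) (by positivity)
      · have := hF.lipschitz_coeff.norm_sub_le (y₂ t) (y₁ t)
        exact this.trans (mul_le_mul_of_nonneg_left hz hL0)
      · exact (abs_cross_le _ _).trans (mul_le_mul hz hy₁ (norm_nonneg _) hZ0)
    rw [Real.norm_eq_abs, e]
    refine (abs_sub _ _).trans ((add_le_add (abs_sub _ _) b3).trans ?_)
    refine (add_le_add_left (add_le_add b1 b2) _).trans (le_of_eq ?_)
    ring
  have h0m : (0 : ℝ) ∈ Icc 0 T₁ := left_mem_Icc.2 (ht.1.trans ht.2)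
  have := (convex_Icc 0 T₁).norm_image_sub_le_of_norm_hasDerivWithin_le hqd hqb h0m ht
  rw [Real.norm_eq_abs, sub_zero, Real.norm_of_nonneg ht.1, mul_comm] at this
  exact this.trans (mul_le_mul_of_nonneg_right (ht.2.trans h₁.time_le) (by positivity))

/-- The derivative of the angular variation in terms of the Wronskian. -/
lemma hasDerivWithinAt_angular_variation {s : Set ℝ} {t : ℝ}
    (hy : HasDerivWithinAt y₁ (v₁ t) s t)
    (hz : HasDerivWithinAt (fun t => y₂ t - y₁ t) (v₂ t - v₁ t) s t) (hn : ‖y₁ t‖ ≠ 0) :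
    HasDerivWithinAt (fun t => cross (y₂ t - y₁ t) (y₁ t) / ‖y₁ t‖ ^ 2)
      ((cross (v₂ t - v₁ t) (y₁ t) - cross (y₂ t - y₁ t) (v₁ t)) / ‖y₁ t‖ ^ 2
      + 2 * ⟪y₂ t - y₁ t, y₁ t⟫ * cross (y₁ t) (v₁ t) / ‖y₁ t‖ ^ 4) s t := by
  refine ((HasDerivWithinAt.cross hz hy).div hy.norm_sq (pow_ne_zero 2 hn)).congr_deriv ?_
  have e4 : ‖y₁ t‖ ^ 4 = (‖y₁ t‖ ^ 2) ^ 2 := by ring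
  have key : (cross (v₂ t - v₁ t) (y₁ t) + cross (y₂ t - y₁ t) (v₁ t)) * ‖y₁ t‖ ^ 2
      - cross (y₂ t - y₁ t) (y₁ t) * (2 * ⟪y₁ t, v₁ t⟫)
      = (cross (v₂ t - v₁ t) (y₁ t) - cross (y₂ t - y₁ t) (v₁ t)) * ‖y₁ t‖ ^ 2
        + 2 * ⟪y₂ t - y₁ t, y₁ t⟫ * cross (y₁ t) (v₁ t) := by
    rw [norm_sq_eq]
    simp only [inner_eq, cross, PiLp.sub_apply]
    ring
  rw [key, e4, add_div]
  congr 1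
  rw [sq (‖y₁ t‖ ^ 2), mul_div_mul_right _ _ (pow_ne_zero 2 hn)]

/-- Nondegeneracy in the tangential direction. The derivative of `μ = z × y₁ / |y₁|²` is the
Wronskian over `|y₁|²`, up to a term with the small angular momentum of `y₁` as a factor. Since the
Wronskian stays within `X` of `q₀`, the increment of `μ` is at least `T₁ * |q₀| / R₂²` minus errors,
while it is bounded by the values of `μ` at the two ends. -/
lemma abs_angular_variation_ge {X Z q₀ : ℝ} (hR : 0 < R) (hη0 : 0 ≤ η) (hT₁ : 0 < T₁)
    (h₁ : IsReturnArc F R R₂ S κ τ₀ Tmax η T₁ y₁ v₁) (h₂ : IsArc F T₁ y₂ v₂) (hR₂ : 0 < R₂)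
    (hZ : ∀ t ∈ Icc 0 T₁, ‖y₂ t - y₁ t‖ ≤ Z)
    (hX : ∀ t ∈ Icc 0 T₁,
      |(cross (v₂ t - v₁ t) (y₁ t) - cross (y₂ t - y₁ t) (v₁ t)) - q₀| ≤ X) :
    T₁ * (|q₀| / R₂ ^ 2 - (X / R ^ 2 + 2 * (Z * R₂) * η / R ^ 4)) ≤
      |cross (y₂ T₁ - y₁ T₁) (y₁ T₁)| / R ^ 2 + |cross (y₂ 0 - y₁ 0) (y₁ 0)| / R ^ 2 := by
  have h0m : (0 : ℝ) ∈ Icc 0 T₁ := left_mem_Icc.2 hT₁.le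
  have hX0 : 0 ≤ X := (abs_nonneg _).trans (hX 0 h0m)
  have hZ0 : 0 ≤ Z := (norm_nonneg _).trans (hZ 0 h0m)
  have hn0 : ∀ t ∈ Icc 0 T₁, 0 < ‖y₁ t‖ := fun t ht => hR.trans_le (h₁.mem t ht).1
  set μ : ℝ → ℝ := fun t => cross (y₂ t - y₁ t) (y₁ t) / ‖y₁ t‖ ^ 2 with hμ
  have hμd := fun t (ht : t ∈ Icc 0 T₁) => hasDerivWithinAt_angular_variation (h₁.arc t ht).1
    ((h₂ t ht).1.sub (h₁.arc t ht).1) (hn0 t ht).ne'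
  set c := X / R ^ 2 + 2 * (Z * R₂) * η / R ^ 4 with hc
  have hμb : ∀ t ∈ Icc 0 T₁, |(cross (v₂ t - v₁ t) (y₁ t) - cross (y₂ t - y₁ t) (v₁ t)) / ‖y₁ t‖ ^ 2
      + 2 * ⟪y₂ t - y₁ t, y₁ t⟫ * cross (y₁ t) (v₁ t) / ‖y₁ t‖ ^ 4 - q₀ / ‖y₁ t‖ ^ 2| ≤ c := by
    intro t ht
    have hn := (h₁.mem t ht).1
    have hn2 : R ^ 2 ≤ ‖y₁ t‖ ^ 2 := by gcongr
    have hn4 : R ^ 4 ≤ ‖y₁ t‖ ^ 4 := by gcongr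
    rw [add_sub_right_comm, ← sub_div]
    refine (abs_add_le _ _).trans ?_
    rw [abs_div, abs_div, abs_of_nonneg (by positivity : 0 ≤ ‖y₁ t‖ ^ 2),
      abs_of_nonneg (by positivity : 0 ≤ ‖y₁ t‖ ^ 4)]
    refine add_le_add (div_le_div₀ hX0 (hX t ht) (by positivity) hn2)
      (div_le_div₀ (by positivity) ?_ (by positivity) hn4)
    rw [abs_mul, abs_mul, abs_two]
    refine mul_le_mul (mul_le_mul_of_nonneg_left ?_ zero_le_two) (h₁.momentum t ht)
      (abs_nonneg _) (by positivity)
    exact (abs_real_inner_le_norm _ _).trans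
      (mul_le_mul (hZ t ht) (h₁.mem t ht).2 (norm_nonneg _) hZ0)
  have hqn : ∀ t ∈ Icc 0 T₁, |q₀| / R₂ ^ 2 ≤ |q₀| / ‖y₁ t‖ ^ 2 := fun t ht => by
    have h5 := hn0 t ht
    have h6 := (h₁.mem t ht).2
    gcongr
  have hμT : T₁ * (|q₀| / R₂ ^ 2 - c) ≤ |μ T₁ - μ 0| := by
    rcases le_total 0 q₀ with hs | hs
    · have := mul_le_sub_of_le_hasDerivWithinAt hT₁.le hμd (C := |q₀| / R₂ ^ 2 - c) fun t ht => by
        have h5 := (abs_le.1 (hμb t ht)).1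
        have h6 := hqn t ht
        rw [abs_of_nonneg hs] at h6 ⊢
        linarith
      rw [sub_zero, mul_comm] at this
      exact this.trans (le_abs_self _)
    · have := sub_le_mul_of_hasDerivWithinAt_le hT₁.le hμd (C := -(|q₀| / R₂ ^ 2 - c)) fun t ht => by
        have h5 := (abs_le.1 (hμb t ht)).2
        have h6 := hqn t ht
        rw [abs_of_nonpos hs] at h6 ⊢
        rw [neg_div (‖y₁ t‖ ^ 2)] at h6
        linarith
      rw [sub_zero] at this
      refine le_trans ?_ (neg_le_abs _)
      linarith
  refine hμT.trans ((abs_sub _ _).trans (le_of_eq ?_))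
  simp only [hμ, h₁.start, h₁.finish, abs_div, abs_of_pos (pow_pos hR 2)]

/-- Behaviour of the second arc between the two return times. -/
lemma IsReturnArc.after_return {Z : ℝ} (hS : 0 < S) (hκ : 0 < κ) (hτ₀ : 0 < τ₀)
    (h₁ : IsReturnArc F R R₂ S κ τ₀ Tmax η T₁ y₁ v₁)
    (h₂ : IsReturnArc F R R₂ S κ τ₀ Tmax η T₂ y₂ v₂) (hTT : T₁ ≤ T₂)
    (hZ : ‖y₂ T₁ - y₁ T₁‖ ≤ Z) :
    T₂ - T₁ ≤ 2 / (κ * τ₀) * Z ∧ ‖y₂ T₂ - y₁ T₁‖ ≤ (1 + S * (2 / (κ * τ₀))) * Z ∧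
      |cross (y₂ T₂ - y₂ T₁) (y₁ T₁)| ≤
        (η + S * (1 + S * (2 / (κ * τ₀))) * Z) * (2 / (κ * τ₀) * Z) := by
  have hT₁ : 0 < T₁ := hτ₀.trans_le h₁.le_time
  set k := 2 / (κ * τ₀) with hk
  have hk0 : 0 < k := by positivity
  have hZ0 : 0 ≤ Z := (norm_nonneg _).trans hZ
  have hΔT : T₂ - T₁ ≤ k * Z := by
    -- At time `T₁` the first arc is on the circle, so the second is at height at most `Z` above it;
    -- concavity makes this height at least proportional to the time left.
    have h5 := h₂.concave T₁ ⟨hT₁.le, hTT⟩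
    have h6 : ‖y₂ T₁‖ - R ≤ Z := by
      rw [← h₁.finish]; exact (norm_sub_norm_le _ _).trans hZ
    have h7 : κ / 2 * τ₀ * (T₂ - T₁) ≤ κ / 2 * T₁ * (T₂ - T₁) := by
      have := h₁.le_time
      have h8 : 0 ≤ T₂ - T₁ := by linarith
      gcongr
    rw [hk, div_mul_eq_mul_div, le_div_iff₀ (by positivity)]
    linarith
  have hsub2 : Icc T₁ T₂ ⊆ Icc 0 T₂ := Icc_subset_Icc_left hT₁.le
  have hy2d : ∀ t ∈ Icc T₁ T₂, HasDerivWithinAt y₂ (v₂ t) (Icc T₁ T₂) t := fun t ht =>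
    (h₂.arc t (hsub2 ht)).1.mono hsub2
  have hy2b : ∀ t ∈ Icc T₁ T₂, ‖y₂ t - y₁ T₁‖ ≤ (1 + S * k) * Z := by
    intro t ht
    have h5 := norm_sub_le_mul_of_hasDerivWithinAt ht.1
      (fun s hs => (hy2d s (Icc_subset_Icc_right ht.2 hs)).mono (Icc_subset_Icc_right ht.2))
      fun s hs => h₂.speed s (hsub2 (Icc_subset_Icc_right ht.2 hs))
    have h6 : S * (t - T₁) ≤ S * (k * Z) := mul_le_mul_of_nonneg_left (by linarith [ht.2]) hS.le
    have h7 := norm_sub_le_norm_sub_add_norm_sub (y₂ t) (y₂ T₁) (y₁ T₁)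
    linarith
  refine ⟨hΔT, hy2b T₂ (right_mem_Icc.2 hTT), ?_⟩
  have hcrossd : ∀ t ∈ Icc T₁ T₂, HasDerivWithinAt (fun t => cross (y₂ t) (y₁ T₁))
      (cross (v₂ t) (y₁ T₁)) (Icc T₁ T₂) t := by
    intro t ht
    have := HasDerivWithinAt.cross (hy2d t ht) (hasDerivWithinAt_const t (Icc T₁ T₂) (y₁ T₁))
    refine this.congr_deriv ?_
    simp [cross]
  have hcrossb : ∀ t ∈ Icc T₁ T₂, ‖cross (v₂ t) (y₁ T₁)‖ ≤ η + S * (1 + S * k) * Z := by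
    intro t ht
    -- The last piece of the second arc is almost radial: the first term is its angular momentum, at
    -- most `η`, and the second is of order `Z`. Hence this piece changes the angle only by a
    -- product of two small quantities.
    have e : cross (v₂ t) (y₁ T₁) = -cross (y₂ t) (v₂ t) - cross (v₂ t) (y₂ t - y₁ T₁) := by
      simp only [cross, PiLp.sub_apply]; ring
    have hv := h₂.speed t (hsub2 ht)
    have b2 : |cross (v₂ t) (y₂ t - y₁ T₁)| ≤ S * ((1 + S * k) * Z) :=
      (abs_cross_le _ _).trans (mul_le_mul hv (hy2b t ht) (norm_nonneg _) hS.le)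
    rw [Real.norm_eq_abs, e]
    refine (abs_sub _ _).trans ?_
    rw [abs_neg]
    refine (add_le_add (h₂.momentum t (hsub2 ht)) b2).trans (le_of_eq (by ring))
  have := norm_sub_le_mul_of_hasDerivWithinAt hTT hcrossd hcrossb
  rw [Real.norm_eq_abs, ← cross_sub_left] at this
  refine this.trans (mul_le_mul_of_nonneg_left hΔT ?_)
  exact (norm_nonneg _).trans (hcrossb T₁ (left_mem_Icc.2 hTT))

end Compare

/-- The third estimate recovers the tangential part of the initial velocity from the end points. Its
error carries the factor `η`, so that it can later be absorbed in the left side. -/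
lemma exists_compare_ordered {R R₂ S κ τ₀ Tmax : ℝ} (hR : 0 < R) (hR₂ : 0 < R₂) (hS : 0 < S)
    (hκ : 0 < κ) (hτ₀ : 0 < τ₀) (hTmax : 0 < Tmax) (L : NNReal) :
    ∃ C : ℝ, 0 < C ∧ ∀ (F : Plane → Plane) (Ψ : Plane → ℝ) (B η T₁ T₂ : ℝ)
      (y₁ v₁ y₂ v₂ : ℝ → Plane), IsNearlyCentral F Ψ L B η → η ≤ 1 →
      IsReturnArc F R R₂ S κ τ₀ Tmax η T₁ y₁ v₁ → IsReturnArc F R R₂ S κ τ₀ Tmax η T₂ y₂ v₂ →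
      T₁ ≤ T₂ → ‖y₂ 0 - y₁ 0‖ + ‖v₂ 0 - v₁ 0‖ ≤ η →
      T₂ - T₁ ≤ C * (‖y₂ 0 - y₁ 0‖ + ‖v₂ 0 - v₁ 0‖) ∧
      ‖y₂ T₂ - y₁ T₁‖ ≤ C * (‖y₂ 0 - y₁ 0‖ + ‖v₂ 0 - v₁ 0‖) ∧
      |cross (v₂ 0 - v₁ 0) (y₁ 0)| ≤ C * (‖y₂ T₂ - y₁ T₁‖ + ‖y₂ 0 - y₁ 0‖
        + η * (‖y₂ 0 - y₁ 0‖ + ‖v₂ 0 - v₁ 0‖)) := by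
  have hL0 : (0 : ℝ) ≤ L := L.2
  obtain ⟨G, hG⟩ : ∃ G, G = gronwallConst L Tmax := ⟨_, rfl⟩
  have hG0 : 0 < G := hG ▸ gronwallConst_pos L Tmax
  obtain ⟨k, hk⟩ : ∃ k, k = 2 / (κ * τ₀) := ⟨_, rfl⟩
  have hk0 : 0 < k := hk ▸ by positivity
  obtain ⟨x, hx⟩ : ∃ x, x = Tmax * ((R₂ + 1 + L * R₂ * G) * G) := ⟨_, rfl⟩
  have hx0 : 0 < x := hx ▸ by positivity
  obtain ⟨c2, hc2⟩ : ∃ c2, c2 = x / R ^ 2 + 2 * (G * R₂) / R ^ 4 := ⟨_, rfl⟩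
  have hc20 : 0 < c2 := hc2 ▸ by positivity
  obtain ⟨c4, hc4⟩ : ∃ c4, c4 = (1 + S * (1 + S * k) * G) * (k * G) := ⟨_, rfl⟩
  have hc40 : 0 < c4 := hc4 ▸ by positivity
  obtain ⟨c6, hc6⟩ : ∃ c6, c6 = R₂ ^ 2 / τ₀ * (1 / R + (c4 / R ^ 2 + Tmax * c2)) := ⟨_, rfl⟩
  have hc60 : 0 < c6 := hc6 ▸ by positivity
  refine ⟨k * G + (1 + S * k) * G + c6 + S, by positivity, ?_⟩
  intro F Ψ B η T₁ T₂ y₁ v₁ y₂ v₂ hF hη1 h₁ h₂ hTT hD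
  obtain ⟨D, hDdef⟩ : ∃ D, D = ‖y₂ 0 - y₁ 0‖ + ‖v₂ 0 - v₁ 0‖ := ⟨_, rfl⟩
  rw [← hDdef] at hD ⊢
  have hD0 : 0 ≤ D := hDdef ▸ by positivity
  have hη0 : 0 ≤ η := hD0.trans hD
  have hT₁ : 0 < T₁ := hτ₀.trans_le h₁.le_time
  have h0m : (0 : ℝ) ∈ Icc 0 T₁ := left_mem_Icc.2 hT₁.le
  have hT₁m : T₁ ∈ Icc 0 T₁ := right_mem_Icc.2 hT₁.le
  have harc₂ := h₂.arc.mono hTT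
  have hZ : ∀ t ∈ Icc 0 T₁, ‖y₂ t - y₁ t‖ ≤ G * D := fun t ht =>
    hG ▸ (IsArc.gronwall_le hF.lipschitz h₁.arc harc₂ h₁.time_le hDdef.ge ht).1
  -- Every quadratic error is traded here for a linear one with the small factor `η`.
  have hDη : D * D ≤ η * D := mul_le_mul_of_nonneg_right hD hD0
  obtain ⟨q₀, hq₀⟩ : ∃ q₀, q₀ = cross (v₂ 0 - v₁ 0) (y₁ 0) - cross (y₂ 0 - y₁ 0) (v₁ 0) := ⟨_, rfl⟩
  have hX : ∀ t ∈ Icc 0 T₁, |(cross (v₂ t - v₁ t) (y₁ t) - cross (y₂ t - y₁ t) (v₁ t)) - q₀|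
      ≤ x * (η * D) := fun t ht => by
    rw [hq₀]
    refine (abs_wronskian_sub_le hF hη0 h₁ harc₂ hR₂.le hZ ht).trans ?_
    rw [hx, mul_assoc Tmax]
    refine mul_le_mul_of_nonneg_left ?_ hTmax.le
    have : L * R₂ * G * G * (D * D) ≤ L * R₂ * G * G * (η * D) :=
      mul_le_mul_of_nonneg_left hDη (by positivity)
    linarith
  have hmain := abs_angular_variation_ge hR hη0 hT₁ h₁ harc₂ hR₂ hZ hX
  obtain ⟨hT, hP, hC⟩ := h₁.after_return hS hκ hτ₀ h₂ hTT (hZ T₁ hT₁m)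
  rw [← hk] at hT hP hC
  set p := ‖y₂ T₂ - y₁ T₁‖ with hp
  set a := ‖y₂ 0 - y₁ 0‖ with ha
  have hp0 : 0 ≤ p := norm_nonneg _
  have ha0 : 0 ≤ a := norm_nonneg _
  have hηD : 0 ≤ η * D := by positivity
  have hC' : |cross (y₂ T₂ - y₂ T₁) (y₁ T₁)| ≤ c4 * (η * D) := by
    refine hC.trans ?_
    rw [hc4]
    have : S * (1 + S * k) * G * (k * G) * (D * D) ≤ S * (1 + S * k) * G * (k * G) * (η * D) :=
      mul_le_mul_of_nonneg_left hDη (by positivity)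
    linarith
  have hz1 : |cross (y₂ T₁ - y₁ T₁) (y₁ T₁)| ≤ R * p + c4 * (η * D) := by
    have e2 : cross (y₂ T₁ - y₁ T₁) (y₁ T₁) = cross (y₂ T₂ - y₁ T₁) (y₁ T₁)
        - cross (y₂ T₂ - y₂ T₁) (y₁ T₁) := by
      simp only [cross_sub_left]; ring
    rw [e2]
    refine (abs_sub _ _).trans (add_le_add ((abs_cross_le _ _).trans (le_of_eq ?_)) hC')
    rw [h₁.finish]; ring
  have hz0 : |cross (y₂ 0 - y₁ 0) (y₁ 0)| ≤ R * a := by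
    refine (abs_cross_le _ _).trans (le_of_eq ?_)
    rw [h₁.start]; ring
  have e1 : x * (η * D) / R ^ 2 + 2 * (G * D * R₂) * η / R ^ 4 = c2 * (η * D) := by
    rw [hc2]; ring
  rw [e1] at hmain
  have hq : |q₀| ≤ c6 * (p + a + η * D) := by
    have k1 : τ₀ * |q₀| / R₂ ^ 2 ≤ T₁ * |q₀| / R₂ ^ 2 := by
      have := h₁.le_time
      gcongr
    have k2 : T₁ * (c2 * (η * D)) ≤ Tmax * (c2 * (η * D)) :=
      mul_le_mul_of_nonneg_right h₁.time_le (by positivity)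
    have k3 : |cross (y₂ T₁ - y₁ T₁) (y₁ T₁)| / R ^ 2 ≤ (R * p + c4 * (η * D)) / R ^ 2 := by gcongr
    have k4 : |cross (y₂ 0 - y₁ 0) (y₁ 0)| / R ^ 2 ≤ R * a / R ^ 2 := by gcongr
    have k5 : T₁ * (|q₀| / R₂ ^ 2 - c2 * (η * D))
        = T₁ * |q₀| / R₂ ^ 2 - T₁ * (c2 * (η * D)) := by ring
    have k6 : (R * p + c4 * (η * D)) / R ^ 2 + R * a / R ^ 2
        = 1 / R * p + c4 / R ^ 2 * (η * D) + 1 / R * a := by field_simp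
    have k7 : τ₀ * |q₀| / R₂ ^ 2 ≤ (1 / R + (c4 / R ^ 2 + Tmax * c2)) * (p + a + η * D) := by
      have j1 : 0 ≤ (c4 / R ^ 2 + Tmax * c2) * (p + a) := by positivity
      have j2 : 0 ≤ 1 / R * (η * D) := by positivity
      linarith
    have k8 : |q₀| = R₂ ^ 2 / τ₀ * (τ₀ * |q₀| / R₂ ^ 2) := by field_simp
    rw [k8, hc6, mul_assoc]
    exact mul_le_mul_of_nonneg_left k7 (by positivity)
  have hcb : |cross (v₂ 0 - v₁ 0) (y₁ 0)| ≤ |q₀| + S * a := by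
    have e : cross (v₂ 0 - v₁ 0) (y₁ 0) = q₀ + cross (y₂ 0 - y₁ 0) (v₁ 0) := by rw [hq₀]; ring
    rw [e]
    refine (abs_add_le _ _).trans (add_le_add_right ((abs_cross_le _ _).trans ?_) _)
    rw [mul_comm]
    exact mul_le_mul_of_nonneg_right (h₁.speed 0 h0m) ha0
  have d1 : 0 ≤ k * G * D := by positivity
  have d2 : 0 ≤ (1 + S * k) * G * D := by positivity
  have d3 : 0 ≤ (c6 + S) * D := by positivity
  refine ⟨by linarith, by linarith, hcb.trans ?_⟩
  have d4 : 0 ≤ (k * G + (1 + S * k) * G) * (p + a + η * D) := by positivity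
  have d5 : 0 ≤ S * (p + η * D) := by positivity
  linarith

/-- The component of `b` along `v₁ + v₂` is given by the difference of the squared speeds, its
component across `p` by `cross b p`. The two directions are transverse because `v₁ + v₂` has a
definite inner product with `p`. -/
lemma norm_le_of_cross {b v₁ v₂ p : Plane} {R S c₀ X : ℝ} (hR : 0 < R) (hc₀ : 0 < c₀)
    (hp : ‖p‖ = R) (h1 : ‖v₁‖ ≤ S) (h2 : ‖v₂‖ ≤ S) (hb : b = v₂ - v₁)
    (hm : c₀ ≤ ⟪v₁ + v₂, p⟫) (hX : |‖v₂‖ ^ 2 - ‖v₁‖ ^ 2| ≤ X) :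
    ‖b‖ ≤ R / c₀ * X + (2 * S / c₀ + 1 / R) * |cross b p| := by
  set w := v₁ + v₂ with hw
  have hwS : ‖w‖ ≤ 2 * S := (norm_add_le _ _).trans (by linarith)
  have e1 : ⟪b, w⟫ = ‖v₂‖ ^ 2 - ‖v₁‖ ^ 2 := by
    rw [hb, hw, inner_sub_left, inner_add_right, inner_add_right, real_inner_self_eq_norm_sq,
      real_inner_self_eq_norm_sq, real_inner_comm]
    ring
  have e2 : ⟪b, p⟫ * ⟪w, p⟫ = ⟪b, w⟫ * R ^ 2 - cross b p * cross w p := by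
    rw [← hp, norm_sq_eq]
    simp only [inner_eq, cross]; ring
  have e3 : |⟪b, p⟫| * c₀ ≤ X * R ^ 2 + |cross b p| * (2 * S * R) := by
    have h3 : |⟪b, p⟫| * c₀ ≤ |⟪b, p⟫ * ⟪w, p⟫| := by
      rw [abs_mul]
      exact mul_le_mul_of_nonneg_left (hm.trans (le_abs_self _)) (abs_nonneg _)
    refine h3.trans ?_
    rw [e2, e1]
    refine (abs_sub _ _).trans (add_le_add ?_ ?_)
    · rw [abs_mul, abs_of_nonneg (sq_nonneg R)]
      exact mul_le_mul_of_nonneg_right hX (sq_nonneg R)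
    · rw [abs_mul]
      refine mul_le_mul_of_nonneg_left ((abs_cross_le _ _).trans ?_) (abs_nonneg _)
      rw [hp]
      exact mul_le_mul_of_nonneg_right hwS hR.le
  have e4 := norm_mul_norm_le b p
  rw [hp] at e4
  have e5 : |⟪b, p⟫| ≤ (X * R ^ 2 + |cross b p| * (2 * S * R)) / c₀ := by
    rwa [le_div_iff₀ hc₀]
  have e6 : ‖b‖ ≤ ((X * R ^ 2 + |cross b p| * (2 * S * R)) / c₀ + |cross b p|) / R := by
    rw [le_div_iff₀ hR]; linarith
  refine e6.trans (le_of_eq ?_)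
  field_simp
  ring

/-- Lipschitz dependence of a return arc on its end points. -/
lemma exists_compare {R R₂ S κ τ₀ Tmax c₀ : ℝ} (hR : 0 < R) (hR₂ : 0 < R₂) (hS : 0 < S)
    (hκ : 0 < κ) (hτ₀ : 0 < τ₀) (hTmax : 0 < Tmax) (hc₀ : 0 < c₀) (L : NNReal) :
    ∃ η₀ : ℝ, 0 < η₀ ∧ ∃ C : ℝ, 0 < C ∧ ∀ (F : Plane → Plane) (Ψ : Plane → ℝ) (B η T₁ T₂ X : ℝ)
      (y₁ v₁ y₂ v₂ : ℝ → Plane), IsNearlyCentral F Ψ L B η → η ≤ η₀ →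
      IsReturnArc F R R₂ S κ τ₀ Tmax η T₁ y₁ v₁ → IsReturnArc F R R₂ S κ τ₀ Tmax η T₂ y₂ v₂ →
      c₀ ≤ ⟪v₁ 0, y₁ 0⟫ → c₀ ≤ ⟪v₂ 0, y₂ 0⟫ → |‖v₂ 0‖ ^ 2 - ‖v₁ 0‖ ^ 2| ≤ X →
      ‖y₂ 0 - y₁ 0‖ + ‖v₂ 0 - v₁ 0‖ ≤ η →
      |T₂ - T₁| ≤ C * (‖y₂ 0 - y₁ 0‖ + ‖v₂ 0 - v₁ 0‖) ∧
      ‖y₂ T₂ - y₁ T₁‖ ≤ C * (‖y₂ 0 - y₁ 0‖ + ‖v₂ 0 - v₁ 0‖) ∧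
      ‖v₂ 0 - v₁ 0‖ ≤ C * (‖y₂ T₂ - y₁ T₁‖ + ‖y₂ 0 - y₁ 0‖ + X) := by
  obtain ⟨C₁, hC₁, H⟩ := exists_compare_ordered hR hR₂ hS hκ hτ₀ hTmax L
  obtain ⟨k₁, hk₁⟩ : ∃ k, k = R / c₀ := ⟨_, rfl⟩
  obtain ⟨k₂, hk₂⟩ : ∃ k, k = 2 * S / c₀ + 1 / R := ⟨_, rfl⟩
  have hk₁0 : 0 < k₁ := hk₁ ▸ by positivity
  have hk₂0 : 0 < k₂ := hk₂ ▸ by positivity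
  -- The bound `c₀ / S` keeps `⟪v₁ 0 + v₂ 0, y₁ 0⟫ ≥ c₀` when `y₂ 0` is replaced by `y₁ 0`; the
  -- bound `1 / (2 * (k₂ * C₁))` allows half of `‖b‖` to be absorbed on the left.
  refine ⟨min 1 (min (c₀ / S) (1 / (2 * (k₂ * C₁)))), by positivity,
    C₁ + (2 * k₁ + 4 * (k₂ * C₁)), by positivity, ?_⟩
  intro F Ψ B η T₁ T₂ X y₁ v₁ y₂ v₂ hF hη h₁ h₂ hi₁ hi₂ hX hD
  -- the case of ordered return times
  have key : ∀ {T₁ T₂ : ℝ} {y₁ v₁ y₂ v₂ : ℝ → Plane},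
      IsReturnArc F R R₂ S κ τ₀ Tmax η T₁ y₁ v₁ → IsReturnArc F R R₂ S κ τ₀ Tmax η T₂ y₂ v₂ →
      c₀ ≤ ⟪v₁ 0, y₁ 0⟫ → c₀ ≤ ⟪v₂ 0, y₂ 0⟫ → |‖v₂ 0‖ ^ 2 - ‖v₁ 0‖ ^ 2| ≤ X →
      ‖y₂ 0 - y₁ 0‖ + ‖v₂ 0 - v₁ 0‖ ≤ η → T₁ ≤ T₂ →
      |T₂ - T₁| ≤ (C₁ + (2 * k₁ + 4 * (k₂ * C₁))) * (‖y₂ 0 - y₁ 0‖ + ‖v₂ 0 - v₁ 0‖) ∧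
      ‖y₂ T₂ - y₁ T₁‖ ≤ (C₁ + (2 * k₁ + 4 * (k₂ * C₁))) * (‖y₂ 0 - y₁ 0‖ + ‖v₂ 0 - v₁ 0‖) ∧
      ‖v₂ 0 - v₁ 0‖ ≤ (C₁ + (2 * k₁ + 4 * (k₂ * C₁))) *
        (‖y₂ T₂ - y₁ T₁‖ + ‖y₂ 0 - y₁ 0‖ + X) := by
    intro T₁ T₂ y₁ v₁ y₂ v₂ h₁ h₂ hi₁ hi₂ hX hD hTT
    obtain ⟨g1, g2, g3⟩ := H F Ψ B η T₁ T₂ y₁ v₁ y₂ v₂ hF (hη.trans (min_le_left _ _)) h₁ h₂ hTT hD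
    have hm0 : (0 : ℝ) ∈ Icc 0 T₁ := left_mem_Icc.2 (hτ₀.le.trans h₁.le_time)
    have hm0' : (0 : ℝ) ∈ Icc 0 T₂ := left_mem_Icc.2 (hτ₀.le.trans h₂.le_time)
    set b := v₂ 0 - v₁ 0 with hb
    have hηS : S * η ≤ c₀ := by
      have := hη.trans ((min_le_right _ _).trans (min_le_left _ _))
      rw [le_div_iff₀ hS] at this; linarith
    have hηC : k₂ * C₁ * η ≤ 1 / 2 := by
      have := hη.trans ((min_le_right _ _).trans (min_le_right _ _))
      rw [le_div_iff₀ (by positivity)] at this; linarith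
    have hm : c₀ ≤ ⟪v₁ 0 + v₂ 0, y₁ 0⟫ := by
      have e : ⟪v₁ 0 + v₂ 0, y₁ 0⟫ = ⟪v₁ 0, y₁ 0⟫ + ⟪v₂ 0, y₂ 0⟫ - ⟪v₂ 0, y₂ 0 - y₁ 0⟫ := by
        rw [inner_add_left, inner_sub_right]; ring
      have h3 : ⟪v₂ 0, y₂ 0 - y₁ 0⟫ ≤ S * η := by
        refine (real_inner_le_norm _ _).trans (mul_le_mul (h₂.speed 0 hm0') ?_ (norm_nonneg _) hS.le)
        linarith [norm_nonneg b]
      rw [e]; linarith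
    have hnb := norm_le_of_cross hR hc₀ h₁.start (h₁.speed 0 hm0) (h₂.speed 0 hm0') hb hm hX
    rw [← hk₁, ← hk₂] at hnb
    set p := ‖y₂ T₂ - y₁ T₁‖
    set a := ‖y₂ 0 - y₁ 0‖
    have hp0 : 0 ≤ p := norm_nonneg _
    have ha0 : 0 ≤ a := norm_nonneg _
    have hb0 : 0 ≤ ‖b‖ := norm_nonneg _
    have hX0 : 0 ≤ X := (abs_nonneg _).trans hX
    have d1 : 0 ≤ (2 * k₁ + 4 * (k₂ * C₁)) * (a + ‖b‖) := by positivity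
    refine ⟨?_, by linarith, ?_⟩
    · rw [abs_of_nonneg (sub_nonneg.2 hTT)]; linarith
    have g4 : k₂ * |cross b (y₁ 0)| ≤ k₂ * (C₁ * (p + a + η * (a + ‖b‖))) :=
      mul_le_mul_of_nonneg_left g3 hk₂0.le
    have g5 : k₂ * C₁ * η * (a + ‖b‖) ≤ 1 / 2 * (a + ‖b‖) :=
      mul_le_mul_of_nonneg_right hηC (by positivity)
    have g6 : k₂ * C₁ * η * a ≤ k₂ * C₁ * 1 * a := by
      have := hη.trans (min_le_left _ _)
      gcongr
    have g7 : k₂ * C₁ * η * ‖b‖ ≤ 1 / 2 * ‖b‖ := mul_le_mul_of_nonneg_right hηC hb0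
    have g8 : ‖b‖ ≤ 2 * (k₁ * X) + 4 * (k₂ * C₁) * (p + a) := by
      have : 0 ≤ k₂ * C₁ * p := by positivity
      linarith
    have d2 : 0 ≤ C₁ * (p + a + X) := by positivity
    have d3 : 0 ≤ k₁ * (p + a) := by positivity
    have d4 : 0 ≤ k₂ * C₁ * X := by positivity
    linarith
  rcases le_total T₁ T₂ with h | h
  · exact key h₁ h₂ hi₁ hi₂ hX hD h
  · have := key h₂ h₁ hi₂ hi₁ (by rw [abs_sub_comm]; exact hX)
      (by rw [norm_sub_rev (y₁ 0), norm_sub_rev (v₁ 0)]; exact hD) h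
    rwa [abs_sub_comm, norm_sub_rev (y₁ 0), norm_sub_rev (v₁ 0), norm_sub_rev (y₁ T₁)] at this

/-! ### Truncation of the force away from the centres -/

/-- The last clause is a second difference bound, from the Lipschitz continuity of the derivative of
`ψ u • u`. It makes the effect of displacing a centre by `c` small in the Lipschitz norm, not only
uniformly. -/
lemma exists_truncated_attraction (α : ℝ) {R₁ R₃ : ℝ} (hR₁ : 0 < R₁) :
    ∃ (ψ : Plane → ℝ) (L : NNReal) (K B : ℝ), 0 ≤ K ∧ 0 ≤ B ∧ LipschitzWith L ψ ∧
      LipschitzWith L (fun u => ψ u • u) ∧ (∀ u, ‖ψ u • u‖ ≤ B) ∧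
      (∀ u, R₁ ≤ ‖u‖ → ‖u‖ ≤ R₃ → ψ u = ‖u‖ ^ (-(α + 2))) ∧
      ∀ c x x' : Plane, ‖(ψ (x' - c) • (x' - c) - ψ x' • x') - (ψ (x - c) • (x - c) - ψ x • x)‖
        ≤ K * ‖c‖ * ‖x' - x‖ := by
  set A : Set Plane := closedBall 0 R₃ ∩ {u | R₁ ≤ ‖u‖}
  have hA : IsCompact A := (isCompact_closedBall _ _).inter_right (isClosed_le continuous_const
    continuous_norm)
  have hAΩ : A ⊆ ({0}ᶜ : Set Plane) := fun u hu h0 => by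
    have h1 : R₁ ≤ ‖u‖ := hu.2
    rw [mem_singleton_iff.1 h0, norm_zero] at h1
    linarith
  obtain ⟨χ, hχ, hc, hs, h1⟩ := exists_contDiff_cutoff hA isOpen_compl_singleton hAΩ
  have hψ : ContDiff ℝ 2 (fun u : Plane => χ u • ‖u‖ ^ (-(α + 2))) :=
    contDiff_smul_of_tsupport_subset hχ hs fun u hu =>
      (contDiffAt_norm ℝ hu).rpow_const_of_ne (norm_ne_zero_iff.2 hu)
  have hψc : HasCompactSupport (fun u : Plane => χ u • ‖u‖ ^ (-(α + 2))) := hc.smul_right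
  set ψ : Plane → ℝ := fun u => χ u • ‖u‖ ^ (-(α + 2)) with hψdef
  have hg : ContDiff ℝ 2 (fun u => ψ u • u) := hψ.smul contDiff_id
  have hgc : HasCompactSupport (fun u => ψ u • u) := hψc.smul_right
  obtain ⟨L₁, hL₁⟩ := hψ.lipschitzWith_of_hasCompactSupport hψc (by norm_num)
  obtain ⟨L₂, hL₂⟩ := hg.lipschitzWith_of_hasCompactSupport hgc (by norm_num)
  obtain ⟨B, hB⟩ := hgc.exists_bound_of_continuous hg.continuous
  have hg' : ContDiff ℝ 1 (fderiv ℝ (fun u => ψ u • u)) := hg.fderiv_right (by norm_num)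
  obtain ⟨K, hK⟩ := hg'.lipschitzWith_of_hasCompactSupport (hgc.fderiv ℝ) (by norm_num)
  refine ⟨ψ, max L₁ L₂, K, B, K.2, (norm_nonneg _).trans (hB 0), hL₁.weaken (le_max_left _ _),
    hL₂.weaken (le_max_right _ _), hB, fun u hu1 hu3 => ?_, fun c x x' => ?_⟩
  · have : u ∈ A := ⟨by simpa using hu3, hu1⟩
    simp only [hψdef, h1 u this, one_smul]
  · have hd : ∀ x, HasFDerivAt (fun u => ψ u • u) (fderiv ℝ (fun u => ψ u • u) x) x := fun x =>
      (hg.differentiable (by norm_num) x).hasFDerivAt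
    have hdiff : ∀ x, HasFDerivAt (fun x => ψ (x - c) • (x - c) - ψ x • x)
        (fderiv ℝ (fun u => ψ u • u) (x - c) - fderiv ℝ (fun u => ψ u • u) x) x := fun x => by
      have h2 := (hd (x - c)).comp x ((hasFDerivAt_id x).sub_const c)
      exact h2.sub (hd x)
    refine convex_univ.norm_image_sub_le_of_norm_hasFDerivWithin_le
      (fun x _ => (hdiff x).hasFDerivWithinAt) (fun x _ => ?_) (mem_univ x) (mem_univ x')
    have := hK.norm_sub_le (x - c) x
    rwa [sub_sub_cancel_left, norm_neg] at this

/-- The central model has all the mass at the origin. The constants `L`, `B`, `Λ` are independent of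
the centres, which enter only through the error `Λ * ε`. -/
lemma exists_truncated_force {N : ℕ} (α : ℝ) (m : Fin N → ℝ) (hm : ∀ k, 0 < m k) {R R₂ : ℝ}
    (hR : 0 < R) : ∃ (Ψ : Plane → ℝ) (L : NNReal) (B Λ : ℝ), 0 < B ∧ 0 < Λ ∧
      (∀ x, R ≤ ‖x‖ → ‖x‖ ≤ R₂ → Ψ x = (∑ k, m k) * ‖x‖ ^ (-(α + 2))) ∧
      ∀ ε : ℝ, 0 ≤ ε → ε ≤ R / 2 → ∀ c : Fin N → Plane, (∀ k, ‖c k‖ ≤ ε) →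
        ∃ F : Plane → Plane, IsNearlyCentral F Ψ L B (Λ * ε) ∧
          ∀ x, R ≤ ‖x‖ → ‖x‖ ≤ R₂ → F x = force α m c x := by
  -- The annulus is enlarged so that its translates by centres of norm at most `R / 2` stay where
  -- `ψ` is exact.
  obtain ⟨ψ, L, K, B, hK, hB, hψL, hAL, hAB, hψ, hA2⟩ :=
    exists_truncated_attraction α (R₁ := R / 2) (R₃ := R₂ + R) (half_pos hR)
  set M := ∑ k, m k with hM
  have hM0 : 0 ≤ M := Finset.sum_nonneg fun k _ => (hm k).le
  have hL0 : (0 : ℝ) ≤ L := L.2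
  set M' : NNReal := ⟨M, hM0⟩ with hM'
  refine ⟨fun x => M * ψ x, M' * L, M * B + 1, M * (K + L) + 1, by positivity, by positivity,
    fun x h1 h2 => ?_, fun ε hε0 hε c hc => ?_⟩
  · change M * ψ x = _
    rw [hψ x (by linarith) (by linarith)]
  · set A : Plane → Plane := fun u => ψ u • u with hA
    have hsum : ∀ (f : Fin N → Plane) (b : ℝ), (∀ k, ‖f k‖ ≤ b) → ‖∑ k, m k • f k‖ ≤ M * b := by
      intro f b hf
      refine (norm_sum_le _ _).trans ?_
      rw [hM, Finset.sum_mul]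
      refine Finset.sum_le_sum fun k _ => ?_
      rw [norm_smul, Real.norm_of_nonneg (hm k).le]
      exact mul_le_mul_of_nonneg_left (hf k) (hm k).le
    have hE : ∀ x, -(∑ k, m k • A (x - c k)) + (M * ψ x) • x
        = -∑ k, m k • (A (x - c k) - A x) := fun x => by
      simp only [smul_sub, Finset.sum_sub_distrib, ← Finset.sum_smul]
      rw [neg_sub, ← hM, hA, mul_smul]; abel
    refine ⟨fun x => -∑ k, m k • A (x - c k), ⟨?_, ?_, ?_, ?_, ?_⟩, fun x h1 h2 => ?_⟩
    · refine LipschitzWith.of_dist_le_mul fun x x' => ?_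
      rw [dist_eq_norm, dist_eq_norm, neg_sub_neg, ← Finset.sum_sub_distrib]
      simp only [← smul_sub]
      rw [NNReal.coe_mul, mul_assoc]
      refine hsum _ _ fun k => ?_
      have := hAL.norm_sub_le (x' - c k) (x - c k)
      rwa [sub_sub_sub_cancel_right, norm_sub_rev x' x] at this
    · intro x
      rw [norm_neg]
      exact (hsum _ _ fun k => hAB _).trans (by linarith)
    · refine LipschitzWith.of_dist_le_mul fun x x' => ?_
      rw [dist_eq_norm, dist_eq_norm, ← mul_sub, norm_mul, Real.norm_of_nonneg hM0, NNReal.coe_mul,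
        mul_assoc]
      exact mul_le_mul_of_nonneg_left (hψL.norm_sub_le x x') hM0
    · intro x
      rw [hE, norm_neg]
      have hb : ∀ k, ‖A (x - c k) - A x‖ ≤ L * ε := fun k => by
        have := hAL.norm_sub_le (x - c k) x
        rw [sub_sub_cancel_left, norm_neg] at this
        exact this.trans (mul_le_mul_of_nonneg_left (hc k) hL0)
      refine (hsum _ _ hb).trans ?_
      have : 0 ≤ M * K * ε := by positivity
      linarith
    · intro x x'
      rw [hE, hE, neg_sub_neg, ← Finset.sum_sub_distrib]
      simp only [← smul_sub]
      have hb : ∀ k, ‖(A (x - c k) - A x) - (A (x' - c k) - A x')‖ ≤ K * ε * ‖x' - x‖ := fun k => by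
        have := hA2 (c k) x' x
        rw [norm_sub_rev x x'] at this
        refine this.trans ?_
        have := hc k
        gcongr
      refine (hsum _ _ hb).trans ?_
      have : 0 ≤ (M * L + 1) * ε * ‖x' - x‖ := by positivity
      linarith
    · simp only [force, attraction]
      congr 1
      refine Finset.sum_congr rfl fun k _ => ?_
      have h3 := norm_sub_norm_le x (c k)
      have h4 := norm_sub_le x (c k)
      have h5 := hc k
      rw [hA]
      simp only
      rw [hψ _ (by linarith) (by linarith)]

/-! ### Radial motion -/

section Radial

variable {F : Plane → Plane} {Ψ : Plane → ℝ} {L : NNReal} {B η R R₂ S κ T : ℝ} {y v : ℝ → Plane}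

lemma IsArc.hasDerivWithinAt_norm (h : IsArc F T y v) {t : ℝ} (ht : t ∈ Icc 0 T) (h0 : y t ≠ 0) :
    HasDerivWithinAt (fun t => ‖y t‖) (⟪y t, v t⟫ / ‖y t‖) (Icc 0 T) t := by
  have h1 := (h t ht).1.norm_sq.sqrt (pow_ne_zero 2 (norm_ne_zero_iff.2 h0))
  simp only [Real.sqrt_sq (norm_nonneg _)] at h1
  refine h1.congr_deriv ?_
  rw [mul_div_mul_left _ _ two_ne_zero]

lemma IsArc.hasDerivWithinAt_radial (h : IsArc F T y v) {t : ℝ} (ht : t ∈ Icc 0 T)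
    (h0 : y t ≠ 0) :
    HasDerivWithinAt (fun t => ⟪y t, v t⟫ / ‖y t‖)
      (cross (y t) (v t) ^ 2 / ‖y t‖ ^ 3 + ⟪y t, F (y t)⟫ / ‖y t‖) (Icc 0 T) t := by
  have hn : ‖y t‖ ≠ 0 := norm_ne_zero_iff.2 h0
  refine (((h t ht).1.inner ℝ (h t ht).2).div (h.hasDerivWithinAt_norm ht h0) hn).congr_deriv ?_
  have e := inner_sq_add_cross_sq (y t) (v t)
  rw [real_inner_self_eq_norm_sq]
  field_simp
  linear_combination -e

lemma IsArc.hasDerivWithinAt_cross (h : IsArc F T y v) {t : ℝ} (ht : t ∈ Icc 0 T) :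
    HasDerivWithinAt (fun t => cross (y t) (v t)) (cross (y t) (F (y t) + Ψ (y t) • y t))
      (Icc 0 T) t := by
  refine (HasDerivWithinAt.cross (h t ht).1 (h t ht).2).congr_deriv ?_
  rw [cross_self, cross_add_right, cross_smul_right, cross_self]; ring

/-- Only the noncentral part of the force exerts a torque. -/
lemma IsArc.abs_cross_sub_le (hF : IsNearlyCentral F Ψ L B η) (h : IsArc F T y v)
    (hmem : ∀ t ∈ Icc 0 T, ‖y t‖ ≤ R₂) {t : ℝ} (ht : t ∈ Icc 0 T) :
    |cross (y t) (v t) - cross (y 0) (v 0)| ≤ R₂ * η * t := by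
  have h0 : (0 : ℝ) ∈ Icc 0 T := left_mem_Icc.2 (ht.1.trans ht.2)
  have := (convex_Icc 0 T).norm_image_sub_le_of_norm_hasDerivWithin_le
    (fun t ht => h.hasDerivWithinAt_cross (Ψ := Ψ) ht) (C := R₂ * η) (fun t ht => ?_) h0 ht
  · rwa [Real.norm_eq_abs, sub_zero, Real.norm_of_nonneg ht.1] at this
  · refine (abs_cross_le _ _).trans (mul_le_mul (hmem t ht) (hF.small _) (norm_nonneg _) ?_)
    exact (norm_nonneg _).trans (hmem t ht)

/-- The central pull is at least `2 * κ`; the centrifugal term and the noncentral error use up at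
most `κ` of it. -/
lemma IsNearlyCentral.radial_le {h : ℝ} {x w : Plane} (hF : IsNearlyCentral F Ψ L B η) (hR : 0 < R)
    (hx : R ≤ ‖x‖) (hΨ : 2 * κ ≤ Ψ x * ‖x‖) (hw : |cross x w| ≤ h) (hκ : h ^ 2 / R ^ 3 + η ≤ κ) :
    cross x w ^ 2 / ‖x‖ ^ 3 + ⟪x, F x⟫ / ‖x‖ ≤ -κ := by
  have hx0 : 0 < ‖x‖ := hR.trans_le hx
  have h1 : cross x w ^ 2 / ‖x‖ ^ 3 ≤ h ^ 2 / R ^ 3 := by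
    rw [← sq_abs (cross x w)]
    gcongr
  have h2 : ⟪x, F x⟫ / ‖x‖ = ⟪x, F x + Ψ x • x⟫ / ‖x‖ - Ψ x * ‖x‖ := by
    rw [inner_add_right, inner_smul_right, real_inner_self_eq_norm_sq]
    field_simp; ring
  have h3 : ⟪x, F x + Ψ x • x⟫ / ‖x‖ ≤ η := by
    rw [div_le_iff₀ hx0, mul_comm]
    exact (real_inner_le_norm _ _).trans (mul_le_mul_of_nonneg_left (hF.small x) hx0.le)
  linarith

lemma IsNearlyCentral.le_radial {x w : Plane} (hF : IsNearlyCentral F Ψ L B η) (hx0 : 0 < ‖x‖) :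
    -B ≤ cross x w ^ 2 / ‖x‖ ^ 3 + ⟪x, F x⟫ / ‖x‖ := by
  have h1 : 0 ≤ cross x w ^ 2 / ‖x‖ ^ 3 := by positivity
  have h3 : -B ≤ ⟪x, F x⟫ / ‖x‖ := by
    rw [le_div_iff₀ hx0]
    have h4 := (abs_le.1 (abs_real_inner_le_norm x (F x))).1
    have h5 := mul_le_mul_of_nonneg_left (hF.bounded x) hx0.le
    linarith
  linarith

lemma IsNearlyCentral.mono {η' : ℝ} (hF : IsNearlyCentral F Ψ L B η) (h : η ≤ η') :
    IsNearlyCentral F Ψ L B η' :=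
  ⟨hF.lipschitz, hF.bounded, hF.lipschitz_coeff, fun x => (hF.small x).trans h, fun x x' =>
    (hF.small_lipschitz x x').trans (mul_le_mul_of_nonneg_right h (norm_nonneg _))⟩

/-- While an arc with small angular momentum stays in the annulus, its momentum stays small, and
its distance to the origin is uniformly concave. -/
lemma IsArc.concave_norm {η' Tmax : ℝ} (hR : 0 < R) (hR₂ : 0 < R₂) (hη' : 0 ≤ η')
    (hF : IsNearlyCentral F Ψ L B η') (hΨ : ∀ x, R ≤ ‖x‖ → ‖x‖ ≤ R₂ → 2 * κ ≤ Ψ x * ‖x‖)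
    (hηη : η' ≤ η) (hκ : η ^ 2 / R ^ 3 + η ≤ κ) (hηT : R₂ * η' * Tmax ≤ η / 2)
    (h : IsArc F T y v) (hT : T ≤ Tmax) (hmem : ∀ t ∈ Icc 0 T, R ≤ ‖y t‖ ∧ ‖y t‖ ≤ R₂)
    (hm : |cross (y 0) (v 0)| ≤ η / 2) :
    (∀ t ∈ Icc 0 T, |cross (y t) (v t)| ≤ η) ∧
      ∀ t ∈ Icc 0 T, cross (y t) (v t) ^ 2 / ‖y t‖ ^ 3 + ⟪y t, F (y t)⟫ / ‖y t‖ ≤ -κ := by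
  have h1 : ∀ t ∈ Icc 0 T, |cross (y t) (v t)| ≤ η := fun t ht => by
    have h2 := h.abs_cross_sub_le hF (fun t ht => (hmem t ht).2) ht
    have h3 : R₂ * η' * t ≤ R₂ * η' * Tmax :=
      mul_le_mul_of_nonneg_left (ht.2.trans hT) (by positivity)
    have h4 := abs_sub_abs_le_abs_sub (cross (y t) (v t)) (cross (y 0) (v 0))
    linarith
  exact ⟨h1, fun t ht => hF.radial_le hR (hmem t ht).1 (hΨ _ (hmem t ht).1 (hmem t ht).2)
    (h1 t ht) (by linarith)⟩

/-- The concave bound `R + S * t - κ / 2 * t²` for the distance falls below `R` at `t = 2 * S / κ +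
1`. The arc is cut at that time, since the drift of the angular momentum is controlled only up to
there. -/
lemma IsArc.time_lt {η' : ℝ} (hR : 0 < R) (hR₂ : 0 < R₂) (hS : 0 < S)
    (hκ0 : 0 < κ) (hη' : 0 ≤ η')
    (hF : IsNearlyCentral F Ψ L B η') (hΨ : ∀ x, R ≤ ‖x‖ → ‖x‖ ≤ R₂ → 2 * κ ≤ Ψ x * ‖x‖)
    (hηη : η' ≤ η) (hκ : η ^ 2 / R ^ 3 + η ≤ κ) (hηT : R₂ * η' * (2 * S / κ + 1) ≤ η / 2)
    (h : IsArc F T y v) (hmem : ∀ t ∈ Icc 0 T, R ≤ ‖y t‖ ∧ ‖y t‖ ≤ R₂)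
    (h0 : ‖y 0‖ = R) (hv : ‖v 0‖ ≤ S) (hm : |cross (y 0) (v 0)| ≤ η / 2) : T < 2 * S / κ + 1 := by
  by_contra! hlt
  set T' := 2 * S / κ + 1 with hT'
  have hT'0 : 0 < T' := by positivity
  have hsub : Icc 0 T' ⊆ Icc 0 T := Icc_subset_Icc_right hlt
  have hy0 : ∀ t ∈ Icc 0 T', y t ≠ 0 := fun t ht =>
    norm_pos_iff.1 (hR.trans_le (hmem t (hsub ht)).1)
  have ha := h.mono hlt
  have h2 := ha.concave_norm hR hR₂ hη' hF hΨ hηη hκ hηT le_rfl (fun t ht => hmem t (hsub ht)) hm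
  have h3 := le_taylor_of_second_deriv_le
    (fun t ht => ha.hasDerivWithinAt_norm ht (hy0 t ht))
    (fun t ht => ha.hasDerivWithinAt_radial ht (hy0 t ht)) h2.2
    (left_mem_Icc.2 hT'0.le) (right_mem_Icc.2 hT'0.le)
  have h4 := (hmem T' ⟨hT'0.le, hlt⟩).1
  have h5 : ⟪y 0, v 0⟫ / ‖y 0‖ ≤ S := by
    rw [div_le_iff₀ (by rw [h0]; exact hR), mul_comm]
    exact (real_inner_le_norm _ _).trans (mul_le_mul_of_nonneg_left hv (norm_nonneg _))
  simp only [sub_zero, h0] at h3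
  rw [h0] at h5
  have h6 : ⟪y 0, v 0⟫ / R * T' ≤ S * T' := mul_le_mul_of_nonneg_right h5 hT'0.le
  have h7 : κ * T' = 2 * S + κ := by rw [hT']; field_simp
  have h8 : κ / 2 * T' ^ 2 = (S + κ / 2) * T' := by
    rw [show κ / 2 * T' ^ 2 = (κ * T') * T' / 2 by ring, h7]; ring
  have h9 : 0 < κ / 2 * T' := by positivity
  linarith

lemma IsArc.isReturnArc {η' c₀ : ℝ} (hR : 0 < R) (hR₂ : 0 < R₂) (hB : 0 < B) (hS : 0 < S)
    (hκ0 : 0 < κ) (hη' : 0 ≤ η')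
    (hF : IsNearlyCentral F Ψ L B η') (hΨ : ∀ x, R ≤ ‖x‖ → ‖x‖ ≤ R₂ → 2 * κ ≤ Ψ x * ‖x‖)
    (hηη : η' ≤ η) (hκ : η ^ 2 / R ^ 3 + η ≤ κ) (hηT : R₂ * η' * (2 * S / κ + 1) ≤ η / 2)
    (hT : 0 < T) (h : IsArc F T y v) (hmem : ∀ t ∈ Icc 0 T, R ≤ ‖y t‖ ∧ ‖y t‖ ≤ R₂)
    (h0 : ‖y 0‖ = R) (h1 : ‖y T‖ = R) (hv : ∀ t ∈ Icc 0 T, ‖v t‖ ≤ S)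
    (hm : |cross (y 0) (v 0)| ≤ η / 2) (hc₀ : c₀ ≤ ⟪v 0, y 0⟫) :
    IsReturnArc F R R₂ S κ (2 * c₀ / (R * B)) (2 * S / κ + 1) η T y v := by
  have hy0 : ∀ t ∈ Icc 0 T, y t ≠ 0 := fun t ht =>
    norm_pos_iff.1 (hR.trans_le (hmem t ht).1)
  have h0m : (0 : ℝ) ∈ Icc 0 T := left_mem_Icc.2 hT.le
  have hTle := (h.time_lt hR hR₂ hS hκ0 hη' hF hΨ hηη hκ hηT hmem h0 (hv 0 h0m) hm).le
  obtain ⟨hm1, hc1⟩ := h.concave_norm hR hR₂ hη' hF hΨ hηη hκ hηT hTle hmem hm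
  refine ⟨h, ?_, hTle, hmem, h0, h1, hv, hm1, fun t ht => ?_⟩
  · have h3 := le_taylor_of_second_deriv_le (κ := -B)
      (fun t ht => (h.hasDerivWithinAt_norm ht (hy0 t ht)).neg)
      (fun t ht => (h.hasDerivWithinAt_radial ht (hy0 t ht)).neg)
      (fun t ht => by
        rw [neg_neg]
        linarith [hF.le_radial (w := v t) (norm_pos_iff.2 (hy0 t ht))])
      h0m (right_mem_Icc.2 hT.le)
    simp only [Pi.neg_apply, sub_zero, h0, h1] at h3
    have h4 : ⟪y 0, v 0⟫ / R ≤ B / 2 * T := by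
      refine le_of_mul_le_mul_right ?_ hT
      linarith
    rw [div_le_iff₀ hR, real_inner_comm] at h4
    rw [div_le_iff₀ (by positivity)]
    linarith
  · exact le_sub_of_second_deriv_le hT (fun t ht => h.hasDerivWithinAt_norm ht (hy0 t ht))
      (fun t ht => h.hasDerivWithinAt_radial ht (hy0 t ht)) hc1 h0.ge h1.ge ht

end Radial

section

variable {N : ℕ} {α : ℝ} {m : Fin N → ℝ} {c : Fin N → Plane}

/-! ### The potential near the circle -/

lemma potential_le (hα : 0 < α) (hm : ∀ k, 0 < m k) {ε : ℝ} (hc : ∀ k, ‖c k‖ ≤ ε) {x : Plane}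
    (hx : ε < ‖x‖) : potential α m c x ≤ (∑ k, m k) / (α * (‖x‖ - ε) ^ α) := by
  rw [potential, Finset.sum_div]
  refine Finset.sum_le_sum fun k _ => ?_
  have h1 : ‖x‖ - ε ≤ ‖x - c k‖ := by linarith [norm_sub_norm_le x (c k), hc k]
  have h2 : 0 < ‖x‖ - ε := by linarith
  have := hm k
  gcongr

lemma le_potential (hα : 0 < α) (hm : ∀ k, 0 < m k) {ε : ℝ} (hc : ∀ k, ‖c k‖ ≤ ε) {x : Plane}
    (hx : ε < ‖x‖) : (∑ k, m k) / (α * (‖x‖ + ε) ^ α) ≤ potential α m c x := by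
  rw [potential, Finset.sum_div]
  refine Finset.sum_le_sum fun k _ => ?_
  have h1 : ‖x - c k‖ ≤ ‖x‖ + ε := by linarith [norm_sub_le x (c k), hc k]
  have h2 : 0 < ‖x - c k‖ := by linarith [norm_sub_norm_le x (c k), hc k]
  have := hm k
  gcongr

/-! ### Outer fields -/

/-- Constants of the outer region: radius `R` of the circle, bounds `R₃ < R₂` for the distance
to the origin, `S` for the speed, `s₀` for `V - 1` on the circle from below, `κ` for the
concavity of the distance to the origin, `B` and `L` for the force and its Lipschitz constant. -/
structure OuterBounds where
  (R R₃ R₂ S s₀ κ B : ℝ)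
  L : NNReal
  R_pos : 0 < R
  R_le : R ≤ R₃
  R₃_lt : R₃ < R₂
  S_pos : 0 < S
  s₀_pos : 0 < s₀
  κ_pos : 0 < κ
  B_pos : 0 < B

namespace OuterBounds

variable (b : OuterBounds)

/-- Upper bound for the duration of outer solutions. -/
noncomputable def Tmax : ℝ := 2 * b.S / b.κ + 1

/-- Lower bound for the initial radial speed of outer solutions, times `R`. -/
noncomputable def c₀ : ℝ := b.R * Real.sqrt (2 * b.s₀) * Real.cos 1

/-- Lower bound for the duration of outer solutions. -/
noncomputable def τ₀ : ℝ := 2 * b.c₀ / (b.R * b.B)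

lemma R₂_pos : 0 < b.R₂ := by linarith [b.R_pos, b.R_le, b.R₃_lt]

lemma Tmax_pos : 0 < b.Tmax := by have := b.S_pos; have := b.κ_pos; unfold Tmax; positivity

lemma c₀_pos : 0 < b.c₀ := by
  have := b.R_pos; have := b.s₀_pos; have := Real.cos_one_pos
  unfold c₀; positivity

lemma τ₀_pos : 0 < b.τ₀ := by
  have := b.c₀_pos; have := b.R_pos; have := b.B_pos
  unfold τ₀; positivity

end OuterBounds

/-- Outside the circle of radius `R`, the force of the centres `c` agrees with `F`, which is nearly
central with error `η`, and the bounds `b` hold. -/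
structure IsOuterField (b : OuterBounds) {N : ℕ} (α : ℝ) (m : Fin N → ℝ) (c : Fin N → Plane)
    (F : Plane → Plane) (Ψ : Plane → ℝ) (η : ℝ) : Prop where
  nonneg : 0 ≤ η
  nearly : IsNearlyCentral F Ψ b.L b.B η
  eq_force : ∀ x, b.R ≤ ‖x‖ → ‖x‖ ≤ b.R₂ → F x = force α m c x
  off : ∀ x, b.R ≤ ‖x‖ → x ∈ offCentres c
  hill : ∀ x, b.R ≤ ‖x‖ → 1 ≤ potential α m c x → ‖x‖ ≤ b.R₃
  le_potential : ∀ x, ‖x‖ = b.R → b.s₀ ≤ potential α m c x - 1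
  potential_le : ∀ x, b.R ≤ ‖x‖ → 2 * (potential α m c x - 1) ≤ b.S ^ 2
  coeff : ∀ x, b.R ≤ ‖x‖ → ‖x‖ ≤ b.R₂ → 2 * b.κ ≤ Ψ x * ‖x‖

/-- The error `η'` of the field is small enough to keep the angular momentum below `η`. -/
structure OuterBounds.IsSmall (b : OuterBounds) (η' η : ℝ) : Prop where
  le : η' ≤ η
  concave : η ^ 2 / b.R ^ 3 + η ≤ b.κ
  drift : b.R₂ * η' * b.Tmax ≤ η / 2

lemma exists_isOuterField (hα : 0 < α) (hm : ∀ k, 0 < m k) {R : ℝ} (hR : 0 < R)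
    (hRM : R < ((∑ k, m k) / α) ^ (1 / α)) :
    ∃ (b : OuterBounds) (Ψ : Plane → ℝ), b.R = R ∧ ∀ η : ℝ, 0 < η → ∃ ε₁ : ℝ, 0 < ε₁ ∧
      ∀ ε : ℝ, 0 < ε → ε < ε₁ → ∀ c : Fin N → Plane, (∀ k, ‖c k‖ ≤ ε) →
        ∃ F : Plane → Plane, IsOuterField b α m c F Ψ η := by
  set M := ∑ k, m k with hM
  have hM0 : 0 ≤ M := Finset.sum_nonneg fun k _ => (hm k).le
  have hMpos : 0 < M := by
    refine hM0.lt_of_ne fun h => ?_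
    rw [← h, zero_div, Real.zero_rpow (by positivity)] at hRM
    linarith
  -- `Q` is the radius at which the potential of all the mass at the origin equals `1`.
  set Q : ℝ := (M / α) ^ (1 / α) with hQ
  have hQα : Q ^ α = M / α := by
    rw [hQ, ← Real.rpow_mul (by positivity), one_div_mul_cancel hα.ne', Real.rpow_one]
  obtain ⟨Ψ, L, B, Λ, hB, hΛ, hΨ, H⟩ := exists_truncated_force α m hm (R₂ := Q + R) hR
  have hQ0 : 0 < Q := hR.trans hRM
  set R' := (R + Q) / 2 with hR'
  have hR'0 : 0 < R' := by positivity
  have hs₀ : 0 < M / (α * R' ^ α) - 1 := by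
    have h1 : R' ^ α < Q ^ α := Real.rpow_lt_rpow hR'0.le (by linarith) hα
    have h2 : 0 < R' ^ α := Real.rpow_pos_of_pos hR'0 α
    rw [sub_pos, one_lt_div (by positivity)]
    rw [hQα, lt_div_iff₀ hα] at h1
    linarith
  set V₁ := M / (α * (R / 2) ^ α) with hV₁
  have hV₁0 : 0 ≤ V₁ := by positivity
  -- Centres of norm at most `ε < R / 2` move the boundary `V = 1` by at most `ε`, whence `R₃ = Q +
  -- R / 2`, and `R₂ = Q + R` leaves a margin. The speed bound uses the potential at distance `R /
  -- 2`, the bound `s₀` the one at `R' = (R + Q) / 2`, and `2 * κ` is the value of `Ψ x * ‖x‖` at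
  -- the outer radius.
  refine ⟨⟨R, Q + R / 2, Q + R, Real.sqrt (2 * V₁) + 1, M / (α * R' ^ α) - 1,
    M * (Q + R) ^ (-(α + 1)) / 2, B, L, hR, by linarith, by linarith, by positivity, hs₀,
    by positivity, hB⟩, Ψ, rfl, fun η hη => ?_⟩
  refine ⟨min (min (R / 2) ((Q - R) / 2)) (η / Λ), lt_min (lt_min (by linarith) (by linarith))
    (by positivity), fun ε hε hεlt c hc => ?_⟩
  rw [lt_min_iff, lt_min_iff] at hεlt
  obtain ⟨⟨he1, he2⟩, he3⟩ := hεlt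
  obtain ⟨F, hF, hFe⟩ := H ε hε.le he1.le c hc
  rw [lt_div_iff₀ hΛ, mul_comm] at he3
  refine ⟨F, hη.le, hF.mono he3.le, hFe, fun x hx k hk => ?_, fun x hx hV => ?_, fun x hx => ?_,
    fun x hx => ?_, fun x hx1 hx2 => ?_⟩
  · change R ≤ ‖x‖ at hx
    rw [hk] at hx
    linarith [hc k]
  · change R ≤ ‖x‖ at hx
    change ‖x‖ ≤ Q + R / 2
    have h0 : 0 < ‖x‖ - ε := by linarith
    have h1 := hV.trans (potential_le hα hm hc (by linarith))
    have h2 : 0 < (‖x‖ - ε) ^ α := Real.rpow_pos_of_pos h0 α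
    rw [one_le_div (by positivity)] at h1
    have h3 : (‖x‖ - ε) ^ α ≤ Q ^ α := by
      rw [hQα, le_div_iff₀ hα]; linarith
    have h4 := (Real.rpow_le_rpow_iff h0.le hQ0.le hα).1 h3
    linarith
  · change ‖x‖ = R at hx
    change M / (α * R' ^ α) - 1 ≤ _
    have h1 := le_potential hα hm hc (x := x) (by linarith)
    refine sub_le_sub_right (le_trans ?_ h1) 1
    have h2 : ‖x‖ + ε ≤ R' := by rw [hx, hR']; linarith
    have h3 : 0 < ‖x‖ + ε := by linarith
    gcongr
  · change R ≤ ‖x‖ at hx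
    change _ ≤ (Real.sqrt (2 * V₁) + 1) ^ 2
    have h1 := potential_le hα hm hc (x := x) (by linarith)
    have h2 : M / (α * (‖x‖ - ε) ^ α) ≤ V₁ := by
      have h3 : R / 2 ≤ ‖x‖ - ε := by linarith
      rw [hV₁]; gcongr
    have h4 := Real.sq_sqrt (by positivity : 0 ≤ 2 * V₁)
    have h5 := Real.sqrt_nonneg (2 * V₁)
    nlinarith
  · change R ≤ ‖x‖ at hx1
    change ‖x‖ ≤ Q + R at hx2
    change 2 * (M * (Q + R) ^ (-(α + 1)) / 2) ≤ _
    have hx0 : 0 < ‖x‖ := hR.trans_le hx1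
    have e : ‖x‖ ^ (-(α + 2)) * ‖x‖ = ‖x‖ ^ (-(α + 1)) := by
      rw [← Real.rpow_add_one hx0.ne']; congr 1; ring
    rw [hΨ x hx1 hx2, mul_assoc, e, mul_div_cancel₀ _ two_ne_zero]
    exact mul_le_mul_of_nonneg_left
      (Real.rpow_le_rpow_of_nonpos hx0 hx2 (by linarith)) hM0

section OuterField

variable {b : OuterBounds} {F : Plane → Plane} {Ψ : Plane → ℝ} {η' η ρ : ℝ}

lemma IsOuterField.abs_cross_le_of_angle {p v : Plane} (hp : ‖p‖ = b.R) (hv : ‖v‖ ≤ b.S)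
    (hv0 : Real.sqrt (2 * b.s₀) ≤ ‖v‖) (hρ : ρ ≤ 1) (h : InnerProductGeometry.angle p v ≤ ρ) :
    |cross p v| ≤ b.R * b.S * ρ ∧ b.c₀ ≤ ⟪v, p⟫ := by
  set θ := InnerProductGeometry.angle p v with hθ
  have hθ0 : 0 ≤ θ := InnerProductGeometry.angle_nonneg p v
  have hπ : (1 : ℝ) ≤ Real.pi := by linarith [Real.pi_gt_three]
  have hcos : ⟪p, v⟫ = ‖p‖ * ‖v‖ * Real.cos θ := by
    rw [hθ, mul_comm, InnerProductGeometry.cos_angle_mul_norm_mul_norm]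
  have hR := b.R_pos
  constructor
  · have h1 : cross p v ^ 2 = (‖p‖ * ‖v‖ * Real.sin θ) ^ 2 := by
      have h2 := inner_sq_add_cross_sq p v
      rw [hcos] at h2
      have h3 := Real.sin_sq_add_cos_sq θ
      linear_combination h2 - ‖p‖ ^ 2 * ‖v‖ ^ 2 * h3
    have h4 : 0 ≤ Real.sin θ := Real.sin_nonneg_of_nonneg_of_le_pi hθ0 (by linarith)
    rw [(sq_eq_sq_iff_abs_eq_abs _ _).1 h1, abs_of_nonneg (by positivity), hp]
    have h5 : Real.sin θ ≤ ρ := (Real.sin_le hθ0).trans h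
    have := b.S_pos
    gcongr
  · rw [real_inner_comm, hcos, hp, OuterBounds.c₀]
    have h6 : Real.cos 1 ≤ Real.cos θ := Real.cos_le_cos_of_nonneg_of_le_pi hθ0 hπ (h.trans hρ)
    have := Real.cos_one_pos
    gcongr

lemma IsOuterField.speed (hF : IsOuterField b α m c F Ψ η') {x v : Plane} (hx : b.R ≤ ‖x‖)
    (hE : ‖v‖ ^ 2 / 2 - potential α m c x = -1) : ‖v‖ ≤ b.S :=
  abs_le_of_sq_le_sq' (by linarith [hF.potential_le x hx]) b.S_pos.le |>.2

lemma IsOuterField.le_speed (hF : IsOuterField b α m c F Ψ η') {x v : Plane} (hx : ‖x‖ = b.R)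
    (hE : ‖v‖ ^ 2 / 2 - potential α m c x = -1) : Real.sqrt (2 * b.s₀) ≤ ‖v‖ := by
  refine Real.sqrt_le_iff.2 ⟨norm_nonneg _, ?_⟩
  linarith [hF.le_potential x hx]

/-- Outer solutions are return arcs of the outer field. -/
lemma IsOuterField.isReturnArc (hF : IsOuterField b α m c F Ψ η') (hs : b.IsSmall η' η)
    (hα : 0 < α) (hρ : ρ ≤ 1) (hρη : b.R * b.S * ρ ≤ η / 2) {p₀ p₁ : Plane} {T : ℝ} {y : ℝ → Plane}
    (hp₀ : ‖p₀‖ = b.R) (hp₁ : ‖p₁‖ = b.R) (h : IsOuterSolution α m c b.R ρ p₀ p₁ T y) :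
    IsReturnArc F b.R b.R₂ b.S b.κ b.τ₀ b.Tmax η T y (velocity T y) ∧
      b.c₀ ≤ ⟪velocity T y 0, y 0⟫ ∧ |cross (y 0) (velocity T y 0)| ≤ b.R * b.S * ρ := by
  obtain ⟨hy, h0, h1, hout, hang⟩ := h
  have hT := hy.1
  have hR : ∀ t ∈ Icc 0 T, b.R ≤ ‖y t‖ := fun t ht => by
    rcases ht.1.eq_or_lt with rfl | h2
    · rw [h0, hp₀]
    rcases ht.2.eq_or_lt with rfl | h3
    · rw [h1, hp₁]
    exact (hout t ⟨h2, h3⟩).le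
  have hR₂ : ∀ t ∈ Icc 0 T, ‖y t‖ ≤ b.R₂ := fun t ht => by
    refine (hF.hill _ (hR t ht) ?_).trans b.R₃_lt.le
    have := hy.norm_velocity_sq ht
    nlinarith [sq_nonneg ‖velocity T y t‖]
  have hE := fun t (ht : t ∈ Icc 0 T) => (hy.2 t ht).2.2.2
  have h0m : (0 : ℝ) ∈ Icc 0 T := left_mem_Icc.2 hT.le
  have hv := fun t (ht : t ∈ Icc 0 T) => hF.speed (hR t ht) (hE t ht)
  have h00 : ‖y 0‖ = b.R := by rw [h0, hp₀]
  have h11 : ‖y T‖ = b.R := by rw [h1, hp₁]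
  rw [← h0] at hang
  have ha := IsOuterField.abs_cross_le_of_angle h00 (hv 0 h0m) (hF.le_speed h00 (hE 0 h0m)) hρ hang.le
  refine ⟨?_, ha.2, ha.1⟩
  exact ((hy.isArc hα).congr_force fun t ht => (hF.eq_force _ (hR t ht) (hR₂ t ht)).symm).isReturnArc
    b.R_pos b.R₂_pos b.B_pos b.S_pos b.κ_pos hF.nonneg hF.nearly hF.coeff hs.le hs.concave hs.drift hT
    (fun t ht => ⟨hR t ht, hR₂ t ht⟩) h00 h11 hv (ha.1.trans hρη) ha.2

end OuterField


/-! ### Return to the circle -/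

lemma IsArc.eventually_lt_norm {F : Plane → Plane} {T R R₂ : ℝ} {y v : ℝ → Plane} (hT : 0 < T)
    (h : IsArc F T y v) (hR : 0 < R) (h0 : ‖y 0‖ = R) (hR₂ : R < R₂) (hpos : 0 < ⟪v 0, y 0⟫) :
    ∃ τ, 0 < τ ∧ τ ≤ T ∧ ∀ t, 0 < t → t ≤ τ → R < ‖y t‖ ∧ ‖y t‖ < R₂ := by
  have h0m : (0 : ℝ) ∈ Icc 0 T := left_mem_Icc.2 hT.le
  have hd := (h.hasDerivWithinAt_norm h0m (norm_pos_iff.1 (h0 ▸ hR))).neg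
  have hneg : -(⟪y 0, v 0⟫ / ‖y 0‖) < 0 := by
    rw [real_inner_comm, h0]
    exact neg_neg_of_pos (by positivity)
  have h1 := hd.limsup_slope_le hneg
  have h2 : ∀ᶠ t in 𝓝[Icc 0 T \ {0}] 0, ‖y t‖ < R₂ :=
    ((h.continuousOn 0 h0m).norm.mono sdiff_subset).eventually (gt_mem_nhds (by simpa only [h0] using hR₂))
  obtain ⟨δ, hδ, hsub⟩ := mem_nhdsWithin_iff.1 (h1.and h2)
  refine ⟨min (δ / 2) T, lt_min (half_pos hδ) hT, min_le_right _ _, fun t ht0 ht => ?_⟩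
  have htm : t ∈ Icc 0 T := ⟨ht0.le, ht.trans (min_le_right _ _)⟩
  have htd : t ∈ ball (0 : ℝ) δ := by
    rw [mem_ball_zero_iff, Real.norm_of_nonneg ht0.le]
    linarith [ht.trans (min_le_left _ _)]
  obtain ⟨h3, h4⟩ := hsub ⟨htd, htm, ht0.ne'⟩
  refine ⟨?_, h4⟩
  rw [slope_def_field, sub_zero, div_neg_iff] at h3
  simp only [Pi.neg_apply, h0] at h3
  rcases h3 with h3 | h3 <;> linarith

/-- `T` is the first time at which the arc leaves the open annulus. Such a time exists by
`IsArc.time_lt`, and the exit is through the inner circle, because conservation of energy confines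
the arc to `‖x‖ ≤ R₃ < R₂`. -/
lemma IsOuterField.exists_return {b : OuterBounds} {F : Plane → Plane} {Ψ : Plane → ℝ} {η' η : ℝ}
    (hF : IsOuterField b α m c F Ψ η') (hs : b.IsSmall η' η) (hα : 0 < α) {y v : ℝ → Plane}
    (h : IsArc F b.Tmax y v) (h0 : ‖y 0‖ = b.R)
    (hE : ‖v 0‖ ^ 2 / 2 - potential α m c (y 0) = -1) (hm : |cross (y 0) (v 0)| ≤ η / 2)
    (hc₀ : b.c₀ ≤ ⟪v 0, y 0⟫) :
    ∃ T, IsReturnArc F b.R b.R₂ b.S b.κ b.τ₀ b.Tmax η T y v ∧ IsSolution α m c T y ∧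
      ∀ t ∈ Ioo 0 T, b.R < ‖y t‖ := by
  have hTm := b.Tmax_pos
  have hR := b.R_pos
  have hv0 := hF.speed h0.ge hE
  obtain ⟨τ, hτ0, hτT, hτ⟩ := h.eventually_lt_norm hTm hR h0 (b.R_le.trans_lt b.R₃_lt)
    (b.c₀_pos.trans_le hc₀)
  -- Exit times are sought only from `τ` on, which excludes the initial point, itself on the circle.
  set E : Set ℝ := Icc τ b.Tmax ∩ {t | ‖y t‖ ≤ b.R ∨ b.R₂ ≤ ‖y t‖} with hEdef
  have hcont : ContinuousOn (fun t => ‖y t‖) (Icc τ b.Tmax) :=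
    (h.continuousOn.mono (Icc_subset_Icc_left hτ0.le)).norm
  have hEc : IsCompact E := by
    have h1 : IsClosed E := by
      have : E = Icc τ b.Tmax ∩ (fun t => ‖y t‖) ⁻¹' (Iic b.R ∪ Ici b.R₂) := rfl
      rw [this]
      exact hcont.preimage_isClosed_of_isClosed isClosed_Icc (isClosed_Iic.union isClosed_Ici)
    exact isCompact_Icc.of_isClosed_subset h1 inter_subset_left
  have hEne : E.Nonempty := by
    by_contra hne
    rw [not_nonempty_iff_eq_empty] at hne
    refine lt_irrefl b.Tmax (h.time_lt hR b.R₂_pos b.S_pos b.κ_pos hF.nonneg hF.nearly hF.coeff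
      hs.le hs.concave hs.drift (fun t ht => ?_) h0 hv0 hm)
    rcases ht.1.eq_or_lt with rfl | h1
    · rw [h0]; exact ⟨le_rfl, by linarith [b.R_le, b.R₃_lt]⟩
    rcases le_total t τ with h2 | h2
    · exact ⟨(hτ t h1 h2).1.le, (hτ t h1 h2).2.le⟩
    · have h3 : t ∉ E := by rw [hne]; exact notMem_empty t
      by_contra h4
      refine h3 ⟨⟨h2, ht.2⟩, ?_⟩
      by_contra h5
      simp only [mem_ofPred_eq, not_or, not_le] at h5
      exact h4 ⟨h5.1.le, h5.2.le⟩
  obtain ⟨T, hTE, hTmin⟩ := hEc.exists_isLeast hEne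
  have hT0 : 0 < T := hτ0.trans_le hTE.1.1
  have hin : ∀ t ∈ Ioo 0 T, b.R < ‖y t‖ ∧ ‖y t‖ < b.R₂ := fun t ht => by
    rcases le_total t τ with h2 | h2
    · exact hτ t ht.1 h2
    · by_contra h4
      refine (hTmin (a := t) ⟨⟨h2, ht.2.le.trans hTE.1.2⟩, ?_⟩).not_gt ht.2
      by_contra h5
      simp only [mem_ofPred_eq, not_or, not_le] at h5
      exact h4 h5
  have ha := h.mono hTE.1.2
  have hIcc : ∀ t ∈ Icc 0 T, b.R ≤ ‖y t‖ ∧ ‖y t‖ ≤ b.R₂ := by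
    have h1 : IsClosed (Icc b.R b.R₂) := isClosed_Icc
    have h2 : MapsTo (fun t => ‖y t‖) (closure (Ioo 0 T)) (closure (Icc b.R b.R₂)) := by
      refine MapsTo.closure_of_continuousOn (fun t ht => ⟨(hin t ht).1.le, (hin t ht).2.le⟩) ?_
      rw [closure_Ioo hT0.ne]
      exact ha.continuousOn.norm
    rw [closure_Ioo hT0.ne, h1.closure_eq] at h2
    exact fun t ht => h2 ht
  have hTm' : T ∈ Icc 0 T := right_mem_Icc.2 hT0.le
  have hα' := ha.congr_force fun t ht => hF.eq_force _ (hIcc t ht).1 (hIcc t ht).2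
  have hoff : ∀ t ∈ Icc 0 T, y t ∈ offCentres c := fun t ht => hF.off _ (hIcc t ht).1
  have hEt : ∀ t ∈ Icc 0 T, ‖v t‖ ^ 2 / 2 - potential α m c (y t) = -1 := fun t ht => by
    rw [hα'.energy_eq hα hoff ht, hE]
  have h1 : ‖y T‖ = b.R := by
    rcases hTE.2 with h2 | h2
    · exact le_antisymm h2 (hIcc T hTm').1
    · have h3 := hF.hill _ (hIcc T hTm').1 (by nlinarith [hEt T hTm', sq_nonneg ‖v T‖])
      linarith [b.R₃_lt]
  refine ⟨T, ?_, hα'.isSolution hα hT0 hoff hEt, fun t ht => (hin t ht).1⟩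
  exact ha.isReturnArc hR b.R₂_pos b.B_pos b.S_pos b.κ_pos hF.nonneg hF.nearly hF.coeff hs.le
    hs.concave hs.drift hT0 hIcc h0 h1 (fun t ht => hF.speed (hIcc t ht).1 (hEt t ht)) hm hc₀


/-! ### Angle swept by a return arc -/

section Angle

variable {F : Plane → Plane} {R R₂ S κ τ₀ Tmax h T : ℝ} {y v : ℝ → Plane}

lemma IsArc.hasDerivWithinAt_inner_div (hy : IsArc F T y v) (p : Plane) {t : ℝ} (ht : t ∈ Icc 0 T)
    (h0 : y t ≠ 0) :
    HasDerivWithinAt (fun t => ⟪p, y t⟫ / ‖y t‖)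
      (-(cross p (y t) * cross (y t) (v t)) / ‖y t‖ ^ 3) (Icc 0 T) t := by
  have hn : ‖y t‖ ≠ 0 := norm_ne_zero_iff.2 h0
  have h1 := ((hasDerivWithinAt_const t (Icc 0 T) p).inner ℝ (hy t ht).1).div
    (hy.hasDerivWithinAt_norm ht h0) hn
  refine h1.congr_deriv ?_
  have e : ⟪p, v t⟫ * ‖y t‖ ^ 2 - ⟪p, y t⟫ * ⟪y t, v t⟫ = -(cross p (y t) * cross (y t) (v t)) := by
    rw [norm_sq_eq]; simp only [inner_eq, cross]; ring
  rw [← e, inner_zero_left, add_zero]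
  field_simp

lemma IsArc.hasDerivWithinAt_cross_div (hy : IsArc F T y v) (p : Plane) {t : ℝ} (ht : t ∈ Icc 0 T)
    (h0 : y t ≠ 0) :
    HasDerivWithinAt (fun t => cross p (y t) / ‖y t‖)
      (⟪p, y t⟫ * cross (y t) (v t) / ‖y t‖ ^ 3) (Icc 0 T) t := by
  have hn : ‖y t‖ ≠ 0 := norm_ne_zero_iff.2 h0
  have h1 := (HasDerivWithinAt.cross (hasDerivWithinAt_const t (Icc 0 T) p) (hy t ht).1).div
    (hy.hasDerivWithinAt_norm ht h0) hn
  refine h1.congr_deriv ?_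
  have e : cross p (v t) * ‖y t‖ ^ 2 - cross p (y t) * ⟪y t, v t⟫ = ⟪p, y t⟫ * cross (y t) (v t) := by
    rw [norm_sq_eq]; simp only [inner_eq, cross]; ring
  have e0 : cross 0 (y t) = 0 := by simp [cross]
  rw [← e, e0, zero_add]
  field_simp

/-- Small angular momentum over bounded time keeps the arc within an angle of sixty degrees of its
initial point. There the oriented area with `y 0` is monotone in the angle, so it can stand for the
angle. -/
lemma IsReturnArc.le_inner (hy : IsReturnArc F R R₂ S κ τ₀ Tmax h T y v) (hR : 0 < R)
    (hh : h * Tmax ≤ R ^ 2 / 2) {t : ℝ} (ht : t ∈ Icc 0 T) : R / 2 * ‖y t‖ ≤ ⟪y 0, y t⟫ := by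
  have h0m : (0 : ℝ) ∈ Icc 0 T := left_mem_Icc.2 (ht.1.trans ht.2)
  have hn : ∀ t ∈ Icc 0 T, 0 < ‖y t‖ := fun t ht => hR.trans_le (hy.mem t ht).1
  have hh0 : 0 ≤ h := (abs_nonneg _).trans (hy.momentum t ht)
  have h1 := (convex_Icc 0 T).norm_image_sub_le_of_norm_hasDerivWithin_le (C := h / R)
    (fun t ht => hy.arc.hasDerivWithinAt_inner_div (y 0) ht (norm_pos_iff.1 (hn t ht)))
    (fun t ht => ?_) h0m ht
  · have h2 : h / R * ‖t - 0‖ ≤ R / 2 := by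
      rw [sub_zero, Real.norm_of_nonneg ht.1, div_mul_eq_mul_div, div_le_iff₀ hR]
      have := mul_le_mul_of_nonneg_left (ht.2.trans hy.time_le) hh0
      linarith
    have h3 : ⟪y 0, y 0⟫ / ‖y 0‖ = R := by
      rw [real_inner_self_eq_norm_sq, hy.start]; field_simp
    rw [h3, Real.norm_eq_abs] at h1
    have h4 := (abs_le.1 (h1.trans h2)).1
    rw [← le_div_iff₀ (hn t ht)]
    linarith
  · have hnt := hn t ht
    have hRt := (hy.mem t ht).1
    rw [norm_div, norm_neg, norm_mul, Real.norm_eq_abs, Real.norm_eq_abs, norm_pow, norm_norm]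
    have h5 : |cross (y 0) (y t)| ≤ R * ‖y t‖ := by
      rw [← hy.start]; exact abs_cross_le _ _
    have h6 : |cross (y 0) (y t)| * |cross (y t) (v t)| ≤ (R * ‖y t‖) * h :=
      mul_le_mul h5 (hy.momentum t ht) (abs_nonneg _) (by positivity)
    rw [div_le_div_iff₀ (by positivity) hR]
    have h7 : (R * ‖y t‖) * h * R ≤ h * ‖y t‖ ^ 3 := by
      have h8 : R * R * (h * ‖y t‖) ≤ ‖y t‖ * ‖y t‖ * (h * ‖y t‖) := by gcongr
      linarith
    exact (mul_le_mul_of_nonneg_right h6 hR.le).trans h7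

/-- An angular momentum of constant sign sweeps a definite angle: the sine of the angle has
derivative cosine times momentum over `|y|²`, with cosine at least `1/2` by `le_inner`. The factor
`σ` selects the side. -/
lemma IsReturnArc.le_cross (hy : IsReturnArc F R R₂ S κ τ₀ Tmax h T y v) (hR : 0 < R) (hτ₀ : 0 < τ₀)
    (hh : h * Tmax ≤ R ^ 2 / 2) {σ μ : ℝ} (hμ : 0 ≤ μ)
    (hσ : ∀ t ∈ Icc 0 T, μ ≤ σ * cross (y t) (v t)) :
    τ₀ * R ^ 2 * μ / (2 * R₂ ^ 2) ≤ σ * cross (y 0) (y T) := by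
  have hT : 0 < T := hτ₀.trans_le hy.le_time
  have hn : ∀ t ∈ Icc 0 T, 0 < ‖y t‖ := fun t ht => hR.trans_le (hy.mem t ht).1
  have h1 := mul_le_sub_of_le_hasDerivWithinAt (C := R * μ / (2 * R₂ ^ 2)) hT.le
    (fun t ht => (hy.arc.hasDerivWithinAt_cross_div (y 0) ht
      (norm_pos_iff.1 (hn t ht))).const_mul σ) (fun t ht => ?_)
  · have hR₂ : 0 < R₂ := hR.trans_le ((hy.mem T (right_mem_Icc.2 hT.le)).1.trans
      (hy.mem T (right_mem_Icc.2 hT.le)).2)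
    rw [cross_self, zero_div, mul_zero, sub_zero, sub_zero, hy.finish, ← mul_div_assoc,
      le_div_iff₀ hR] at h1
    have h2 : R * μ / (2 * R₂ ^ 2) * τ₀ ≤ R * μ / (2 * R₂ ^ 2) * T :=
      mul_le_mul_of_nonneg_left hy.le_time (by positivity)
    calc _ = R * μ / (2 * R₂ ^ 2) * τ₀ * R := by ring
      _ ≤ _ := (mul_le_mul_of_nonneg_right h2 hR.le).trans h1
  · have hnt := hn t ht
    have h3 := hy.le_inner hR hh ht
    have h4 : R / 2 * ‖y t‖ * μ ≤ ⟪y 0, y t⟫ * (σ * cross (y t) (v t)) :=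
      mul_le_mul h3 (hσ t ht) hμ (le_trans (by positivity) h3)
    have h5 : R * μ / (2 * R₂ ^ 2) ≤ R * μ / (2 * ‖y t‖ ^ 2) := by
      have := (hy.mem t ht).2
      gcongr
    refine h5.trans ?_
    have e : R * μ / (2 * ‖y t‖ ^ 2) = (R / 2 * ‖y t‖ * μ) / ‖y t‖ ^ 3 := by field_simp
    rw [e, ← mul_div_assoc]
    refine div_le_div_of_nonneg_right ?_ (by positivity)
    linarith

end Angle

/-! ### Shooting -/

lemma eq_of_inner_eq_of_cross_eq {p x x' : Plane} (hp : p ≠ 0) (h1 : ⟪p, x⟫ = ⟪p, x'⟫)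
    (h2 : cross p x = cross p x') : x = x' := by
  have h := norm_mul_norm_le p (x - x')
  rw [inner_sub_right, cross_sub_right, h1, h2, sub_self, sub_self, abs_zero, add_zero] at h
  have h3 := norm_pos_iff.2 hp
  have h4 : ‖x - x'‖ ≤ 0 := le_of_mul_le_mul_left (by rwa [mul_zero]) h3
  exact sub_eq_zero.1 (norm_le_zero_iff.1 h4)

/-- The point of a circle centred at the origin is determined by its oriented area with `p`, on the
side of `p`. -/
lemma eq_of_cross_eq {p x x' : Plane} (hp : p ≠ 0) (hn : ‖x‖ = ‖x'‖) (h : cross p x = cross p x')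
    (h1 : 0 ≤ ⟪p, x⟫) (h2 : 0 ≤ ⟪p, x'⟫) : x = x' := by
  refine eq_of_inner_eq_of_cross_eq hp ?_ h
  have e1 := inner_sq_add_cross_sq p x
  have e2 := inner_sq_add_cross_sq p x'
  rw [hn, h] at e1
  exact (sq_eq_sq₀ h1 h2).1 (by linarith)

/-- Rotation by a quarter turn. -/
def quarterTurn (x : Plane) : Plane := !₂[-x 1, x 0]

/-- The rotation of `x` by the angle `θ`. -/
noncomputable def rotate (θ : ℝ) (x : Plane) : Plane := Real.cos θ • x + Real.sin θ • quarterTurn x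

lemma inner_rotate (θ : ℝ) (x : Plane) : ⟪x, rotate θ x⟫ = Real.cos θ * ‖x‖ ^ 2 := by
  rw [norm_sq_eq, inner_eq]; simp [rotate, quarterTurn]; ring

lemma cross_rotate (θ : ℝ) (x : Plane) : cross x (rotate θ x) = Real.sin θ * ‖x‖ ^ 2 := by
  rw [norm_sq_eq, cross]; simp [rotate, quarterTurn]; ring

lemma norm_rotate (θ : ℝ) (x : Plane) : ‖rotate θ x‖ = ‖x‖ := by
  rw [← sq_eq_sq₀ (norm_nonneg _) (norm_nonneg _), norm_sq_eq, norm_sq_eq]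
  simp [rotate, quarterTurn]
  linear_combination (x 0 ^ 2 + x 1 ^ 2) * Real.sin_sq_add_cos_sq θ

lemma continuous_rotate (x : Plane) : Continuous fun θ => rotate θ x := by
  unfold rotate; fun_prop

lemma angle_rotate {θ : ℝ} (hθ : |θ| ≤ Real.pi) {x : Plane} (hx : x ≠ 0) :
    InnerProductGeometry.angle x (rotate θ x) = |θ| := by
  have : ‖x‖ ≠ 0 := norm_ne_zero_iff.2 hx
  rw [InnerProductGeometry.angle, inner_rotate, norm_rotate, ← sq, mul_div_cancel_right₀ _
    (pow_ne_zero 2 this), ← Real.cos_abs, Real.arccos_cos (abs_nonneg _) hθ]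


/-! ### Choice of the constants -/

/-- A lower bound for the angular momentum of the outer solutions of initial angle `ρ / 2`. -/
noncomputable def OuterBounds.sweep (b : OuterBounds) (ρ : ℝ) : ℝ :=
  b.R * Real.sqrt (2 * b.s₀) * Real.sin (ρ / 2) / 2

/-- Admissible choices of the angle `ρ`, of the error `η'` of the force, of the bound `η` for the
angular momentum, of the distance `δ₀` of the end points; `C` bounds the variation of outer
solutions with their end points, when the initial points and energies differ by at most `μ`. -/
structure OuterBounds.IsAdapted (b : OuterBounds) (ρ δ₀ η' η μ C : ℝ) : Prop where
  ρ_pos : 0 < ρ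
  δ₀_pos : 0 < δ₀
  η'_pos : 0 < η'
  μ_pos : 0 < μ
  C_pos : 0 < C
  ρ_le : ρ ≤ 1
  small : b.IsSmall η' η
  momentum : b.R * b.S * ρ ≤ η / 2
  angle : η * b.Tmax ≤ b.R ^ 2 / 2
  drift : b.R₂ * η' * b.Tmax ≤ b.sweep ρ
  δ₀_le : δ₀ ≤ b.R
  δ₀_sweep : b.R * δ₀ ≤ b.τ₀ * b.R ^ 2 * b.sweep ρ / (2 * b.R₂ ^ 2)
  compare : ∀ (F : Plane → Plane) (Ψ : Plane → ℝ) (T₁ T₂ X : ℝ) (y₁ v₁ y₂ v₂ : ℝ → Plane),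
    IsNearlyCentral F Ψ b.L b.B η' →
    IsReturnArc F b.R b.R₂ b.S b.κ b.τ₀ b.Tmax η T₁ y₁ v₁ →
    IsReturnArc F b.R b.R₂ b.S b.κ b.τ₀ b.Tmax η T₂ y₂ v₂ →
    b.c₀ ≤ ⟪v₁ 0, y₁ 0⟫ → b.c₀ ≤ ⟪v₂ 0, y₂ 0⟫ →
    |‖v₂ 0‖ ^ 2 - ‖v₁ 0‖ ^ 2| ≤ X → ‖y₂ 0 - y₁ 0‖ + ‖v₂ 0 - v₁ 0‖ ≤ η →
    |T₂ - T₁| ≤ C * (‖y₂ 0 - y₁ 0‖ + ‖v₂ 0 - v₁ 0‖) ∧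
      ‖y₂ T₂ - y₁ T₁‖ ≤ C * (‖y₂ 0 - y₁ 0‖ + ‖v₂ 0 - v₁ 0‖) ∧
      ‖v₂ 0 - v₁ 0‖ ≤ C * (‖y₂ T₂ - y₁ T₁‖ + ‖y₂ 0 - y₁ 0‖ + X)
  close : ∀ (p₁ v₁ p₂ v₂ : Plane) (X : ℝ), ‖p₁‖ = b.R → ‖v₁‖ ≤ b.S → ‖v₂‖ ≤ b.S →
    b.c₀ ≤ ⟪v₁, p₁⟫ → b.c₀ ≤ ⟪v₂, p₂⟫ → |cross p₁ v₁| ≤ b.R * b.S * ρ →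
    |cross p₂ v₂| ≤ b.R * b.S * ρ → |‖v₂‖ ^ 2 - ‖v₁‖ ^ 2| ≤ X → ‖p₂ - p₁‖ + X ≤ μ →
    ‖p₂ - p₁‖ + ‖v₂ - v₁‖ ≤ η

/-- Starts that are both nearly radial, with close initial points and energies, automatically have
close velocities, since their angular momenta are at most `ω`. This makes the local comparison
available for any two outer solutions with close starting points, and turns local uniqueness into
uniqueness. -/
lemma norm_add_norm_sub_le {p₁ v₁ p₂ v₂ : Plane} {R S c₀ X ω : ℝ} (hR : 0 < R) (hS : 0 < S)
    (hc₀ : 0 < c₀) (hp : ‖p₁‖ = R) (h1 : ‖v₁‖ ≤ S) (h2 : ‖v₂‖ ≤ S) (hi₁ : c₀ ≤ ⟪v₁, p₁⟫)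
    (hi₂ : c₀ ≤ ⟪v₂, p₂⟫) (hc₁ : |cross p₁ v₁| ≤ ω) (hc₂ : |cross p₂ v₂| ≤ ω)
    (hX : |‖v₂‖ ^ 2 - ‖v₁‖ ^ 2| ≤ X) (ha : S * ‖p₂ - p₁‖ ≤ c₀) :
    ‖p₂ - p₁‖ + ‖v₂ - v₁‖ ≤ (1 + R / c₀ + (2 * S / c₀ + 1 / R) * S) * (‖p₂ - p₁‖ + X)
      + (2 * S / c₀ + 1 / R) * (2 * ω) := by
  have hX0 : 0 ≤ X := (abs_nonneg _).trans hX
  have h3 : ⟪v₂, p₂ - p₁⟫ ≤ S * ‖p₂ - p₁‖ :=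
    (real_inner_le_norm _ _).trans (mul_le_mul_of_nonneg_right h2 (norm_nonneg _))
  have h4 : c₀ ≤ ⟪v₁ + v₂, p₁⟫ := by
    rw [inner_add_left]
    rw [inner_sub_right] at h3
    linarith
  have h5 := norm_le_of_cross hR hc₀ hp h1 h2 rfl h4 hX
  have h6 : |cross (v₂ - v₁) p₁| ≤ 2 * ω + S * ‖p₂ - p₁‖ := by
    have e : cross (v₂ - v₁) p₁ = -cross p₂ v₂ + cross p₁ v₁ + cross (p₂ - p₁) v₂ := by
      simp only [cross, PiLp.sub_apply]; ring
    have h7 : |cross (p₂ - p₁) v₂| ≤ S * ‖p₂ - p₁‖ := by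
      rw [mul_comm]
      exact (abs_cross_le _ _).trans (mul_le_mul_of_nonneg_left h2 (norm_nonneg _))
    rw [e]
    have h8 := abs_add_three (-cross p₂ v₂) (cross p₁ v₁) (cross (p₂ - p₁) v₂)
    rw [abs_neg] at h8
    linarith
  have h9 : (2 * S / c₀ + 1 / R) * |cross (v₂ - v₁) p₁|
      ≤ (2 * S / c₀ + 1 / R) * (2 * ω + S * ‖p₂ - p₁‖) :=
    mul_le_mul_of_nonneg_left h6 (by positivity)
  have h10 : 0 ≤ R / c₀ * ‖p₂ - p₁‖ := by positivity
  have h11 : 0 ≤ (2 * S / c₀ + 1 / R) * S * X := by positivity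
  linarith

/-- The order of choice matters: `η` from the bounds `b`, then the angle `ρ` from `η`, then the
error `η'` and the distance `δ₀` from the momentum that the angle `ρ / 2` provides. The threshold
`μ` depends on `b` and `η`. -/
lemma OuterBounds.exists_isAdapted (b : OuterBounds) :
    ∃ ρ δ₀ η' η μ C : ℝ, b.IsAdapted ρ δ₀ η' η μ C := by
  have hR := b.R_pos
  have hS := b.S_pos
  have hκ := b.κ_pos
  have hc₀ := b.c₀_pos
  have hT := b.Tmax_pos
  have hR₂ := b.R₂_pos
  have hτ₀ := b.τ₀_pos
  obtain ⟨η₀, hη₀, C, hC, H⟩ := exists_compare hR hR₂ hS hκ hτ₀ hT hc₀ b.L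
  obtain ⟨k, hk⟩ : ∃ k, k = 2 * b.S / b.c₀ + 1 / b.R := ⟨_, rfl⟩
  have hk0 : 0 < k := hk ▸ by positivity
  obtain ⟨k', hk'⟩ : ∃ k', k' = 1 + b.R / b.c₀ + k * b.S := ⟨_, rfl⟩
  have hk'0 : 0 < k' := hk' ▸ by positivity
  obtain ⟨η, hη, hη1, hη2, hη3, hη4⟩ : ∃ η, 0 < η ∧ η ≤ η₀ ∧ η ≤ 1 ∧
      η * (1 / b.R ^ 3 + 1) ≤ b.κ ∧ η * b.Tmax ≤ b.R ^ 2 / 2 := by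
    refine ⟨min (min η₀ 1) (min (b.κ / (1 / b.R ^ 3 + 1)) (b.R ^ 2 / 2 / b.Tmax)), by positivity,
      (min_le_left _ _).trans (min_le_left _ _), (min_le_left _ _).trans (min_le_right _ _), ?_, ?_⟩
    · rw [← le_div_iff₀ (by positivity)]
      exact (min_le_right _ _).trans (min_le_left _ _)
    · rw [← le_div_iff₀ (by positivity)]
      exact (min_le_right _ _).trans (min_le_right _ _)
  obtain ⟨ρ, hρ, hρ1, hρ2, hρ3⟩ : ∃ ρ, 0 < ρ ∧ ρ ≤ 1 ∧ ρ * (b.R * b.S) ≤ η / 2 ∧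
      ρ * (k * (2 * (b.R * b.S))) ≤ η / 2 := by
    refine ⟨min 1 (min (η / 2 / (b.R * b.S)) (η / 2 / (k * (2 * (b.R * b.S))))), by positivity,
      min_le_left _ _, ?_, ?_⟩
    · rw [← le_div_iff₀ (by positivity)]
      exact (min_le_right _ _).trans (min_le_left _ _)
    · rw [← le_div_iff₀ (by positivity)]
      exact (min_le_right _ _).trans (min_le_right _ _)
  have hsw : 0 < b.sweep ρ := by
    have h1 : 0 < Real.sin (ρ / 2) :=
      Real.sin_pos_of_pos_of_lt_pi (by linarith) (by linarith [Real.pi_gt_three])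
    have := b.s₀_pos
    unfold OuterBounds.sweep; positivity
  obtain ⟨η', hη', hη'1, hη'2, hη'3⟩ : ∃ η', 0 < η' ∧ η' ≤ η ∧ η' * (b.R₂ * b.Tmax) ≤ η / 2 ∧
      η' * (b.R₂ * b.Tmax) ≤ b.sweep ρ := by
    refine ⟨min η (min (η / 2 / (b.R₂ * b.Tmax)) (b.sweep ρ / (b.R₂ * b.Tmax))), by positivity,
      min_le_left _ _, ?_, ?_⟩
    · rw [← le_div_iff₀ (by positivity)]
      exact (min_le_right _ _).trans (min_le_left _ _)
    · rw [← le_div_iff₀ (by positivity)]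
      exact (min_le_right _ _).trans (min_le_right _ _)
  obtain ⟨δ₀, hδ₀, hδ₀1, hδ₀2⟩ : ∃ δ₀, 0 < δ₀ ∧ δ₀ ≤ b.R ∧
      δ₀ * b.R ≤ b.τ₀ * b.R ^ 2 * b.sweep ρ / (2 * b.R₂ ^ 2) := by
    refine ⟨min b.R (b.τ₀ * b.R ^ 2 * b.sweep ρ / (2 * b.R₂ ^ 2) / b.R), by positivity,
      min_le_left _ _, ?_⟩
    rw [← le_div_iff₀ hR]
    exact min_le_right _ _
  obtain ⟨μ, hμ, hμ1, hμ2⟩ : ∃ μ, 0 < μ ∧ μ * b.S ≤ b.c₀ ∧ μ * k' ≤ η / 2 := by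
    refine ⟨min (b.c₀ / b.S) (η / 2 / k'), by positivity, ?_, ?_⟩
    · rw [← le_div_iff₀ hS]; exact min_le_left _ _
    · rw [← le_div_iff₀ hk'0]; exact min_le_right _ _
  refine ⟨ρ, δ₀, η', η, μ, C, hρ, hδ₀, hη', hμ, hC, hρ1, ⟨hη'1, ?_, by linarith⟩, by linarith, hη4,
    by linarith, hδ₀1, by linarith, ?_, ?_⟩
  · have h1 : η ^ 2 / b.R ^ 3 ≤ η * (1 / b.R ^ 3) := by
      rw [mul_one_div]
      refine div_le_div_of_nonneg_right ?_ (by positivity)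
      nlinarith
    linarith
  · intro F Ψ T₁ T₂ X y₁ v₁ y₂ v₂ hF h1 h2 h3 h4 h5 h6
    exact H F Ψ b.B η T₁ T₂ X y₁ v₁ y₂ v₂ (hF.mono hη'1) hη1 h1 h2 h3 h4 h5 h6
  · intro p₁ v₁ p₂ v₂ X hp h1 h2 h3 h4 h5 h6 hX hμX
    have hX0 : 0 ≤ X := (abs_nonneg _).trans hX
    have ha : b.S * ‖p₂ - p₁‖ ≤ b.c₀ := by
      have := mul_le_mul_of_nonneg_left (show ‖p₂ - p₁‖ ≤ μ by linarith) hS.le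
      linarith
    have := norm_add_norm_sub_le hR hS hc₀ hp h1 h2 h3 h4 h5 h6 hX ha
    rw [← hk, ← hk'] at this
    have h7 := mul_le_mul_of_nonneg_left hμX hk'0.le
    linarith

/-! ### Existence and uniqueness of outer solutions -/

section Shooting

variable {b : OuterBounds} {ρ δ₀ η' η μ C : ℝ} {F : Plane → Plane} {Ψ : Plane → ℝ}

/-- With equal end points and equal energies every term on the right of the comparison vanishes, so
the initial velocities agree. -/
lemma IsOuterField.outer_unique (hb : b.IsAdapted ρ δ₀ η' η μ C)
    (hF : IsOuterField b α m c F Ψ η') (hα : 0 < α) {p₀ p₁ : Plane} (hp₀ : ‖p₀‖ = b.R)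
    (hp₁ : ‖p₁‖ = b.R) {T T' : ℝ} {y y' : ℝ → Plane} (h : IsOuterSolution α m c b.R ρ p₀ p₁ T y)
    (h' : IsOuterSolution α m c b.R ρ p₀ p₁ T' y') : T' = T ∧ EqOn y' y (Icc 0 T) := by
  obtain ⟨r, i, hc⟩ := hF.isReturnArc hb.small hα hb.ρ_le hb.momentum hp₀ hp₁ h
  obtain ⟨r', i', hc'⟩ := hF.isReturnArc hb.small hα hb.ρ_le hb.momentum hp₀ hp₁ h'
  have hT := h.1.1
  have h0m : (0 : ℝ) ∈ Icc 0 T := left_mem_Icc.2 hT.le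
  have h0m' : (0 : ℝ) ∈ Icc 0 T' := left_mem_Icc.2 h'.1.1.le
  have e0 : y' 0 - y 0 = 0 := by rw [h.2.1, h'.2.1, sub_self]
  have e1 : y' T' - y T = 0 := by rw [h.2.2.1, h'.2.2.1, sub_self]
  have hX : |‖velocity T' y' 0‖ ^ 2 - ‖velocity T y 0‖ ^ 2| ≤ 0 := by
    rw [h.1.norm_velocity_sq h0m, h'.1.norm_velocity_sq h0m', h.2.1, h'.2.1, sub_self, abs_zero]
  have hη := hb.close (y 0) (velocity T y 0) (y' 0) (velocity T' y' 0) 0 r.start (r.speed 0 h0m)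
    (r'.speed 0 h0m') i i' hc hc' hX (by rw [e0, norm_zero, add_zero]; exact hb.μ_pos.le)
  obtain ⟨h1, -, h3⟩ := hb.compare F Ψ T T' 0 _ _ _ _ hF.nearly r r' i i' hX hη
  rw [e0, e1, norm_zero, add_zero, add_zero, mul_zero] at h3
  have h4 : ‖velocity T' y' 0 - velocity T y 0‖ = 0 := le_antisymm h3 (norm_nonneg _)
  rw [e0, h4, norm_zero, add_zero, mul_zero] at h1
  have hTT : T' = T := sub_eq_zero.1 (abs_eq_zero.1 (le_antisymm h1 (abs_nonneg _)))
  subst hTT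
  refine ⟨rfl, fun t ht => ?_⟩
  have h5 := (r.arc.gronwall_le hF.nearly.lipschitz r'.arc r.time_le (D := 0)
    (by rw [e0, h4, norm_zero, add_zero]) ht).1
  rw [mul_zero] at h5
  exact sub_eq_zero.1 (norm_le_zero_iff.1 h5)

/-- Shooting from `p₀` at the speed fixed by the energy, with angle `θ` to the radial direction in
`[-ρ / 2, ρ / 2]`. The return point depends continuously on `θ`, and the extreme angles land on
opposite sides of `p₀`, beyond every `p₁` at distance at most `δ₀`. -/
lemma IsOuterField.exists_outer (hb : b.IsAdapted ρ δ₀ η' η μ C)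
    (hF : IsOuterField b α m c F Ψ η') (hα : 0 < α) {p₀ p₁ : Plane} (hp₀ : ‖p₀‖ = b.R)
    (hp₁ : ‖p₁‖ = b.R) (hd : ‖p₁ - p₀‖ ≤ δ₀) :
    ∃ T y, IsOuterSolution α m c b.R ρ p₀ p₁ T y := by
  have hR := b.R_pos
  have hρ := hb.ρ_pos
  have hp0 : p₀ ≠ 0 := norm_pos_iff.1 (hp₀ ▸ hR)
  have hs₀ := b.s₀_pos
  have hπ := Real.pi_gt_three
  set s : ℝ := Real.sqrt (2 * (potential α m c p₀ - 1)) with hs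
  have hV := hF.le_potential p₀ hp₀
  have hss : s ^ 2 = 2 * (potential α m c p₀ - 1) := Real.sq_sqrt (by linarith)
  have hs0 : Real.sqrt (2 * b.s₀) ≤ s := Real.sqrt_le_sqrt (by linarith)
  have hs0' : 0 < Real.sqrt (2 * b.s₀) := by positivity
  have hspos : 0 < s := hs0'.trans_le hs0
  set w : ℝ → Plane := fun θ => (s / b.R) • rotate θ p₀ with hw
  have hwc : Continuous w := by
    have := continuous_rotate p₀
    simp only [hw]; fun_prop
  have hwn : ∀ θ, ‖w θ‖ = s := fun θ => by
    rw [hw, norm_smul, norm_rotate, hp₀, Real.norm_of_nonneg (by positivity)]; field_simp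
  have hE : ∀ θ, ‖w θ‖ ^ 2 / 2 - potential α m c p₀ = -1 := fun θ => by rw [hwn, hss]; ring
  have hwcr : ∀ θ, cross p₀ (w θ) = b.R * s * Real.sin θ := fun θ => by
    rw [hw, cross_smul_right, cross_rotate, hp₀]; field_simp
  set I : Set ℝ := Icc (-(ρ / 2)) (ρ / 2) with hI
  have hIρ : ∀ θ ∈ I, |θ| ≤ ρ / 2 := fun θ hθ => abs_le.2 hθ
  have hang : ∀ θ ∈ I, InnerProductGeometry.angle p₀ (w θ) = |θ| := fun θ hθ => by
    rw [hw, InnerProductGeometry.angle_smul_right_of_pos _ _ (by positivity),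
      angle_rotate (by linarith [hIρ θ hθ, hb.ρ_le]) hp0]
  have hstart : ∀ θ ∈ I, |cross p₀ (w θ)| ≤ b.R * b.S * ρ ∧ b.c₀ ≤ ⟪w θ, p₀⟫ := fun θ hθ => by
    refine IsOuterField.abs_cross_le_of_angle hp₀ (hF.speed hp₀.ge (hE θ)) (hF.le_speed hp₀ (hE θ))
      hb.ρ_le ?_
    rw [hang θ hθ]; linarith [hIρ θ hθ]
  choose y v hy hy0 hv0 using fun θ : ℝ =>
    exists_isArc hF.nearly.lipschitz hF.nearly.bounded b.Tmax_pos p₀ (w θ)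
  have hret : ∀ θ : ℝ, ∃ T, θ ∈ I →
      IsReturnArc F b.R b.R₂ b.S b.κ b.τ₀ b.Tmax η T (y θ) (v θ) ∧ IsSolution α m c T (y θ) ∧
        ∀ t ∈ Ioo 0 T, b.R < ‖y θ t‖ := fun θ => by
    by_cases hθ : θ ∈ I
    · obtain ⟨T, hT⟩ := hF.exists_return hb.small hα (hy θ) (by rw [hy0, hp₀])
        (by rw [hy0, hv0, hE]) (by rw [hy0, hv0]; exact (hstart θ hθ).1.trans hb.momentum)
        (by rw [hy0, hv0]; exact (hstart θ hθ).2)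
      exact ⟨T, fun _ => hT⟩
    · exact ⟨0, fun h => absurd h hθ⟩
  choose T hT using hret
  set P : ℝ → Plane := fun θ => y θ (T θ) with hP
  have hPc : ContinuousOn P I := by
    intro θ hθ
    rw [ContinuousWithinAt, tendsto_iff_norm_sub_tendsto_zero]
    have h1 : Tendsto (fun θ' => C * ‖w θ' - w θ‖) (𝓝[I] θ) (𝓝 0) := by
      have : Tendsto (fun θ' => C * ‖w θ' - w θ‖) (𝓝 θ) (𝓝 (C * ‖w θ - w θ‖)) :=
        (((hwc.sub continuous_const).norm).const_mul C).tendsto θ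
      rw [sub_self, norm_zero, mul_zero] at this
      exact this.mono_left nhdsWithin_le_nhds
    have hηpos : 0 < η := hb.η'_pos.trans_le hb.small.le
    have h2 : ∀ᶠ θ' in 𝓝[I] θ, ‖w θ' - w θ‖ ≤ η := by
      have : Tendsto (fun θ' => ‖w θ' - w θ‖) (𝓝 θ) (𝓝 ‖w θ - w θ‖) :=
        ((hwc.sub continuous_const).norm).tendsto θ
      rw [sub_self, norm_zero] at this
      exact (this.mono_left nhdsWithin_le_nhds).eventually (ge_mem_nhds hηpos)
    refine squeeze_zero' (Eventually.of_forall fun _ => norm_nonneg _) ?_ h1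
    filter_upwards [h2, self_mem_nhdsWithin] with θ' hθ'η hθ'
    have h3 := (hb.compare F Ψ (T θ) (T θ') 0 _ _ _ _ hF.nearly (hT θ hθ).1 (hT θ' hθ').1
      (by rw [hy0, hv0]; exact (hstart θ hθ).2) (by rw [hy0, hv0]; exact (hstart θ' hθ').2)
      (by rw [hv0, hv0, hwn, hwn, sub_self, abs_zero])
      (by rw [hy0, hy0, hv0, hv0, sub_self, norm_zero, zero_add]; exact hθ'η)).2.1
    rwa [hy0, hy0, hv0, hv0, sub_self, norm_zero, zero_add] at h3
  have hsin : 0 ≤ Real.sin (ρ / 2) :=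
    Real.sin_nonneg_of_nonneg_of_le_pi (by linarith) (by linarith [hb.ρ_le])
  have hsw0 : 0 ≤ b.sweep ρ := by unfold OuterBounds.sweep; positivity
  -- At the extreme angles, `σ = ±1`, the angular momentum starts at least at `2 * sweep` on the
  -- side `σ` and drifts by at most `sweep`, so it stays above `sweep`.
  have hsweep : ∀ σ : ℝ, ∀ θ ∈ I, σ * Real.sin θ = Real.sin (ρ / 2) → |σ| = 1 →
      b.τ₀ * b.R ^ 2 * b.sweep ρ / (2 * b.R₂ ^ 2) ≤ σ * cross p₀ (P θ) := by
    intro σ θ hθ hσ hσ1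
    have hr := (hT θ hθ).1
    rw [← hy0 θ]
    refine hr.le_cross hR b.τ₀_pos hb.angle hsw0 fun t ht => ?_
    have h1 := hr.arc.abs_cross_sub_le hF.nearly (fun t ht => (hr.mem t ht).2) ht
    have h2 : b.R₂ * η' * t ≤ b.R₂ * η' * b.Tmax :=
      mul_le_mul_of_nonneg_left (ht.2.trans hr.time_le)
        (mul_nonneg b.R₂_pos.le hF.nonneg)
    rw [hy0, hv0, hwcr] at h1
    have h3 : |σ * (cross (y θ t) (v θ t) - b.R * s * Real.sin θ)| ≤ b.sweep ρ := by
      rw [abs_mul, hσ1, one_mul]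
      exact h1.trans (h2.trans hb.drift)
    have h4 : 2 * b.sweep ρ ≤ b.R * s * Real.sin (ρ / 2) := by
      rw [OuterBounds.sweep, mul_div_cancel₀ _ two_ne_zero]
      gcongr
    have h5 := (abs_le.1 h3).1
    rw [← hσ] at h4
    linarith
  have hω : |cross p₀ p₁| ≤ b.τ₀ * b.R ^ 2 * b.sweep ρ / (2 * b.R₂ ^ 2) := by
    have h1 : cross p₀ p₁ = cross p₀ (p₁ - p₀) := by rw [cross_sub_right, cross_self, sub_zero]
    rw [h1]
    refine (abs_cross_le _ _).trans (le_trans ?_ hb.δ₀_sweep)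
    rw [hp₀]
    exact mul_le_mul_of_nonneg_left hd hR.le
  have hle : -(ρ / 2) ≤ ρ / 2 := by linarith
  have hcc : ContinuousOn (fun θ => cross p₀ (P θ)) I := by
    have : Continuous fun x : Plane => cross p₀ x := by unfold cross; fun_prop
    exact this.comp_continuousOn hPc
  have h1 := hsweep 1 (ρ / 2) (right_mem_Icc.2 hle) (one_mul _) abs_one
  have h2 := hsweep (-1) (-(ρ / 2)) (left_mem_Icc.2 hle) (by rw [Real.sin_neg]; ring) (by simp)
  obtain ⟨θ, hθ, hθP⟩ := intermediate_value_Icc hle hcc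
    (show cross p₀ p₁ ∈ Icc _ _ from ⟨by linarith [(abs_le.1 hω).1], by linarith [(abs_le.1 hω).2]⟩)
  obtain ⟨hr, hsol, hout⟩ := hT θ hθ
  have hTpos := hsol.1
  have hPn : ‖P θ‖ = b.R := hr.finish
  -- The intermediate value theorem only matches the oriented areas with `p₀`. Both points lie on
  -- the side of `p₀`, the point `p₁` because `δ₀ ≤ R`, and this leaves one point of the circle.
  have hPp : P θ = p₁ := by
    refine eq_of_cross_eq hp0 (hPn.trans hp₁.symm) hθP ?_ ?_
    · have := hr.le_inner hR hb.angle (right_mem_Icc.2 hTpos.le)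
      rw [hy0] at this
      exact le_trans (by positivity) this
    · have h3 := norm_sub_sq_real p₁ p₀
      have h4 : ‖p₁ - p₀‖ ^ 2 ≤ b.R ^ 2 := by
        have := hd.trans hb.δ₀_le
        gcongr
      rw [hp₀, hp₁, real_inner_comm] at h3
      nlinarith
  refine ⟨T θ, y θ, hsol, hy0 θ, hPp, hout, ?_⟩
  rw [hr.arc.velocity_eq hTpos (left_mem_Icc.2 hTpos.le), hv0, hang θ hθ]
  linarith [hIρ θ hθ]

end Shooting


/-! ### First variation of the action of outer solutions -/

section Action

variable {F : Plane → Plane} {L : NNReal} {B S Tmax T T₁ T₂ : ℝ} {y₁ v₁ y₂ v₂ : ℝ → Plane}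

/-- First variation on a fixed time interval. -/
lemma IsArc.abs_action_sub_le {W : Plane → ℝ} {Ct Z : ℝ} (hT : 0 ≤ T) (hCt : 0 ≤ Ct) (hF : Continuous F)
    (h₁ : IsArc F T y₁ v₁) (h₂ : IsArc F T y₂ v₂)
    (hE₁ : ∀ t ∈ Icc 0 T, ‖v₁ t‖ ^ 2 = 2 * W (y₁ t))
    (hE₂ : ∀ t ∈ Icc 0 T, ‖v₂ t‖ ^ 2 = 2 * W (y₂ t))
    (hW : ∀ t ∈ Icc 0 T, |W (y₂ t) - W (y₁ t) - ⟪F (y₁ t), y₂ t - y₁ t⟫| ≤ Ct * ‖y₂ t - y₁ t‖ ^ 2)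
    (hZ : ∀ t ∈ Icc 0 T, ‖y₂ t - y₁ t‖ ≤ Z ∧ ‖v₂ t - v₁ t‖ ≤ Z) :
    |(∫ t in (0 : ℝ)..T, ‖v₂ t‖ ^ 2) - (∫ t in (0 : ℝ)..T, ‖v₁ t‖ ^ 2)
      - (⟪v₁ T, y₂ T - y₁ T⟫ - ⟪v₁ 0, y₂ 0 - y₁ 0⟫)| ≤ (Ct + 1 / 2) * Z ^ 2 * T := by
  have hIcc : uIcc 0 T = Icc 0 T := uIcc_of_le hT
  have hi₁ : IntervalIntegrable (fun t => ‖v₁ t‖ ^ 2) MeasureTheory.volume 0 T :=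
    ContinuousOn.intervalIntegrable (by rw [hIcc]; exact h₁.continuousOn_velocity.norm.pow 2)
  have hi₂ : IntervalIntegrable (fun t => ‖v₂ t‖ ^ 2) MeasureTheory.volume 0 T :=
    ContinuousOn.intervalIntegrable (by rw [hIcc]; exact h₂.continuousOn_velocity.norm.pow 2)
  set f : ℝ → ℝ := fun t => ⟪v₁ t, y₂ t - y₁ t⟫ with hf
  set f' : ℝ → ℝ := fun t => ⟪v₁ t, v₂ t - v₁ t⟫ + ⟪F (y₁ t), y₂ t - y₁ t⟫ with hf'
  have hfd : ∀ t ∈ Icc 0 T, HasDerivWithinAt f (f' t) (Icc 0 T) t := fun t ht =>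
    (h₁ t ht).2.inner ℝ ((h₂ t ht).1.sub (h₁ t ht).1)
  have hb : ∀ t ∈ Icc 0 T, |(‖v₂ t‖ ^ 2 - ‖v₁ t‖ ^ 2) - f' t| ≤ (Ct + 1 / 2) * Z ^ 2 := by
    intro t ht
    have h3 := hE₁ t ht
    have h4 := hE₂ t ht
    have h5 : ‖v₂ t‖ ^ 2 = ‖v₁ t‖ ^ 2 + 2 * ⟪v₁ t, v₂ t - v₁ t⟫ + ‖v₂ t - v₁ t‖ ^ 2 := by
      rw [← norm_add_sq_real, add_sub_cancel]
    -- Half of the difference of the squared speeds is expanded around `v₁`, the other half is a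
    -- difference of potentials by the energy. The linear terms of both form the derivative of the
    -- boundary term `f`, and the rest is quadratic.
    have e : (‖v₂ t‖ ^ 2 - ‖v₁ t‖ ^ 2) - f' t
        = (W (y₂ t) - W (y₁ t) - ⟪F (y₁ t), y₂ t - y₁ t⟫) + ‖v₂ t - v₁ t‖ ^ 2 / 2 := by
      simp only [hf']; linarith
    rw [e]
    refine (abs_add_le _ _).trans ?_
    rw [abs_of_nonneg (by positivity : 0 ≤ ‖v₂ t - v₁ t‖ ^ 2 / 2)]
    have h6 : ‖y₂ t - y₁ t‖ ^ 2 ≤ Z ^ 2 := by gcongr; exact (hZ t ht).1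
    have h7 : ‖v₂ t - v₁ t‖ ^ 2 ≤ Z ^ 2 := by gcongr; exact (hZ t ht).2
    have h8 := (hW t ht).trans (mul_le_mul_of_nonneg_left h6 hCt)
    linarith
  have hi' : IntervalIntegrable f' MeasureTheory.volume 0 T := by
    refine ContinuousOn.intervalIntegrable ?_
    rw [hIcc]
    exact (h₁.continuousOn_velocity.inner (h₂.continuousOn_velocity.sub h₁.continuousOn_velocity)).add
      ((hF.comp_continuousOn h₁.continuousOn).inner (h₂.continuousOn.sub h₁.continuousOn))
  have hint : ∫ t in (0 : ℝ)..T, f' t = f T - f 0 :=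
    intervalIntegral.integral_eq_sub_of_hasDerivAt_of_le hT
      (fun t ht => (hfd t ht).continuousWithinAt)
      (fun t ht => (hfd t (Ioo_subset_Icc_self ht)).hasDerivAt (Icc_mem_nhds ht.1 ht.2)) hi'
  rw [← hint, ← intervalIntegral.integral_sub hi₂ hi₁,
    ← intervalIntegral.integral_sub (hi₂.sub hi₁) hi']
  refine (intervalIntegral.norm_integral_le_of_norm_le_const
    (C := (Ct + 1 / 2) * Z ^ 2) fun t ht => (Real.norm_eq_abs _).trans_le (hb t ?_)).trans_eq ?_
  · rw [uIoc_of_le hT] at ht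
    exact Ioc_subset_Icc_self ht
  · rw [sub_zero, abs_of_nonneg hT]

/-- The action of an arc after the end of a nearby arc. -/
lemma IsArc.abs_tail_action_sub_le {Z X : ℝ} {w : Plane} (hT₁ : 0 ≤ T₁) (hTT : T₁ ≤ T₂)
    (hB : ∀ x, ‖F x‖ ≤ B) (h₂ : IsArc F T₂ y₂ v₂) (hS : ∀ t ∈ Icc 0 T₂, ‖v₂ t‖ ≤ S)
    (hw : ‖v₂ T₁ - w‖ ≤ Z) (hX : T₂ - T₁ ≤ X) :
    |(∫ t in T₁..T₂, ‖v₂ t‖ ^ 2) - ⟪w, y₂ T₂ - y₂ T₁⟫| ≤ (B * X + Z) * S * X := by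
  have hsub : Icc T₁ T₂ ⊆ Icc 0 T₂ := Icc_subset_Icc_left hT₁
  have hIcc : uIcc T₁ T₂ = Icc T₁ T₂ := uIcc_of_le hTT
  have hvc := h₂.continuousOn_velocity.mono hsub
  have hB0 : 0 ≤ B := (norm_nonneg _).trans (hB 0)
  have hZ0 : 0 ≤ Z := (norm_nonneg _).trans hw
  have hS0 : 0 ≤ S := (norm_nonneg _).trans (hS T₂ (right_mem_Icc.2 (hT₁.trans hTT)))
  have hX0 : 0 ≤ X := by linarith
  have hi₂ : IntervalIntegrable (fun t => ‖v₂ t‖ ^ 2) MeasureTheory.volume T₁ T₂ :=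
    ContinuousOn.intervalIntegrable (by rw [hIcc]; exact hvc.norm.pow 2)
  have hi : IntervalIntegrable (fun t => ⟪w, v₂ t⟫) MeasureTheory.volume T₁ T₂ :=
    ContinuousOn.intervalIntegrable (by rw [hIcc]; exact continuousOn_const.inner hvc)
  have hd : ∀ t ∈ Icc T₁ T₂, HasDerivWithinAt (fun t => ⟪w, y₂ t⟫) ⟪w, v₂ t⟫ (Icc T₁ T₂) t :=
    fun t ht => by
      have := (hasDerivWithinAt_const t (Icc T₁ T₂) w).inner ℝ ((h₂ t (hsub ht)).1.mono hsub)
      refine this.congr_deriv ?_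
      rw [inner_zero_left, add_zero]
  have hint : ∫ t in T₁..T₂, ⟪w, v₂ t⟫ = ⟪w, y₂ T₂⟫ - ⟪w, y₂ T₁⟫ :=
    intervalIntegral.integral_eq_sub_of_hasDerivAt_of_le hTT
      (fun t ht => (hd t ht).continuousWithinAt)
      (fun t ht => (hd t (Ioo_subset_Icc_self ht)).hasDerivAt (Icc_mem_nhds ht.1 ht.2)) hi
  rw [inner_sub_right, ← hint, ← intervalIntegral.integral_sub hi₂ hi, ← Real.norm_eq_abs]
  refine (intervalIntegral.norm_integral_le_of_norm_le_const (C := (B * X + Z) * S)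
    fun t ht => ?_).trans ?_
  · rw [uIoc_of_le hTT] at ht
    have ht' := Ioc_subset_Icc_self ht
    have h3 : ‖v₂ t - v₂ T₁‖ ≤ B * X := by
      have := norm_sub_le_mul_of_hasDerivWithinAt ht.1.le (f := v₂) (C := B)
        (fun s hs => ((h₂ s (hsub (Icc_subset_Icc_right ht.2 hs))).2.mono
          ((Icc_subset_Icc_right ht.2).trans hsub))) fun s hs => hB _
      exact this.trans (mul_le_mul_of_nonneg_left (by linarith [ht.2]) hB0)
    have h4 : ‖v₂ t - w‖ ≤ B * X + Z :=
      (norm_sub_le_norm_sub_add_norm_sub _ (v₂ T₁) _).trans (add_le_add h3 hw)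
    rw [← real_inner_self_eq_norm_sq, ← inner_sub_left]
    exact (norm_inner_le_norm (𝕜 := ℝ) _ _).trans (mul_le_mul h4 (hS t (hsub ht')) (norm_nonneg _)
      (by positivity))
  · rw [abs_of_nonneg (by linarith)]
    exact mul_le_mul_of_nonneg_left hX (by positivity)

/-- First variation of the action, for the arc of smaller duration. -/
lemma IsArc.abs_action_sub_le_of_le {W : Plane → ℝ} {Ct D C : ℝ} (hT₁ : 0 ≤ T₁) (hTT : T₁ ≤ T₂)
    (hTm : T₂ ≤ Tmax) (hCt : 0 ≤ Ct) (hF : LipschitzWith L F) (hB : ∀ x, ‖F x‖ ≤ B)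
    (h₁ : IsArc F T₁ y₁ v₁) (h₂ : IsArc F T₂ y₂ v₂) (hS : ∀ t ∈ Icc 0 T₂, ‖v₂ t‖ ≤ S)
    (hE₁ : ∀ t ∈ Icc 0 T₁, ‖v₁ t‖ ^ 2 = 2 * W (y₁ t))
    (hE₂ : ∀ t ∈ Icc 0 T₁, ‖v₂ t‖ ^ 2 = 2 * W (y₂ t))
    (hW : ∀ t ∈ Icc 0 T₁, |W (y₂ t) - W (y₁ t) - ⟪F (y₁ t), y₂ t - y₁ t⟫| ≤ Ct * ‖y₂ t - y₁ t‖ ^ 2)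
    (hD : ‖y₂ 0 - y₁ 0‖ + ‖v₂ 0 - v₁ 0‖ ≤ D) (hTD : T₂ - T₁ ≤ C * D) :
    |(∫ t in (0 : ℝ)..T₂, ‖v₂ t‖ ^ 2) - (∫ t in (0 : ℝ)..T₁, ‖v₁ t‖ ^ 2)
      - (⟪v₁ T₁, y₂ T₂ - y₁ T₁⟫ - ⟪v₁ 0, y₂ 0 - y₁ 0⟫)|
      ≤ ((Ct + 1 / 2) * gronwallConst L Tmax ^ 2 * Tmax
        + (B * C + gronwallConst L Tmax) * S * C) * D ^ 2 := by
  obtain ⟨G, hG⟩ : ∃ G, G = gronwallConst L Tmax := ⟨_, rfl⟩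
  have hT₁m : T₁ ∈ Icc 0 T₁ := right_mem_Icc.2 hT₁
  have hgr := fun t (ht : t ∈ Icc 0 T₁) =>
    h₁.gronwall_le hF (h₂.mono hTT) (hTT.trans hTm) hD ht
  rw [← hG] at hgr ⊢
  have e1 := IsArc.abs_action_sub_le hT₁ hCt hF.continuous h₁ (h₂.mono hTT) hE₁ hE₂ hW hgr
  have e2 := IsArc.abs_tail_action_sub_le hT₁ hTT hB h₂ hS (hgr T₁ hT₁m).2 hTD
  have hvc := h₂.continuousOn_velocity.norm.pow 2
  have hi : ∀ a b, 0 ≤ a → a ≤ b → b ≤ T₂ →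
      IntervalIntegrable (fun t => ‖v₂ t‖ ^ 2) MeasureTheory.volume a b := fun a b h0 hab hb =>
    ContinuousOn.intervalIntegrable (by rw [uIcc_of_le hab]; exact hvc.mono (Icc_subset_Icc h0 hb))
  rw [← intervalIntegral.integral_add_adjacent_intervals (hi 0 T₁ le_rfl hT₁ hTT)
    (hi T₁ T₂ hT₁ hTT le_rfl)]
  have e3 : y₂ T₂ - y₁ T₁ = (y₂ T₁ - y₁ T₁) + (y₂ T₂ - y₂ T₁) := by abel
  rw [e3, inner_add_right]
  have e4 := (abs_add_le _ _).trans (add_le_add e1 e2)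
  have e5 : (Ct + 1 / 2) * (G * D) ^ 2 * T₁ ≤ (Ct + 1 / 2) * (G * D) ^ 2 * Tmax :=
    mul_le_mul_of_nonneg_left (hTT.trans hTm) (by positivity)
  refine le_trans (le_of_eq ?_) (e4.trans ((add_le_add_left e5 _).trans (le_of_eq (by ring))))
  congr 1; ring

end Action


/-! ### First variation of the length of outer solutions -/

lemma IsSolution.jacobiLength_eq_action {T : ℝ} {y : ℝ → Plane} (h : IsSolution α m c T y) :
    jacobiLength α m c T y = 1 / Real.sqrt 2 * ∫ t in (0 : ℝ)..T, ‖velocity T y t‖ ^ 2 := by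
  rw [h.jacobiLength_eq, ← intervalIntegral.integral_const_mul]
  refine intervalIntegral.integral_congr fun t ht => ?_
  rw [uIcc_of_le h.1.le] at ht
  rw [h.norm_velocity_sq ht, ← mul_assoc, one_div_mul_eq_div, Real.div_sqrt]

section

variable {b : OuterBounds} {ρ δ₀ η' η μ C : ℝ} {F : Plane → Plane} {Ψ : Plane → ℝ}

/-- Lipschitz dependence of the outer solutions on their end points. -/
lemma IsOuterField.outer_compare (hb : b.IsAdapted ρ δ₀ η' η μ C)
    (hF : IsOuterField b α m c F Ψ η') (hα : 0 < α) {p₀ p₁ q₀ q₁ : Plane} (hp₀ : ‖p₀‖ = b.R)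
    (hp₁ : ‖p₁‖ = b.R) (hq₀ : ‖q₀‖ = b.R) (hq₁ : ‖q₁‖ = b.R) {T T' : ℝ} {y y' : ℝ → Plane}
    (h : IsOuterSolution α m c b.R ρ p₀ p₁ T y) (h' : IsOuterSolution α m c b.R ρ q₀ q₁ T' y')
    {KV : ℝ} (hV : |potential α m c q₀ - potential α m c p₀| ≤ KV * ‖q₀ - p₀‖)
    (hμ : (1 + 2 * KV) * ‖q₀ - p₀‖ ≤ μ) :
    ‖y' 0 - y 0‖ + ‖velocity T' y' 0 - velocity T y 0‖
        ≤ (1 + C * (1 + 2 * KV)) * ‖q₀ - p₀‖ + C * ‖q₁ - p₁‖ ∧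
      |T' - T| ≤ C * ((1 + C * (1 + 2 * KV)) * ‖q₀ - p₀‖ + C * ‖q₁ - p₁‖) := by
  obtain ⟨r, i, hc⟩ := hF.isReturnArc hb.small hα hb.ρ_le hb.momentum hp₀ hp₁ h
  obtain ⟨r', i', hc'⟩ := hF.isReturnArc hb.small hα hb.ρ_le hb.momentum hq₀ hq₁ h'
  have h0m : (0 : ℝ) ∈ Icc 0 T := left_mem_Icc.2 h.1.1.le
  have h0m' : (0 : ℝ) ∈ Icc 0 T' := left_mem_Icc.2 h'.1.1.le
  have e0 : y' 0 - y 0 = q₀ - p₀ := by rw [h.2.1, h'.2.1]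
  have e1 : y' T' - y T = q₁ - p₁ := by rw [h.2.2.1, h'.2.2.1]
  have hX : |‖velocity T' y' 0‖ ^ 2 - ‖velocity T y 0‖ ^ 2| ≤ 2 * KV * ‖q₀ - p₀‖ := by
    rw [h.1.norm_velocity_sq h0m, h'.1.norm_velocity_sq h0m', h.2.1, h'.2.1, ← mul_sub,
      sub_sub_sub_cancel_right, abs_mul, abs_two, mul_assoc]
    exact mul_le_mul_of_nonneg_left hV zero_le_two
  have hη := hb.close (y 0) (velocity T y 0) (y' 0) (velocity T' y' 0) _ r.start (r.speed 0 h0m)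
    (r'.speed 0 h0m') i i' hc hc' hX (by rw [e0]; linarith)
  obtain ⟨h1, -, h3⟩ := hb.compare F Ψ T T' _ _ _ _ _ hF.nearly r r' i i' hX hη
  rw [e0, e1] at h3
  have h4 : ‖y' 0 - y 0‖ + ‖velocity T' y' 0 - velocity T y 0‖
      ≤ (1 + C * (1 + 2 * KV)) * ‖q₀ - p₀‖ + C * ‖q₁ - p₁‖ := by
    rw [e0]; linarith
  exact ⟨h4, h1.trans (mul_le_mul_of_nonneg_left h4 hb.C_pos.le)⟩

/-- The velocities and the duration depend in a Lipschitz way on the end points, so the quadratic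
error of the action is quadratic in the end displacements. Here `ν` and `K` are uniform in the end
points but may depend on the centres, which are fixed when differentiating. -/
lemma IsOuterField.exists_outer_variation (hb : b.IsAdapted ρ δ₀ η' η μ C)
    (hF : IsOuterField b α m c F Ψ η') (hα : 0 < α) :
    ∃ ν : ℝ, 0 < ν ∧ ∃ K : ℝ, ∀ (p₀ p₁ q₀ q₁ : Plane) (T T' : ℝ) (y y' : ℝ → Plane),
      ‖p₀‖ = b.R → ‖p₁‖ = b.R → ‖q₀‖ = b.R → ‖q₁‖ = b.R →
      IsOuterSolution α m c b.R ρ p₀ p₁ T y → IsOuterSolution α m c b.R ρ q₀ q₁ T' y' →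
      ‖q₀ - p₀‖ + ‖q₁ - p₁‖ ≤ ν →
      |jacobiLength α m c T' y' - jacobiLength α m c T y - 1 / Real.sqrt 2 *
        (⟪velocity T y T, q₁ - p₁⟫ - ⟪velocity T y 0, q₀ - p₀⟫)|
        ≤ K * (‖q₀ - p₀‖ + ‖q₁ - p₁‖) ^ 2 := by
  have hR := b.R_pos
  have hS := b.S_pos
  have hB := b.B_pos
  have hC := hb.C_pos
  have hTm := b.Tmax_pos
  set A : Set Plane := closedBall 0 b.R₂ ∩ {x | b.R ≤ ‖x‖}
  have hA : IsCompact A := (isCompact_closedBall _ _).inter_right (isClosed_le continuous_const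
    continuous_norm)
  have hmemA : ∀ x : Plane, b.R ≤ ‖x‖ → ‖x‖ ≤ b.R₂ → x ∈ A := fun x h1 h2 => ⟨by simpa using h2, h1⟩
  obtain ⟨ηt, hηt, Ct, hCt, hTay⟩ := exists_taylor_bound hA (isOpen_offCentres c)
    (fun x hx => hF.off x hx.2) (fun x hx => hasGradientAt_potential hα m c hx)
    (fun x hx => contDiffAt_force α m c hx)
  have hTay' : ∀ x x' : Plane, b.R ≤ ‖x‖ → ‖x‖ ≤ b.R₂ → ‖x' - x‖ ≤ ηt →
      |(potential α m c x' - 1) - (potential α m c x - 1) - ⟪F x, x' - x⟫| ≤ Ct * ‖x' - x‖ ^ 2 := by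
    intro x x' h1 h2 h3
    have := (hTay x (hmemA x h1 h2) (x' - x) h3).2
    rw [sub_sub_sub_cancel_right]
    rwa [add_sub_cancel, ← hF.eq_force x h1 h2] at this
  obtain ⟨KV, hKV⟩ : ∃ KV, KV = b.B + Ct * ηt := ⟨_, rfl⟩
  have hKV0 : 0 < KV := hKV ▸ by positivity
  have hVlip : ∀ x x' : Plane, ‖x‖ = b.R → ‖x' - x‖ ≤ ηt →
      |potential α m c x' - potential α m c x| ≤ KV * ‖x' - x‖ := by
    intro x x' h1 h3
    have h4 := hTay' x x' h1.ge (by linarith [b.R_le, b.R₃_lt]) h3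
    rw [sub_sub_sub_cancel_right] at h4
    have h5 : |⟪F x, x' - x⟫| ≤ b.B * ‖x' - x‖ := (abs_real_inner_le_norm _ _).trans
      (mul_le_mul_of_nonneg_right (hF.nearly.bounded x) (norm_nonneg _))
    have h6 : Ct * ‖x' - x‖ ^ 2 ≤ Ct * ηt * ‖x' - x‖ := by
      rw [sq, mul_assoc]
      gcongr
    have h7 := abs_sub_abs_le_abs_sub (potential α m c x' - potential α m c x) ⟪F x, x' - x⟫
    rw [hKV]; linarith
  obtain ⟨G, hG⟩ : ∃ G, G = gronwallConst b.L b.Tmax := ⟨_, rfl⟩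
  have hG0 : 0 < G := hG ▸ gronwallConst_pos _ _
  obtain ⟨C₂, hC₂⟩ : ∃ C₂, C₂ = 1 + C * (1 + 2 * KV) := ⟨_, rfl⟩
  have hC₂0 : 0 < C₂ := hC₂ ▸ by positivity
  have hCC₂ : C ≤ C₂ := by
    have : 0 ≤ C * (2 * KV) := by positivity
    rw [hC₂]; linarith
  obtain ⟨K₁, hK₁⟩ : ∃ K₁, K₁ = (Ct + 1 / 2) * G ^ 2 * b.Tmax + (b.B * C + G) * b.S * C := ⟨_, rfl⟩
  obtain ⟨ν, hν, hν1, hν2, hν3⟩ : ∃ ν, 0 < ν ∧ ν ≤ ηt ∧ (1 + 2 * KV) * ν ≤ μ ∧ G * (C₂ * ν) ≤ ηt := by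
    have := hb.μ_pos
    refine ⟨min ηt (min (μ / (1 + 2 * KV)) (ηt / (G * C₂))), by positivity, min_le_left _ _, ?_, ?_⟩
    · rw [mul_comm, ← le_div_iff₀ (by positivity)]
      exact (min_le_right _ _).trans (min_le_left _ _)
    · rw [← mul_assoc, mul_comm, ← le_div_iff₀ (by positivity)]
      exact (min_le_right _ _).trans (min_le_right _ _)
  refine ⟨ν, hν, 1 / Real.sqrt 2 * (K₁ * C₂ ^ 2 + (G * C₂ + b.B * (C * C₂)) + C₂), ?_⟩
  intro p₀ p₁ q₀ q₁ T T' y y' hp₀ hp₁ hq₀ hq₁ h h' hδ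
  obtain ⟨δ, hδe⟩ : ∃ δ, δ = ‖q₀ - p₀‖ + ‖q₁ - p₁‖ := ⟨_, rfl⟩
  rw [← hδe] at hδ ⊢
  have ha0 := norm_nonneg (q₀ - p₀)
  have hP0 := norm_nonneg (q₁ - p₁)
  have ha : ‖q₀ - p₀‖ ≤ δ := by linarith
  have hP : ‖q₁ - p₁‖ ≤ δ := by linarith
  have hδ0 : 0 ≤ δ := ha0.trans ha
  obtain ⟨hD, hTD⟩ := hF.outer_compare hb hα hp₀ hp₁ hq₀ hq₁ h h' (hVlip p₀ q₀ hp₀ (by linarith))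
    ((mul_le_mul_of_nonneg_left (ha.trans hδ) (by positivity)).trans hν2)
  have hDδ : (1 + C * (1 + 2 * KV)) * ‖q₀ - p₀‖ + C * ‖q₁ - p₁‖ ≤ C₂ * δ := by
    rw [← hC₂, hδe, mul_add]
    exact add_le_add_right (mul_le_mul_of_nonneg_right hCC₂ hP0) _
  replace hD := hD.trans hDδ
  replace hTD := hTD.trans (mul_le_mul_of_nonneg_left hDδ hC.le)
  have hGη : G * (C₂ * δ) ≤ ηt :=
    le_trans (by gcongr) hν3
  obtain ⟨r, -, -⟩ := hF.isReturnArc hb.small hα hb.ρ_le hb.momentum hp₀ hp₁ h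
  obtain ⟨r', -, -⟩ := hF.isReturnArc hb.small hα hb.ρ_le hb.momentum hq₀ hq₁ h'
  have hT := h.1.1
  have hT' := h'.1.1
  have hL := hF.nearly.lipschitz
  rw [h.1.jacobiLength_eq_action, h'.1.jacobiLength_eq_action, ← mul_sub, ← mul_sub, abs_mul,
    abs_of_nonneg (by positivity), mul_assoc]
  refine mul_le_mul_of_nonneg_left ?_ (by positivity)
  have hn1 : 0 ≤ (G * C₂ + b.B * (C * C₂) + C₂) * δ ^ 2 := by positivity
  -- The variation of the action is centred at the arc of smaller duration. If this is the displaced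
  -- arc, its end velocities are replaced by those of `y`; they differ by a multiple of `δ` and are
  -- paired with displacements of size at most `δ`, so the change is again quadratic.
  rcases le_total T T' with hTT | hTT
  · have := IsArc.abs_action_sub_le_of_le (W := fun x => potential α m c x - 1) hT.le hTT r'.time_le hCt
      hL hF.nearly.bounded r.arc r'.arc r'.speed (fun t ht => h.1.norm_velocity_sq ht)
      (fun t ht => h'.1.norm_velocity_sq ⟨ht.1, ht.2.trans hTT⟩) (fun t ht => ?_) hD
      ((le_abs_self _).trans hTD)
    · rw [h.2.1, h'.2.1, h.2.2.1, h'.2.2.1, ← hG, ← hK₁] at this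
      linarith
    · refine hTay' _ _ (r.mem t ht).1 (r.mem t ht).2 (le_trans ?_ hGη)
      rw [hG]
      exact (r.arc.gronwall_le hL (r'.arc.mono hTT) r.time_le hD ht).1
  · rw [abs_sub_comm] at hTD
    have hD' : ‖y 0 - y' 0‖ + ‖velocity T y 0 - velocity T' y' 0‖ ≤ C₂ * δ := by
      rwa [norm_sub_rev (y 0), norm_sub_rev (velocity T y 0)]
    have hgr := fun t (ht : t ∈ Icc 0 T') =>
      r'.arc.gronwall_le hL (r.arc.mono hTT) r'.time_le hD' ht
    have := IsArc.abs_action_sub_le_of_le (W := fun x => potential α m c x - 1) hT'.le hTT r.time_le hCt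
      hL hF.nearly.bounded r'.arc r.arc r.speed (fun t ht => h'.1.norm_velocity_sq ht)
      (fun t ht => h.1.norm_velocity_sq ⟨ht.1, ht.2.trans hTT⟩) (fun t ht => ?_) hD'
      ((le_abs_self _).trans hTD)
    · rw [h.2.1, h'.2.1, h.2.2.1, h'.2.2.1, ← hG, ← hK₁] at this
      have hT'm : T' ∈ Icc 0 T' := right_mem_Icc.2 hT'.le
      have hvT : ‖velocity T' y' T' - velocity T y T‖ ≤ G * (C₂ * δ) + b.B * (C * (C₂ * δ)) := by
        have h1 := (hgr T' hT'm).2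
        rw [norm_sub_rev, ← hG] at h1
        have hsub : Icc T' T ⊆ Icc 0 T := Icc_subset_Icc_left hT'.le
        have h2 := norm_sub_le_mul_of_hasDerivWithinAt hTT (f := velocity T y) (C := b.B)
          (fun s hs => (r.arc s (hsub hs)).2.mono hsub) fun s hs => hF.nearly.bounded _
        have h3 : b.B * (T - T') ≤ b.B * (C * (C₂ * δ)) :=
          mul_le_mul_of_nonneg_left ((le_abs_self _).trans hTD) hB.le
        rw [norm_sub_rev] at h2
        exact (norm_sub_le_norm_sub_add_norm_sub _ (velocity T y T') _).trans
          (add_le_add h1 (h2.trans h3))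
      have i1 : |⟪velocity T' y' T' - velocity T y T, q₁ - p₁⟫|
          ≤ (G * (C₂ * δ) + b.B * (C * (C₂ * δ))) * δ :=
        (abs_real_inner_le_norm _ _).trans (mul_le_mul hvT hP hP0 (by positivity))
      have hv0 : ‖velocity T' y' 0 - velocity T y 0‖ ≤ C₂ * δ := by
        linarith [norm_nonneg (y' 0 - y 0)]
      have i2 : |⟪velocity T' y' 0 - velocity T y 0, q₀ - p₀⟫| ≤ C₂ * δ * δ :=
        (abs_real_inner_le_norm _ _).trans (mul_le_mul hv0 ha ha0 (by positivity))
      rw [← neg_sub q₁ p₁, ← neg_sub q₀ p₀, inner_neg_right, inner_neg_right] at this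
      rw [inner_sub_left, abs_le] at i1 i2
      rw [abs_le] at this ⊢
      constructor <;> linarith [this.1, this.2, i1.1, i1.2, i2.1, i2.2]
    · refine hTay' _ _ (r'.mem t ht).1 (r'.mem t ht).2 (le_trans ?_ hGη)
      rw [hG]
      exact (hgr t ht).1

end


/-! ### Differentials of the lengths -/

/-- The covector `⟨v, ·⟩ / √2`. -/
noncomputable def momentum (v : Plane) : Plane →L[ℝ] ℝ := (1 / Real.sqrt 2) • innerSL ℝ v

lemma momentum_apply (v φ : Plane) : momentum v φ = 1 / Real.sqrt 2 * ⟪v, φ⟫ := by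
  simp [momentum]

section Inner

variable {U s : Set Plane} {a p : Plane} {T : Plane → ℝ} {y : Plane → ℝ → Plane}

lemma hasFDerivWithinAt_inner_length_right (hα : 0 < α) (hU : IsStronglyConvex α m c U)
    (hs : s ⊆ closure U) (ha : a ∈ closure U) (hp : p ∈ s) (has : a ∉ s)
    (h : ∀ q ∈ s, IsInnerArc α m c a q (T q) (y q)) :
    HasFDerivWithinAt (fun q => jacobiLength α m c (T q) (y q))
      (momentum (velocity (T p) (y p) (T p))) s p := by
  have hap : a ≠ p := fun e => has (e ▸ hp)
  have := IsInnerArc.jacobiLength_isLittleO (l := 𝓝[s] p) (P := fun _ => a) (Q := fun q => q)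
    (T := T) (y := y) hα hU
    (by filter_upwards [self_mem_nhdsWithin] with q hq using ⟨ha, hs hq, h q hq⟩)
    tendsto_const_nhds nhdsWithin_le_nhds ha (hs hp) hap (h p hp)
  refine .of_isLittleO ?_
  simp only [sub_self, inner_zero_right, sub_zero, norm_zero, norm_nonneg, max_eq_right] at this
  simpa only [momentum_apply] using this.trans_le fun q => (norm_norm _).le

lemma hasFDerivWithinAt_inner_length_left (hα : 0 < α) (hU : IsStronglyConvex α m c U)
    (hs : s ⊆ closure U) (ha : a ∈ closure U) (hp : p ∈ s) (has : a ∉ s)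
    (h : ∀ q ∈ s, IsInnerArc α m c q a (T q) (y q)) :
    HasFDerivWithinAt (fun q => jacobiLength α m c (T q) (y q))
      (-momentum (velocity (T p) (y p) 0)) s p := by
  have hap : p ≠ a := fun e => has (e ▸ hp)
  have := IsInnerArc.jacobiLength_isLittleO (l := 𝓝[s] p) (P := fun q => q) (Q := fun _ => a)
    (T := T) (y := y) hα hU
    (by filter_upwards [self_mem_nhdsWithin] with q hq using ⟨hs hq, ha, h q hq⟩)
    nhdsWithin_le_nhds tendsto_const_nhds (hs hp) ha hap (h p hp)
  refine .of_isLittleO ?_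
  simp only [sub_self, inner_zero_right, zero_sub, norm_zero, norm_nonneg, max_eq_left] at this
  simpa only [neg_apply, momentum_apply, mul_neg] using this.trans_le fun q => (norm_norm _).le

end Inner

section Outer

variable {b : OuterBounds} {ρ δ₀ η' η μ C : ℝ} {F : Plane → Plane} {Ψ : Plane → ℝ}
  {s : Set Plane} {a p : Plane} {T : Plane → ℝ} {y : Plane → ℝ → Plane}

lemma hasFDerivWithinAt_of_quadratic {f : Plane → ℝ} {f' : Plane →L[ℝ] ℝ} {K ν : ℝ} (hν : 0 < ν)
    (h : ∀ q ∈ s, ‖q - p‖ ≤ ν → |f q - f p - f' (q - p)| ≤ K * ‖q - p‖ ^ 2) :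
    HasFDerivWithinAt f f' s p := by
  refine .of_isLittleO ?_
  have hsub : Tendsto (fun q => q - p) (𝓝[s] p) (𝓝 0) := by
    have : Tendsto (fun q => q - p) (𝓝 p) (𝓝 (p - p)) := (continuous_id.sub continuous_const).tendsto p
    rw [sub_self] at this
    exact this.mono_left nhdsWithin_le_nhds
  have h1 : (fun q => f q - f p - f' (q - p)) =O[𝓝[s] p] fun q => ‖q - p‖ ^ 2 := by
    refine Asymptotics.IsBigO.of_bound K ?_
    filter_upwards [self_mem_nhdsWithin, hsub.norm.eventually
      (ge_mem_nhds (by rwa [norm_zero] : ‖(0 : Plane)‖ < ν))] with q hq hqν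
    rw [norm_pow, norm_norm]
    exact h q hq hqν
  exact h1.trans_isLittleO ((Asymptotics.isLittleO_norm_pow_id one_lt_two).comp_tendsto hsub)

lemma IsOuterField.hasFDerivWithinAt_outer_length_right (hb : b.IsAdapted ρ δ₀ η' η μ C)
    (hF : IsOuterField b α m c F Ψ η') (hα : 0 < α) (hs : s ⊆ sphere 0 b.R)
    (ha : a ∈ sphere (0 : Plane) b.R) (hp : p ∈ s)
    (h : ∀ q ∈ s, IsOuterSolution α m c b.R ρ a q (T q) (y q)) :
    HasFDerivWithinAt (fun q => jacobiLength α m c (T q) (y q))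
      (momentum (velocity (T p) (y p) (T p))) s p := by
  obtain ⟨ν, hν, K, H⟩ := hF.exists_outer_variation hb hα
  refine hasFDerivWithinAt_of_quadratic hν (K := K) fun q hq hqν => ?_
  have := H a p a q _ _ _ _ (mem_sphere_zero_iff_norm.1 ha) (mem_sphere_zero_iff_norm.1 (hs hp))
    (mem_sphere_zero_iff_norm.1 ha) (mem_sphere_zero_iff_norm.1 (hs hq)) (h p hp) (h q hq)
    (by rwa [sub_self, norm_zero, zero_add])
  simpa only [momentum_apply, sub_self, inner_zero_right, sub_zero, norm_zero, zero_add] using this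

lemma IsOuterField.hasFDerivWithinAt_outer_length_left (hb : b.IsAdapted ρ δ₀ η' η μ C)
    (hF : IsOuterField b α m c F Ψ η') (hα : 0 < α) (hs : s ⊆ sphere 0 b.R)
    (ha : a ∈ sphere (0 : Plane) b.R) (hp : p ∈ s)
    (h : ∀ q ∈ s, IsOuterSolution α m c b.R ρ q a (T q) (y q)) :
    HasFDerivWithinAt (fun q => jacobiLength α m c (T q) (y q))
      (-momentum (velocity (T p) (y p) 0)) s p := by
  obtain ⟨ν, hν, K, H⟩ := hF.exists_outer_variation hb hα
  refine hasFDerivWithinAt_of_quadratic hν (K := K) fun q hq hqν => ?_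
  have := H p a q a _ _ _ _ (mem_sphere_zero_iff_norm.1 (hs hp)) (mem_sphere_zero_iff_norm.1 ha)
    (mem_sphere_zero_iff_norm.1 (hs hq)) (mem_sphere_zero_iff_norm.1 ha) (h p hp) (h q hq)
    (by rwa [sub_self, norm_zero, add_zero])
  simpa only [neg_apply, momentum_apply, sub_self, inner_zero_right, zero_sub,
    norm_zero, add_zero, mul_neg] using this

end Outer

end

end NCentre

/-! ### Assembly of the differentials -/

theorem mainTheorem3 (α : ℝ) (hα₁ : 1 ≤ α) (hα₂ : α < 2) {N : ℕ} (m : Fin N → ℝ)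
    (hm : ∀ k, 0 < m k) (R : ℝ) (hR : 0 < R) (hRM : R < ((∑ k, m k) / α) ^ (1 / α)) :
    ∃ ρ : ℝ, 0 < ρ ∧ ∃ δ₀ : ℝ, 0 < δ₀ ∧ ∃ ε₁ : ℝ, 0 < ε₁ ∧
    ∀ ε : ℝ, 0 < ε → ε < ε₁ → ∀ c : Fin N → NCentre.Plane, (∀ k, ‖c k‖ ≤ ε) →
      -- the outer solutions are well defined
      (∀ p₀ ∈ sphere (0 : NCentre.Plane) R, ∀ p₁ ∈ sphere (0 : NCentre.Plane) R, dist p₀ p₁ ≤ δ₀ →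
        ∃ (T : ℝ) (y : ℝ → NCentre.Plane), NCentre.IsOuterSolution α m c R ρ p₀ p₁ T y ∧
          ∀ (T' : ℝ) (y' : ℝ → NCentre.Plane), NCentre.IsOuterSolution α m c R ρ p₀ p₁ T' y' →
            T' = T ∧ EqOn y' y (Icc 0 T)) ∧
      -- the reparametrized minimal geodesics are well defined
      (∀ U : Set NCentre.Plane, NCentre.IsStronglyConvex α m c U →
        ∀ p ∈ closure U, ∀ q ∈ closure U, p ≠ q →
          ∃ (T : ℝ) (y : ℝ → NCentre.Plane), NCentre.IsInnerArc α m c p q T y ∧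
            ∀ (T' : ℝ) (y' : ℝ → NCentre.Plane), NCentre.IsInnerArc α m c p q T' y' →
              T' = T ∧ EqOn y' y (Icc 0 T)) ∧
      ∀ δ : ℝ, 0 < δ → δ ≤ δ₀ →
      ∀ (Text : NCentre.Plane → NCentre.Plane → ℝ)
        (yext : NCentre.Plane → NCentre.Plane → ℝ → NCentre.Plane),
        (∀ p₀ ∈ sphere (0 : NCentre.Plane) R, ∀ p₁ ∈ sphere (0 : NCentre.Plane) R,
          dist p₀ p₁ ≤ δ →
            NCentre.IsOuterSolution α m c R ρ p₀ p₁ (Text p₀ p₁) (yext p₀ p₁)) →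
      ∀ U : Set NCentre.Plane, NCentre.IsStronglyConvex α m c U →
      ∀ (Tin : NCentre.Plane → NCentre.Plane → ℝ)
        (yin : NCentre.Plane → NCentre.Plane → ℝ → NCentre.Plane),
        (∀ p ∈ closure U, ∀ q ∈ closure U, p ≠ q →
          NCentre.IsInnerArc α m c p q (Tin p q) (yin p q)) →
      ∀ ptilde ∈ U, ‖ptilde‖ < R → ∀ pbar ∈ sphere (0 : NCentre.Plane) R,
        -- even index: the inner arc arrives at the junction point, the outer solution leaves it
        (∀ p ∈ NCentre.admissible R δ U pbar,
          ∃ dG : NCentre.Plane →L[ℝ] ℝ,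
            HasFDerivWithinAt
              (fun q => NCentre.jacobiLength α m c (Tin ptilde q) (yin ptilde q)
                + NCentre.jacobiLength α m c (Text q pbar) (yext q pbar))
              dG (NCentre.admissible R δ U pbar) p ∧
            ∀ φ ∈ (Submodule.span ℝ {p})ᗮ,
              dG φ = 1 / Real.sqrt 2 *
                ⟪NCentre.velocity (Tin ptilde p) (yin ptilde p) (Tin ptilde p)
                  - NCentre.velocity (Text p pbar) (yext p pbar) 0, φ⟫) ∧
        -- odd index: the outer solution arrives at the junction point, the inner arc leaves it
        (∀ p ∈ NCentre.admissible R δ U pbar,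
          ∃ dG : NCentre.Plane →L[ℝ] ℝ,
            HasFDerivWithinAt
              (fun q => NCentre.jacobiLength α m c (Text pbar q) (yext pbar q)
                + NCentre.jacobiLength α m c (Tin q ptilde) (yin q ptilde))
              dG (NCentre.admissible R δ U pbar) p ∧
            ∀ φ ∈ (Submodule.span ℝ {p})ᗮ,
              dG φ = 1 / Real.sqrt 2 *
                ⟪NCentre.velocity (Text pbar p) (yext pbar p) (Text pbar p)
                  - NCentre.velocity (Tin p ptilde) (yin p ptilde) 0, φ⟫) := by
  have hα : 0 < α := by linarith
  obtain ⟨b, Ψ, rfl, H⟩ := NCentre.exists_isOuterField hα hm hR hRM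
  obtain ⟨ρ, δ₀, η', η, μ, C, hb⟩ := b.exists_isAdapted
  -- The bounds `b`, and hence `ρ`, `δ₀` and `η'`, are fixed before the centres; `ε₁` then only has
  -- to make the field error at most `η'`.
  obtain ⟨ε₁, hε₁, Hε⟩ := H η' hb.η'_pos
  refine ⟨ρ, hb.ρ_pos, δ₀, hb.δ₀_pos, ε₁, hε₁, fun ε hε hεlt c hc => ?_⟩
  obtain ⟨F, hF⟩ := Hε ε hε hεlt c hc
  refine ⟨fun p₀ hp₀ p₁ hp₁ hd => ?_, fun U hU p hp q hq hpq => ?_, ?_⟩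
  · rw [mem_sphere_zero_iff_norm] at hp₀ hp₁
    obtain ⟨T, y, h⟩ := hF.exists_outer hb hα hp₀ hp₁ (by rwa [← dist_eq_norm, dist_comm])
    exact ⟨T, y, h, fun T' y' h' => hF.outer_unique hb hα hp₀ hp₁ h h'⟩
  · obtain ⟨T, y, h, -, huniq⟩ := hU.existsUnique_isInnerArc hα hp hq hpq
    exact ⟨T, y, h, huniq⟩
  · intro δ _ _ Text yext hext U hU Tin yin hin a ha haR pbar hpbar
    have hs₁ : NCentre.admissible b.R δ U pbar ⊆ closure U := fun q hq => hq.2.1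
    have hs₂ : NCentre.admissible b.R δ U pbar ⊆ sphere 0 b.R := fun q hq => hq.1
    -- The interior point is off the circle, so it differs from every junction point and the inner
    -- arcs never degenerate.
    have has : a ∉ NCentre.admissible b.R δ U pbar := fun h =>
      haR.ne (mem_sphere_zero_iff_norm.1 h.1)
    have ha' : a ∈ closure U := subset_closure ha
    have hne : ∀ q ∈ NCentre.admissible b.R δ U pbar, a ≠ q := fun q hq e => has (e ▸ hq)
    refine ⟨fun p hp => ⟨_, (NCentre.hasFDerivWithinAt_inner_length_right hα hU hs₁ ha' hp has
      fun q hq => hin a ha' q (hs₁ hq) (hne q hq)).add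
      (hF.hasFDerivWithinAt_outer_length_left hb hα hs₂ hpbar hp fun q hq =>
        hext q hq.1 pbar hpbar (by rw [dist_comm]; exact hq.2.2)), fun φ _ => ?_⟩,
      fun p hp => ⟨_, (hF.hasFDerivWithinAt_outer_length_right hb hα hs₂ hpbar hp fun q hq =>
        hext pbar hpbar q hq.1 hq.2.2).add
      (NCentre.hasFDerivWithinAt_inner_length_left hα hU hs₁ ha' hp has
        fun q hq => hin q (hs₁ hq) a ha' (hne q hq).symm), fun φ _ => ?_⟩⟩
    · rw [add_apply, neg_apply, NCentre.momentum_apply, NCentre.momentum_apply, inner_sub_left]; ring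
    · rw [add_apply, neg_apply, NCentre.momentum_apply, NCentre.momentum_apply, inner_sub_left]; ring
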